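/- Two sets \emph{overlap} if they intersect and neither contains the other. An \emph{overlap representation} of a finite graph $G$ is an assignment $f$ of finite sets to the vertices of $G$ such that, for all vertices $u,v$, $uv$ is an edge if and only if $f(u)$ and $f(v)$ overlap; its \emph{size} is $\left|\bigcup_v f(v)\right|$, and the \emph{overlap number} $\varphi(G)$ is the minimum size of an overlap representation of $G$. A \emph{skeleton} is a tree in which the neighbor of every vertex of degree $1$ has degree $2$. \textbf{Theorem.} If $T$ is a tree with at least three vertices, then $\varphi(T)$ equals the number of vertices in a largest skeleton contained in $T$ as a subtree (such a largest skeleton exists, and any choice of it gives the same number). Furthermore, there is a linear-time algorithm to produce an optimal overlap representation of a tree: there are a program for the unit-cost successor RAM (a random access machine whose only arithmetic operations are successor and predecessor) and a constant $C$ such that, for every $n\ge 1$ and every tree $T$ on the vertex set $\{0,\dots,n-1\}$, given as a list of its edges in any order and orientation, the program halts within $Cn$ steps and outputs an overlap representation $f$ of $T$ of size $\varphi(T)$. In the output, each set $f(v)\subset\mathbb N$ is given by a pointer to a linked list of pairwise disjoint nonempty integer intervals $[l,r)$ whose union is $f(v)$. -/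

import Mathlib

namespace OverlapTree

/-! ### Overlap representations -/

/-- Two sets overlap if they intersect and neither contains the other. -/
def Overlap (A B : Finset ℕ) : Prop :=
  (A ∩ B).Nonempty ∧ ¬ A ⊆ B ∧ ¬ B ⊆ A

/-- `f` is a finite overlap representation of `G`. (Finite sets of arbitrary elements can be
relabelled by natural numbers.) -/
def IsOverlapRep {V : Type*} (G : SimpleGraph V) (f : V → Finset ℕ) : Prop :=
  ∀ u v : V, G.Adj u v ↔ Overlap (f u) (f v)

/-- The size of a representation: the number of elements in the union of the assigned sets. -/
def size {V : Type*} [Fintype V] (f : V → Finset ℕ) : ℕ :=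
  (Finset.univ.biUnion f).card

/-- The overlap number: the minimum size of a finite overlap representation. -/
noncomputable def overlapNumber {V : Type*} [Fintype V] (G : SimpleGraph V) : ℕ :=
  sInf {k : ℕ | ∃ f : V → Finset ℕ, IsOverlapRep G f ∧ size f = k}

/-! ### Skeletons -/

/-- A skeleton is a tree in which the neighbor of any leaf (vertex of degree 1) has degree 2. -/
def IsSkeleton {W : Type*} (G : SimpleGraph W) : Prop :=
  G.IsTree ∧ ∀ v w : W, (G.neighborSet v).ncard = 1 → G.Adj v w → (G.neighborSet w).ncard = 2

/-- `S` is a skeleton contained in `T` with the largest possible number of vertices. -/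
def IsLargestSkeleton {V : Type*} (T : SimpleGraph V) (S : T.Subgraph) : Prop :=
  IsSkeleton S.coe ∧ ∀ S' : T.Subgraph, IsSkeleton S'.coe → S'.verts.ncard ≤ S.verts.ncard

/-! ### Random access machine

A unit-cost successor RAM, presented as a structured programming language: registers and
finitely many arrays (those a program mentions) of natural numbers, whose only arithmetic is
successor and predecessor.  All numbers occurring in the first `t` steps are therefore at most
`t` plus the largest constant of the program and the largest number in the input. -/

/-- A memory state: `reg x` is the content of register `x`, and `arr a i` is the content of cell
`i` of array `a`. -/
structure State where
  reg : ℕ → ℕ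
  arr : ℕ → ℕ → ℕ

/-- Expressions. -/
inductive Expr where
  | const (c : ℕ)
  | reg (x : ℕ)
  | read (a : ℕ) (e : Expr)
  | succ (e : Expr)
  | pred (e : Expr)

/-- The value of an expression. -/
def Expr.eval (σ : State) : Expr → ℕ
  | .const c => c
  | .reg x => σ.reg x
  | .read a e => σ.arr a (e.eval σ)
  | .succ e => e.eval σ + 1
  | .pred e => e.eval σ - 1

/-- The number of elementary operations in the evaluation of an expression. -/
def Expr.cost : Expr → ℕ
  | .const _ => 1
  | .reg _ => 1
  | .read _ e => e.cost + 1
  | .succ e => e.cost + 1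
  | .pred e => e.cost + 1

/-- Tests: equality and order comparison of two expressions. -/
inductive Test where
  | eq (e₁ e₂ : Expr)
  | lt (e₁ e₂ : Expr)

/-- Truth of a test in a state. -/
def Test.Holds (σ : State) : Test → Prop
  | .eq e₁ e₂ => e₁.eval σ = e₂.eval σ
  | .lt e₁ e₂ => e₁.eval σ < e₂.eval σ

/-- The number of elementary operations in the evaluation of a test. -/
def Test.cost : Test → ℕ
  | .eq e₁ e₂ => e₁.cost + e₂.cost + 1
  | .lt e₁ e₂ => e₁.cost + e₂.cost + 1

/-- Programs. -/
inductive Prog where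
  | skip
  | assign (x : ℕ) (e : Expr)
  | store (a : ℕ) (i e : Expr)
  | seq (p q : Prog)
  | ite (b : Test) (p q : Prog)
  | while (b : Test) (p : Prog)

/-- Write `c` into register `x`. -/
def State.setReg (σ : State) (x c : ℕ) : State where
  reg := Function.update σ.reg x c
  arr := σ.arr

/-- Write `c` into cell `i` of array `a`. -/
def State.setArr (σ : State) (a i c : ℕ) : State where
  reg := σ.reg
  arr := Function.update σ.arr a (Function.update (σ.arr a) i c)

/-- `Exec p σ t τ`: started in state `σ`, the program `p` halts in state `τ` after exactly `t`
steps. -/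
inductive Exec : Prog → State → ℕ → State → Prop where
  | skip (σ : State) : Exec .skip σ 1 σ
  | assign (x : ℕ) (e : Expr) (σ : State) :
      Exec (.assign x e) σ (e.cost + 1) (σ.setReg x (e.eval σ))
  | store (a : ℕ) (i e : Expr) (σ : State) :
      Exec (.store a i e) σ (i.cost + e.cost + 1) (σ.setArr a (i.eval σ) (e.eval σ))
  | seq {p q : Prog} {σ τ υ : State} {s t : ℕ} :
      Exec p σ s τ → Exec q τ t υ → Exec (.seq p q) σ (s + t) υ
  | ite_true {b : Test} {p q : Prog} {σ τ : State} {t : ℕ} :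
      b.Holds σ → Exec p σ t τ → Exec (.ite b p q) σ (b.cost + t) τ
  | ite_false {b : Test} {p q : Prog} {σ τ : State} {t : ℕ} :
      ¬ b.Holds σ → Exec q σ t τ → Exec (.ite b p q) σ (b.cost + t) τ
  | while_true {b : Test} {p : Prog} {σ τ υ : State} {s t : ℕ} :
      b.Holds σ → Exec p σ s τ → Exec (.while b p) τ t υ →
        Exec (.while b p) σ (b.cost + s + t) υ
  | while_false {b : Test} {p : Prog} {σ : State} :
      ¬ b.Holds σ → Exec (.while b p) σ b.cost σ

/-! ### Input and output of the algorithm -/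

/-- `es` lists the edges of `G`, each exactly once, in any order and with either orientation. -/
def IsEdgeList {n : ℕ} (G : SimpleGraph (Fin n)) (es : List (Fin n × Fin n)) : Prop :=
  (es.map fun e => s(e.1, e.2)).Nodup ∧
    ∀ u v : Fin n, G.Adj u v ↔ s(u, v) ∈ es.map fun e => s(e.1, e.2)

/-- The initial state: register 0 holds the number of vertices, register 1 the number of edges,
and cell `i` of arrays 0 and 1 the two endpoints of the `i`-th edge; all else is 0. -/
def inputState {n : ℕ} (es : List (Fin n × Fin n)) : State where
  reg := fun x => if x = 0 then n else if x = 1 then es.length else 0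
  arr := fun a i =>
    if a = 0 then (es.map fun e => (e.1 : ℕ)).getD i 0
    else if a = 1 then (es.map fun e => (e.2 : ℕ)).getD i 0
    else 0

/-- `EncodesSet σ q A`: in state `σ`, the pointer `q` is the head of a linked list of pairwise
disjoint nonempty intervals of integers whose union is `A`.  The pointer 0 is the empty list; a
cell `q ≠ 0` describes the interval `[arr 3 q, arr 4 q)`, and its successor is `arr 5 q`. -/
inductive EncodesSet (σ : State) : ℕ → Finset ℕ → Prop where
  | nil : EncodesSet σ 0 ∅
  | cons {q : ℕ} {A : Finset ℕ} :
      q ≠ 0 → σ.arr 3 q < σ.arr 4 q → EncodesSet σ (σ.arr 5 q) A →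
        Disjoint (Finset.Ico (σ.arr 3 q) (σ.arr 4 q)) A →
          EncodesSet σ q (Finset.Ico (σ.arr 3 q) (σ.arr 4 q) ∪ A)

/-- The state `σ` outputs the family `f`: cell `v` of array 2 points to the list for `f v`. -/
def Outputs (σ : State) {n : ℕ} (f : Fin n → Finset ℕ) : Prop :=
  ∀ v : Fin n, EncodesSet σ (σ.arr 2 v) (f v)

/-- Started on any edge list of the graph `G`, the program `p` halts within `t` steps and outputs
an overlap representation of `G` of minimum size. -/
def ProducesOptimalRep (p : Prog) {n : ℕ} (G : SimpleGraph (Fin n)) (t : ℕ) : Prop :=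
  ∀ es : List (Fin n × Fin n), IsEdgeList G es →
    ∃ (s : ℕ) (σ : State) (f : Fin n → Finset ℕ),
      Exec p (inputState es) s σ ∧ s ≤ t ∧
        Outputs σ f ∧ IsOverlapRep G f ∧ size f = overlapNumber G

end OverlapTree

/-!
The number of vertices of a largest skeleton of a tree `T` and the overlap number of `T` are
compared through a third quantity, `weight ρ par`, which belongs to a choice of a root `ρ`. A root
is good (`IsGoodRoot`) if it has at least two neighbors, of which at most one is not a leaf.

*Upper bound.* A traversal with a stack assigns to each vertex an integer interval that starts
inside the interval of the parent, just before its right end, and ends after it (`Traversal`). An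
inner vertex costs one new point, and a second one only if all its children are leaves: otherwise
the inner child that is visited first provides the point by which the intervals of the leaf children
extend beyond that of the parent. Thus `weight ρ par` points suffice (`Traversal.size_le_weight`).

*Skeletons.* For a good root, the inner vertices, one leaf child of each inner vertex all of whose
children are leaves, and one further leaf at the root form a skeleton with `weight ρ par` vertices
(`exists_skeleton_of_weight`).

*Lower bound.* A skeleton with at least three vertices has at most as many vertices as an overlap
representation of `T` has points (`ncard_verts_le_size`). With one additional point that lies in no
set, two sets overlap exactly if all four cells of the partition generated by them are nonempty
(`Cross`). This relation does not change if sets are complemented, and it is proved by induction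
that the edges of a skeleton with `k ≥ 3` vertices cannot be represented in this way on `k` points
(`card_lt_card_of_crossRep`). A leaf `l` of a skeleton has a neighbor `p` of degree two; let `q` be
the other neighbor of `p`. After complementation, all sets except those of `l` and `p` are disjoint
from the set of `l` (`Normal`). If `q` has degree two, then `l` and one point can be removed.
If its degree is larger, then no set beyond `q` crosses that of `p`; either all of them lie on the
same side of it and `l`, `p` and two points can be removed, or the skeleton falls into two smaller
ones that live on the two sides. The induction ends at the path `l`, `p`, `q`, one edge of which
already needs four points.

*The algorithm.* The traversal runs in linear time on the RAM once adjacency lists, with the leaves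
in front, and a good root have been computed from the degrees (`runs_prepare`, `runs_visit`). A
visit takes a number of steps that is linear in the degree of the vertex, and the degrees add up to
less than `2 * n`.
-/

namespace OverlapTree

/-! ### The lower bound for skeletons -/

section LowerBound

open scoped Classical

variable {V : Type*} {G : SimpleGraph V}

/-- All four cells of the partition of the rows `X` by the columns `a` and `b` are nonempty. -/
def Cross (X : Finset ℕ) (a b : ℕ → Prop) : Prop :=
  (∃ x ∈ X, a x ∧ b x) ∧ (∃ x ∈ X, a x ∧ ¬ b x) ∧ (∃ x ∈ X, ¬ a x ∧ b x) ∧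
    ∃ x ∈ X, ¬ a x ∧ ¬ b x

/-- The columns `c v`, `v ∈ S`, on the rows `X` cross exactly along the edges of `G`. -/
def CrossRep (G : SimpleGraph V) (S : Finset V) (X : Finset ℕ) (c : V → ℕ → Prop) : Prop :=
  ∀ u ∈ S, ∀ v ∈ S, G.Adj u v ↔ Cross X (c u) (c v)

/-- `S` induces a connected subgraph of `G`: a nonempty part of `S` that is closed under taking
neighbors in `S` is all of `S`. -/
def Conn (G : SimpleGraph V) (S : Finset V) : Prop :=
  ∀ A ⊆ S, A.Nonempty → (∀ a ∈ A, ∀ b ∈ S, G.Adj a b → b ∈ A) → A = S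

/-- If `w` is the only neighbor of `v` in `S`, then `w` has exactly one further neighbor in `S`. -/
def LeafCondition (G : SimpleGraph V) (S : Finset V) : Prop :=
  ∀ v ∈ S, ∀ w ∈ S, G.Adj v w → (∀ x ∈ S, G.Adj v x → x = w) →
    ∃ u ∈ S, u ≠ v ∧ G.Adj w u ∧ ∀ x ∈ S, G.Adj w x → x = v ∨ x = u

theorem Cross.symm {X : Finset ℕ} {a b : ℕ → Prop} (h : Cross X a b) : Cross X b a := by
  obtain ⟨⟨x1, h1, p1, q1⟩, ⟨x2, h2, p2, q2⟩, ⟨x3, h3, p3, q3⟩, ⟨x4, h4, p4, q4⟩⟩ := h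
  exact ⟨⟨x1, h1, q1, p1⟩, ⟨x3, h3, q3, p3⟩, ⟨x2, h2, q2, p2⟩, ⟨x4, h4, q4, p4⟩⟩

theorem Cross.mono {X Y : Finset ℕ} {a b : ℕ → Prop} (hXY : X ⊆ Y) (h : Cross X a b) :
    Cross Y a b := by
  obtain ⟨⟨x1, h1, p1⟩, ⟨x2, h2, p2⟩, ⟨x3, h3, p3⟩, ⟨x4, h4, p4⟩⟩ := h
  exact ⟨⟨x1, hXY h1, p1⟩, ⟨x2, hXY h2, p2⟩, ⟨x3, hXY h3, p3⟩, ⟨x4, hXY h4, p4⟩⟩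

theorem cross_not_left {X : Finset ℕ} {a b : ℕ → Prop} :
    Cross X (fun x => ¬ a x) b ↔ Cross X a b := by
  unfold Cross; simp only [not_not]; tauto

theorem cross_comm {X : Finset ℕ} {a b : ℕ → Prop} : Cross X a b ↔ Cross X b a :=
  ⟨Cross.symm, Cross.symm⟩

theorem cross_flip_left {X : Finset ℕ} {a a' b : ℕ → Prop}
    (h : (∀ x, a' x ↔ a x) ∨ ∀ x, a' x ↔ ¬ a x) : Cross X a' b ↔ Cross X a b := by
  rcases h with h | h
  · rw [show a' = a from funext fun x => propext (h x)]
  · rw [show a' = fun x => ¬ a x from funext fun x => propext (h x), cross_not_left]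

/-- Complementing some of the columns does not change which of them cross. -/
theorem CrossRep.flip {S : Finset V} {X : Finset ℕ} {c c' : V → ℕ → Prop}
    (hc : CrossRep G S X c) (h : ∀ v, (∀ x, c' v x ↔ c v x) ∨ ∀ x, c' v x ↔ ¬ c v x) :
    CrossRep G S X c' := by
  intro u hu v hv
  rw [hc u hu v hv, cross_flip_left (h u), cross_comm, @cross_comm _ (c u), cross_flip_left (h v)]

theorem CrossRep.restrict {S S' : Finset V} {X X' : Finset ℕ} {c : V → ℕ → Prop}
    (hc : CrossRep G S X c) (hS : S' ⊆ S) (hX : X' ⊆ X)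
    (h : ∀ u ∈ S', ∀ v ∈ S', G.Adj u v → Cross X' (c u) (c v)) : CrossRep G S' X' c :=
  fun u hu v hv => ⟨h u hu v hv, fun h' => (hc u (hS hu) v (hS hv)).2 (h'.mono hX)⟩

/-- A row may be deleted if the two columns have a twin row. -/
theorem Cross.erase {X : Finset ℕ} {a b : ℕ → Prop} (h : Cross X a b) {r r' : ℕ} (hr : r' ∈ X)
    (hne : r' ≠ r) (ha : a r ↔ a r') (hb : b r ↔ b r') : Cross (X.erase r) a b := by
  have key : ∀ P : ℕ → Prop, (P r ↔ P r') → (∃ x ∈ X, P x) → ∃ x ∈ X.erase r, P x := by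
    rintro P hP ⟨x, hx, hPx⟩
    by_cases hxr : x = r
    · exact ⟨r', Finset.mem_erase.2 ⟨hne, hr⟩, hP.1 (hxr ▸ hPx)⟩
    · exact ⟨x, Finset.mem_erase.2 ⟨hxr, hx⟩, hPx⟩
  obtain ⟨h1, h2, h3, h4⟩ := h
  exact ⟨key (fun x => a x ∧ b x) (by tauto) h1, key (fun x => a x ∧ ¬ b x) (by tauto) h2,
    key (fun x => ¬ a x ∧ b x) (by tauto) h3, key (fun x => ¬ a x ∧ ¬ b x) (by tauto) h4⟩

theorem Cross.four_le_card {X : Finset ℕ} {a b : ℕ → Prop} (h : Cross X a b) : 4 ≤ X.card := by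
  obtain ⟨⟨x1, h1, p1, q1⟩, ⟨x2, h2, p2, q2⟩, ⟨x3, h3, p3, q3⟩, ⟨x4, h4, p4, q4⟩⟩ := h
  have h12 : x1 ≠ x2 := by rintro rfl; exact q2 q1
  have h13 : x1 ≠ x3 := by rintro rfl; exact p3 p1
  have h14 : x1 ≠ x4 := by rintro rfl; exact p4 p1
  have h23 : x2 ≠ x3 := by rintro rfl; exact p3 p2
  have h24 : x2 ≠ x4 := by rintro rfl; exact p4 p2
  have h34 : x3 ≠ x4 := by rintro rfl; exact q4 q3
  have hsub : ({x1, x2, x3, x4} : Finset ℕ) ⊆ X := by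
    intro x hx
    simp only [Finset.mem_insert, Finset.mem_singleton] at hx
    rcases hx with rfl | rfl | rfl | rfl <;> assumption
  have hcard : ({x1, x2, x3, x4} : Finset ℕ).card = 4 := by
    rw [Finset.card_insert_of_notMem (by simp [h12, h13, h14]),
      Finset.card_insert_of_notMem (by simp [h23, h24]),
      Finset.card_insert_of_notMem (by simp [h34]), Finset.card_singleton]
  exact hcard ▸ Finset.card_le_card hsub

/-- A pendant path `l - p - q` in the subgraph induced by `S`: `l` is a leaf with neighbor `p`, and
`p` has degree two. -/
structure Pendant (G : SimpleGraph V) (S : Finset V) (l p q : V) : Prop where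
  hl : l ∈ S
  hp : p ∈ S
  hq : q ∈ S
  lp : G.Adj l p
  pq : G.Adj p q
  ql : q ≠ l
  nl : ∀ x ∈ S, G.Adj l x → x = p
  np : ∀ x ∈ S, G.Adj p x → x = l ∨ x = q

/-- The normal form reached by complementing columns: the rows `r₀`, `r₁` lie in the column of the
leaf `l`, they are distinguished by `p`, and all columns other than `l` and `p` are disjoint
from the column of `l`. -/
structure Normal (S : Finset V) (X : Finset ℕ) (c : V → ℕ → Prop) (l p : V) (r₀ r₁ : ℕ) :
    Prop where
  h0 : r₀ ∈ X
  h1 : r₁ ∈ X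
  l0 : c l r₀
  l1 : c l r₁
  p0 : ¬ c p r₀
  p1 : c p r₁
  rest : ∀ w ∈ S, w ≠ l → w ≠ p → ∀ x ∈ X, c l x → ¬ c w x

theorem Pendant.conn_erase_leaf {S : Finset V} {l p q : V} (h : Pendant G S l p q)
    (hS : Conn G S) : Conn G (S.erase l) := by
  intro A hA hne hcl
  by_cases hpA : p ∈ A
  · have := hS (insert l A) (Finset.insert_subset h.hl (hA.trans (Finset.erase_subset _ _)))
      (Finset.insert_nonempty _ _) (by
        intro a ha b hb hab
        rw [Finset.mem_insert] at ha ⊢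
        rcases ha with rfl | ha
        · exact Or.inr (h.nl b hb hab ▸ hpA)
        · by_cases hbl : b = l
          · exact Or.inl hbl
          · exact Or.inr (hcl a ha b (Finset.mem_erase.2 ⟨hbl, hb⟩) hab))
    rw [← this, Finset.erase_insert]
    exact fun hlA => Finset.notMem_erase l S (hA hlA)
  · exfalso
    have := hS A (hA.trans (Finset.erase_subset _ _)) hne (by
      intro a ha b hb hab
      refine hcl a ha b (Finset.mem_erase.2 ⟨?_, hb⟩) hab
      rintro rfl
      exact hpA (h.nl a (Finset.mem_of_mem_erase (hA ha)) hab.symm ▸ ha))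
    exact hpA (this ▸ h.hp)

theorem Pendant.conn_erase_erase {S : Finset V} {l p q : V} (h : Pendant G S l p q)
    (hS : Conn G S) : Conn G ((S.erase l).erase p) := by
  intro A hA hne hcl
  have hA' : A ⊆ S := hA.trans ((Finset.erase_subset _ _).trans (Finset.erase_subset _ _))
  have hlA : l ∉ A := fun h' => by simpa using hA h'
  have hpA : p ∉ A := fun h' => by simpa using hA h'
  have hcl' : ∀ a ∈ A, ∀ b ∈ S, G.Adj a b → b ∈ A ∨ (a = q ∧ b = p) := by
    intro a ha b hb hab
    by_cases hbl : b = l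
    · subst hbl
      exact absurd (h.nl a (hA' ha) hab.symm ▸ ha) hpA
    by_cases hbp : b = p
    · subst hbp
      rcases h.np a (hA' ha) hab.symm with rfl | rfl
      · exact absurd ha hlA
      · exact Or.inr ⟨rfl, rfl⟩
    · exact Or.inl (hcl a ha b (by simp [hbl, hbp, hb]) hab)
  by_cases hqA : q ∈ A
  · have := hS (insert l (insert p A))
      (Finset.insert_subset h.hl (Finset.insert_subset h.hp hA')) (Finset.insert_nonempty _ _) (by
        intro a ha b hb hab
        simp only [Finset.mem_insert] at ha ⊢
        rcases ha with rfl | rfl | ha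
        · exact Or.inr (Or.inl (h.nl b hb hab))
        · rcases h.np b hb hab with rfl | rfl
          · exact Or.inl rfl
          · exact Or.inr (Or.inr hqA)
        · rcases hcl' a ha b hb hab with h' | h'
          · exact Or.inr (Or.inr h')
          · exact Or.inr (Or.inl h'.2))
    ext x
    rw [← this]
    simp only [Finset.mem_erase, Finset.mem_insert]
    constructor
    · intro hx
      exact ⟨fun e => hpA (e ▸ hx), fun e => hlA (e ▸ hx), Or.inr (Or.inr hx)⟩
    · tauto
  · exfalso
    have := hS A hA' hne (by
      intro a ha b hb hab
      rcases hcl' a ha b hb hab with h' | h'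
      · exact h'
      · exact absurd (h'.1 ▸ ha) hqA)
    exact hqA (this ▸ h.hq)

/-- All columns other than those of the leaf `l` and its neighbor are constant on one and the same
side of the column of `l`. -/
theorem Pendant.constant_side {S : Finset V} {l p q : V} (h : Pendant G S l p q) (hS : Conn G S)
    {X : Finset ℕ} {c : V → ℕ → Prop} (hc : CrossRep G S X c) :
    ∃ side : Prop, ∀ w ∈ S, w ≠ l → w ≠ p → ∀ x ∈ X, ∀ y ∈ X, (c l x ↔ side) → (c l y ↔ side) →
      (c w x ↔ c w y) := by
  -- `const side w`: the column of `w` is constant on this side of the column of `l`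
  let const (side : Prop) (w : V) : Prop :=
    ∀ x ∈ X, ∀ y ∈ X, (c l x ↔ side) → (c l y ↔ side) → (c w x ↔ c w y)
  have hone : ∀ w ∈ S, w ≠ l → w ≠ p → const True w ∨ const False w := by
    intro w hw hwl hwp
    have hnc : ¬ Cross X (c w) (c l) := fun h' => hwp (h.nl w hw ((hc w hw l h.hl).2 h').symm)
    by_contra hcon
    push Not at hcon
    obtain ⟨h1, h2⟩ := hcon
    simp only [const, iff_true, iff_false] at h1 h2
    push Not at h1 h2
    obtain ⟨x, hx, y, hy, hlx, hly, hxy⟩ := h1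
    obtain ⟨x', hx', y', hy', hlx', hly', hxy'⟩ := h2
    apply hnc
    rcases hxy with ⟨a1, a2⟩ | ⟨a1, a2⟩ <;> rcases hxy' with ⟨b1, b2⟩ | ⟨b1, b2⟩
    · exact ⟨⟨x, hx, a1, hlx⟩, ⟨x', hx', b1, hlx'⟩, ⟨y, hy, a2, hly⟩, ⟨y', hy', b2, hly'⟩⟩
    · exact ⟨⟨x, hx, a1, hlx⟩, ⟨y', hy', b2, hly'⟩, ⟨y, hy, a2, hly⟩, ⟨x', hx', b1, hlx'⟩⟩
    · exact ⟨⟨y, hy, a2, hly⟩, ⟨x', hx', b1, hlx'⟩, ⟨x, hx, a1, hlx⟩, ⟨y', hy', b2, hly'⟩⟩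
    · exact ⟨⟨y, hy, a2, hly⟩, ⟨y', hy', b2, hly'⟩, ⟨x, hx, a1, hlx⟩, ⟨x', hx', b1, hlx'⟩⟩
  have hadj : ∀ u ∈ S, ∀ w ∈ S, G.Adj u w → const True u → const False w → False := by
    intro u hu w hw huw h1 h2
    obtain ⟨⟨x1, k1, p1, q1⟩, ⟨x2, k2, p2, q2⟩, ⟨x3, k3, p3, q3⟩, ⟨x4, k4, p4, q4⟩⟩ :=
      (hc u hu w hw).1 huw
    -- `x₃` and `x₄` both lie outside the column of `l`, where `w` does not separate them
    have hin : ∃ x ∈ X, c u x ∧ c l x := by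
      by_cases g1 : c l x1
      · exact ⟨x1, k1, p1, g1⟩
      by_cases g2 : c l x2
      · exact ⟨x2, k2, p2, g2⟩
      · exact absurd ((h2 x1 k1 x2 k2 (iff_false_intro g1) (iff_false_intro g2)).1 q1) q2
    obtain ⟨x, hx, hux, hlx⟩ := hin
    have g3 : ¬ c l x3 := fun g =>
      p3 ((h1 x hx x3 k3 (iff_true_intro hlx) (iff_true_intro g)).1 hux)
    have g4 : ¬ c l x4 := fun g =>
      p4 ((h1 x hx x4 k4 (iff_true_intro hlx) (iff_true_intro g)).1 hux)
    exact q4 ((h2 x3 k3 x4 k4 (iff_false_intro g3) (iff_false_intro g4)).1 q3)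
  by_cases hall : ∀ w ∈ S, w ≠ l → w ≠ p → const False w
  · exact ⟨False, hall⟩
  · refine ⟨True, ?_⟩
    push Not at hall
    obtain ⟨w0, hw0, hl0, hp0, hn0⟩ := hall
    have := h.conn_erase_erase hS
      (((S.erase l).erase p).filter fun w => ¬ const False w) (Finset.filter_subset _ _)
      ⟨w0, by simp [hw0, hl0, hp0, hn0]⟩ (by
        intro a ha b hb hab
        simp only [Finset.mem_filter, Finset.mem_erase] at ha hb ⊢
        refine ⟨hb, fun hbF => hadj a ha.1.2.2 b hb.2.2 hab ?_ hbF⟩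
        exact (hone a ha.1.2.2 ha.1.2.1 ha.1.1).resolve_right ha.2)
    intro w hw hwl hwp
    have hw' : w ∈ (S.erase l).erase p := by simp [hw, hwl, hwp]
    rw [← this, Finset.mem_filter] at hw'
    exact (hone w hw hwl hwp).resolve_right hw'.2

/-- The column of `l` is complemented if necessary to become the side on which all other columns are
constant; the other columns are complemented to be empty there. -/
theorem Pendant.exists_normal {S : Finset V} {l p q : V} (h : Pendant G S l p q) (hS : Conn G S)
    {X : Finset ℕ} {c : V → ℕ → Prop} (hc : CrossRep G S X c) :
    ∃ c' r₀ r₁, CrossRep G S X c' ∧ Normal S X c' l p r₀ r₁ := by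
  obtain ⟨side, hside⟩ := h.constant_side hS hc
  have hpl : p ≠ l := h.lp.ne'
  have hcr := (hc l h.hl p h.hp).1 h.lp
  obtain ⟨r0, h0, r1, h1, l0, l1, hp⟩ : ∃ r0 ∈ X, ∃ r1 ∈ X, (c l r0 ↔ side) ∧ (c l r1 ↔ side) ∧
      ¬ (c p r1 ↔ c p r0) := by
    obtain ⟨⟨x1, k1, p1, q1⟩, ⟨x2, k2, p2, q2⟩, ⟨x3, k3, p3, q3⟩, ⟨x4, k4, p4, q4⟩⟩ := hcr
    by_cases hs : side
    · exact ⟨x1, k1, x2, k2, by tauto, by tauto, by tauto⟩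
    · exact ⟨x3, k3, x4, k4, by tauto, by tauto, by tauto⟩
  refine ⟨fun v x => if v = l then (c v x ↔ c v r0) else ¬ (c v x ↔ c v r0), r0, r1,
    hc.flip fun v => ?_, ?_⟩
  · by_cases hv : v = l <;> by_cases hr : c v r0 <;> simp [hv] <;> subst_vars <;> simp [hr]
  · refine ⟨h0, h1, by simp, by simp; tauto, by simp [hpl], by simpa [hpl] using hp, ?_⟩
    intro w hw hwl hwp x hx hlx
    simp only [if_true, hwl, if_false, not_not] at hlx ⊢
    exact hside w hw hwl hwp x hx r0 h0 (hlx.trans l0) l0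

/-- The induction hypothesis of the lower bound. -/
def LowerBoundBelow (G : SimpleGraph V) (N : ℕ) : Prop :=
  ∀ S : Finset V, S.card < N → 3 ≤ S.card → Conn G S → LeafCondition G S →
    ∀ (c : V → ℕ → Prop) (X : Finset ℕ), CrossRep G S X c → S.card + 1 ≤ X.card

/-- If `q` has degree two in `S`, then `S - l` is again a skeleton. Only the columns of `l` and `p`
distinguish the rows `r₀` and `r₁`, and one of these two rows is not needed for the crossing of `p`
and `q`, so that it can be deleted together with `l`. -/
theorem bound_of_degree_two {S : Finset V} {l p q w₀ : V} (h : Pendant G S l p q) (hS : Conn G S)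
    (hL : LeafCondition G S) {X : Finset ℕ} {c : V → ℕ → Prop} (hc : CrossRep G S X c) {r₀ r₁ : ℕ}
    (hn : Normal S X c l p r₀ r₁) (ih : LowerBoundBelow G S.card)
    (hw₀ : w₀ ∈ S) (hqw : G.Adj q w₀) (hwp : w₀ ≠ p)
    (hq2 : ∀ x ∈ S, G.Adj q x → x = p ∨ x = w₀) : S.card + 1 ≤ X.card := by
  have hpl : p ≠ l := h.lp.ne'
  have hqp : q ≠ p := h.pq.ne'
  have hwl : w₀ ≠ l := by rintro rfl; exact hqp (h.nl q h.hq hqw.symm)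
  have hwq : w₀ ≠ q := hqw.ne'
  have hr : r₁ ≠ r₀ := by rintro rfl; exact hn.p0 hn.p1
  have hcard : (S.erase l).card + 1 = S.card := Finset.card_erase_add_one h.hl
  have h3 : 3 ≤ (S.erase l).card := by
    have : ({p, q, w₀} : Finset V) ⊆ S.erase l := by
      intro x hx
      simp only [Finset.mem_insert, Finset.mem_singleton] at hx
      rcases hx with rfl | rfl | rfl <;> simp [h.hp, h.hq, hw₀, hpl, h.ql, hwl]
    refine le_trans (le_of_eq ?_) (Finset.card_le_card this)
    rw [Finset.card_insert_of_notMem (by simp [hqp.symm, hwp.symm]),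
      Finset.card_insert_of_notMem (by simp [hwq.symm]), Finset.card_singleton]
  have hL' : LeafCondition G (S.erase l) := by
    intro v hv w hw hvw huniq
    rw [Finset.mem_erase] at hv hw
    by_cases hvp : v = p
    · subst hvp
      obtain rfl : w = q := (h.np w hw.2 hvw).resolve_left hw.1
      exact ⟨w₀, by simp [hwl, hw₀], hwp, hqw, fun x hx hwx =>
        hq2 x (Finset.mem_of_mem_erase hx) hwx⟩
    · obtain ⟨u, hu, huv, hwu, hx⟩ := hL v hv.2 w hw.2 hvw (by
        intro x hx hvx
        refine huniq x (Finset.mem_erase.2 ⟨?_, hx⟩) hvx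
        rintro rfl
        exact hvp (h.nl v hv.2 hvx.symm))
      have hwp' : w ≠ p := by
        rintro rfl
        obtain rfl : v = q := (h.np v hv.2 hvw.symm).resolve_left hv.1
        exact hwp (huniq w₀ (by simp [hwl, hw₀]) hqw)
      refine ⟨u, Finset.mem_erase.2 ⟨?_, hu⟩, huv, hwu, fun x hx' => hx x
        (Finset.mem_of_mem_erase hx')⟩
      rintro rfl
      exact hwp' (h.nl w hw.2 hwu.symm)
  have hq0 := hn.rest q h.hq h.ql hqp r₀ hn.h0 hn.l0
  have hq1 := hn.rest q h.hq h.ql hqp r₁ hn.h1 hn.l1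
  obtain ⟨⟨x1, k1, p1, q1⟩, _, ⟨x3, k3, p3, q3⟩, _⟩ := (hc p h.hp q h.hq).1 h.pq
  -- one of the twin rows can be deleted without destroying the crossing of `p` and `q`
  obtain ⟨r, r', hrX, hrX', hne, hrr, hcross⟩ : ∃ r r', r ∈ X ∧ r' ∈ X ∧ r' ≠ r ∧
      (∀ w ∈ S, w ≠ l → w ≠ p → (c w r ↔ c w r')) ∧ Cross (X.erase r) (c p) (c q) := by
    have hx10 : x1 ≠ r₀ := by rintro rfl; exact hq0 q1
    have hx11 : x1 ≠ r₁ := by rintro rfl; exact hq1 q1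
    have hx30 : x3 ≠ r₀ := by rintro rfl; exact hq0 q3
    have hx31 : x3 ≠ r₁ := by rintro rfl; exact hq1 q3
    obtain ⟨_, _, ⟨z, hzX, hz1, hz2⟩, _⟩ := (hc q h.hq w₀ hw₀).1 hqw
    have hz0 : z ≠ r₀ := by rintro rfl; exact hn.rest w₀ hw₀ hwl hwp _ hn.h0 hn.l0 hz2
    have hz1' : z ≠ r₁ := by rintro rfl; exact hn.rest w₀ hw₀ hwl hwp _ hn.h1 hn.l1 hz2
    by_cases hzp : c p z
    · refine ⟨r₁, r₀, hn.h1, hn.h0, hr.symm, ?_, ⟨x1, by simp [k1, hx11], p1, q1⟩,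
        ⟨z, by simp [hzX, hz1'], hzp, hz1⟩, ⟨x3, by simp [k3, hx31], p3, q3⟩,
        ⟨r₀, by simp [hn.h0, hr.symm], hn.p0, hq0⟩⟩
      intro w hw hwl hwp
      exact iff_of_false (hn.rest w hw hwl hwp _ hn.h1 hn.l1) (hn.rest w hw hwl hwp _ hn.h0 hn.l0)
    · refine ⟨r₀, r₁, hn.h0, hn.h1, hr, ?_, ⟨x1, by simp [k1, hx10], p1, q1⟩,
        ⟨r₁, by simp [hn.h1, hr], hn.p1, hq1⟩, ⟨x3, by simp [k3, hx30], p3, q3⟩,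
        ⟨z, by simp [hzX, hz0], hzp, hz1⟩⟩
      intro w hw hwl hwp
      exact iff_of_false (hn.rest w hw hwl hwp _ hn.h0 hn.l0) (hn.rest w hw hwl hwp _ hn.h1 hn.l1)
  have := ih (S.erase l) (by omega) h3 (h.conn_erase_leaf hS) hL' c (X.erase r)
    (hc.restrict (Finset.erase_subset _ _) (Finset.erase_subset _ _) (by
      intro u hu v hv huv
      rw [Finset.mem_erase] at hu hv
      by_cases hup : u = p
      · subst hup
        obtain rfl : v = q := (h.np v hv.2 huv).resolve_left hv.1
        exact hcross
      by_cases hvp : v = p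
      · subst hvp
        obtain rfl : u = q := (h.np u hu.2 huv.symm).resolve_left hu.1
        exact hcross.symm
      · exact ((hc u hu.2 v hv.2).1 huv).erase hrX' hne (hrr u hu.2 hu.1 hup)
          (hrr v hv.2 hv.1 hvp)))
  have := Finset.card_erase_add_one hrX
  omega

/-- If `q` has at least three neighbors in `S`, then no neighbor of `q` is a leaf, and `q` itself
does not become one when the pendant path is cut off. -/
theorem Pendant.leafCondition_erase_erase {S : Finset V} {l p q w₀ w₁ : V}
    (h : Pendant G S l p q) (hL : LeafCondition G S) (hw₀ : w₀ ∈ S) (hw₁ : w₁ ∈ S)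
    (h0 : G.Adj q w₀) (h1 : G.Adj q w₁) (hp0 : w₀ ≠ p) (hp1 : w₁ ≠ p) (h01 : w₀ ≠ w₁) :
    LeafCondition G ((S.erase l).erase p) := by
  have hqp : q ≠ p := h.pq.ne'
  have hl0 : w₀ ≠ l := by rintro rfl; exact hqp (h.nl q h.hq h0.symm)
  have hl1 : w₁ ≠ l := by rintro rfl; exact hqp (h.nl q h.hq h1.symm)
  intro v hv w hw hvw huniq
  simp only [Finset.mem_erase] at hv hw
  obtain ⟨hvp, hvl, hv⟩ := hv
  obtain ⟨hwp, hwl, hw⟩ := hw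
  have hvq : v ≠ q := by
    rintro rfl
    exact h01 ((huniq w₀ (by simp [*]) h0).trans (huniq w₁ (by simp [*]) h1).symm)
  obtain ⟨u, hu, huv, hwu, hx⟩ := hL v hv w hw hvw (by
    intro x hx hvx
    refine huniq x ?_ hvx
    simp only [Finset.mem_erase]
    refine ⟨?_, ?_, hx⟩
    · rintro rfl
      exact (h.np v hv hvx.symm).elim hvl hvq
    · rintro rfl
      exact hvp (h.nl v hv hvx.symm))
  have hwq : w ≠ q := by
    rintro rfl
    have e1 := (hx p h.hp h.pq.symm).resolve_left (Ne.symm hvp)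
    subst e1
    exact h01 (((hx w₀ hw₀ h0).resolve_right hp0).trans ((hx w₁ hw₁ h1).resolve_right hp1).symm)
  refine ⟨u, ?_, huv, hwu, fun x hx' => hx x (by simp at hx'; exact hx'.2.2)⟩
  simp only [Finset.mem_erase]
  refine ⟨?_, ?_, hu⟩
  · rintro rfl
    exact (h.np w hw hwu.symm).elim hwl hwq
  · rintro rfl
    exact hwp (h.nl w hw hwu.symm)

/-- If `q` has at least three neighbors and all columns of vertices beyond `q` lie inside the column
of `p`, then `l` and `p` can be deleted together with two rows: `r₁`, and either `r₀` or a row `y`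
of `q` outside the column of `p`. If neither choice preserved the crossings of `q`, then some
neighbor of `q` would have a column so large that it crosses only that of `q`; this neighbor would
be a leaf, which contradicts the degree of `q`. -/
theorem bound_of_one_side {S : Finset V} {l p q w₀ w₁ : V} (h : Pendant G S l p q)
    (hG : ∀ u v w, G.Adj u v → G.Adj u w → ¬ G.Adj v w) (hS : Conn G S)
    (hL : LeafCondition G S) {X : Finset ℕ} {c : V → ℕ → Prop} (hc : CrossRep G S X c) {r₀ r₁ : ℕ}
    (hn : Normal S X c l p r₀ r₁) (ih : LowerBoundBelow G S.card)
    (hw₀ : w₀ ∈ S) (hw₁ : w₁ ∈ S) (h0 : G.Adj q w₀) (h1 : G.Adj q w₁) (hp0 : w₀ ≠ p)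
    (hp1 : w₁ ≠ p) (h01 : w₀ ≠ w₁)
    (hside : ∀ w ∈ S, w ≠ l → w ≠ p → w ≠ q → ∀ x ∈ X, ¬ c p x → ¬ c w x) :
    S.card + 1 ≤ X.card := by
  have hpl : p ≠ l := h.lp.ne'
  have hqp : q ≠ p := h.pq.ne'
  have hl0 : w₀ ≠ l := by rintro rfl; exact hqp (h.nl q h.hq h0.symm)
  have hl1 : w₁ ≠ l := by rintro rfl; exact hqp (h.nl q h.hq h1.symm)
  have hr : r₁ ≠ r₀ := by rintro rfl; exact hn.p0 hn.p1
  have hcard1 : (S.erase l).card + 1 = S.card := Finset.card_erase_add_one h.hl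
  have hcard2 : ((S.erase l).erase p).card + 1 = (S.erase l).card :=
    Finset.card_erase_add_one (by simp [hpl, h.hp])
  have h3 : 3 ≤ ((S.erase l).erase p).card := by
    have : ({q, w₀, w₁} : Finset V) ⊆ (S.erase l).erase p := by
      intro x hx
      simp only [Finset.mem_insert, Finset.mem_singleton] at hx
      rcases hx with rfl | rfl | rfl <;> simp [h.hq, hw₀, hw₁, hqp, h.ql, hl0, hl1, hp0, hp1]
    refine le_trans (le_of_eq ?_) (Finset.card_le_card this)
    rw [Finset.card_insert_of_notMem (by simp [h0.ne, h1.ne]),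
      Finset.card_insert_of_notMem (by simp [h01]), Finset.card_singleton]
  have hq0 := hn.rest q h.hq h.ql hqp r₀ hn.h0 hn.l0
  have hq1 := hn.rest q h.hq h.ql hqp r₁ hn.h1 hn.l1
  obtain ⟨_, _, ⟨y, hy, hpy, hqy⟩, _⟩ := (hc p h.hp q h.hq).1 h.pq
  have hy0 : y ≠ r₀ := by rintro rfl; exact hq0 hqy
  have hy1 : y ≠ r₁ := by rintro rfl; exact hq1 hqy
  have out0 : ∀ w ∈ S, w ≠ l → w ≠ p → ¬ c w r₀ := fun w hw hwl hwp =>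
    hn.rest w hw hwl hwp r₀ hn.h0 hn.l0
  have out1 : ∀ w ∈ S, w ≠ l → w ≠ p → ¬ c w r₁ := fun w hw hwl hwp =>
    hn.rest w hw hwl hwp r₁ hn.h1 hn.l1
  -- the rows `r₁, z` are deleted, where `z` is `y` or `r₀`, and the other one of the two is kept
  have finish : ∀ z z', (z = y ∧ z' = r₀ ∨ z = r₀ ∧ z' = y) →
      (∀ w ∈ S, G.Adj q w → w ≠ p → Cross ((X.erase r₁).erase z) (c q) (c w)) →
      S.card + 1 ≤ X.card := by
    intro z z' hz hq
    have hzX : z ∈ X.erase r₁ := by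
      rcases hz with ⟨rfl, -⟩ | ⟨rfl, -⟩ <;> simp [hy1, hy, hr.symm, hn.h0]
    have hz'X : z' ∈ (X.erase r₁).erase z := by
      rcases hz with ⟨rfl, rfl⟩ | ⟨rfl, rfl⟩ <;> simp [hy1, hy, hr.symm, hn.h0, hy0, hy0.symm]
    have hz_out : ∀ w ∈ S, w ≠ l → w ≠ p → w ≠ q → ¬ c w z := by
      intro w hw hwl hwp hwq
      rcases hz with ⟨rfl, -⟩ | ⟨rfl, -⟩
      · exact hside w hw hwl hwp hwq _ hy hpy
      · exact out0 w hw hwl hwp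
    have hz'_out : ∀ w ∈ S, w ≠ l → w ≠ p → w ≠ q → ¬ c w z' := by
      intro w hw hwl hwp hwq
      rcases hz with ⟨-, rfl⟩ | ⟨-, rfl⟩
      · exact out0 w hw hwl hwp
      · exact hside w hw hwl hwp hwq _ hy hpy
    have hX1 := Finset.card_erase_add_one hn.h1
    have hX2 := Finset.card_erase_add_one hzX
    have := ih ((S.erase l).erase p) (by omega) h3 (h.conn_erase_erase hS)
      (h.leafCondition_erase_erase hL hw₀ hw₁ h0 h1 hp0 hp1 h01) c ((X.erase r₁).erase z)
      (hc.restrict ((Finset.erase_subset _ _).trans (Finset.erase_subset _ _))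
        ((Finset.erase_subset _ _).trans (Finset.erase_subset _ _)) (by
        intro u hu v hv huv
        simp only [Finset.mem_erase] at hu hv
        by_cases huq : u = q
        · subst huq
          exact hq v hv.2.2 huv hv.1
        by_cases hvq : v = q
        · subst hvq
          exact (hq u hu.2.2 huv.symm hu.1).symm
        obtain ⟨⟨x1, k1, p1, q1⟩, ⟨x2, k2, p2, q2⟩, ⟨x3, k3, p3, q3⟩, -⟩ :=
          (hc u hu.2.2 v hv.2.2).1 huv
        have hu1 := out1 u hu.2.2 hu.2.1 hu.1
        have hv1 := out1 v hv.2.2 hv.2.1 hv.1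
        have huz := hz_out u hu.2.2 hu.2.1 hu.1 huq
        have hvz := hz_out v hv.2.2 hv.2.1 hv.1 hvq
        refine ⟨⟨x1, ?_, p1, q1⟩, ⟨x2, ?_, p2, q2⟩, ⟨x3, ?_, p3, q3⟩, ⟨z', hz'X,
          hz'_out u hu.2.2 hu.2.1 hu.1 huq, hz'_out v hv.2.2 hv.2.1 hv.1 hvq⟩⟩
        · simp only [Finset.mem_erase]
          exact ⟨fun e => huz (e ▸ p1), fun e => hu1 (e ▸ p1), k1⟩
        · simp only [Finset.mem_erase]
          exact ⟨fun e => huz (e ▸ p2), fun e => hu1 (e ▸ p2), k2⟩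
        · simp only [Finset.mem_erase]
          exact ⟨fun e => hvz (e ▸ q3), fun e => hv1 (e ▸ q3), k3⟩))
    omega
  have notl : ∀ w, G.Adj q w → w ∈ S → w ≠ l := by
    rintro w hqw hw rfl
    exact hqp (h.nl q h.hq hqw.symm)
  by_cases hA : ∀ w ∈ S, G.Adj q w → w ≠ p → ∃ x ∈ X, x ≠ y ∧ c q x ∧ ¬ c w x
  · refine finish y r₀ (Or.inl ⟨rfl, rfl⟩) fun w hw hqw hwp => ?_
    have hwl := notl w hqw hw
    have hw1 := out1 w hw hwl hwp
    have hwy := hside w hw hwl hwp hqw.ne' y hy hpy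
    obtain ⟨x2, k2, n2, p2, q2⟩ := hA w hw hqw hwp
    obtain ⟨⟨x1, k1, p1, q1⟩, -, ⟨x3, k3, p3, q3⟩, -⟩ := (hc q h.hq w hw).1 hqw
    refine ⟨⟨x1, ?_, p1, q1⟩, ⟨x2, ?_, p2, q2⟩, ⟨x3, ?_, p3, q3⟩, ⟨r₀, ?_, hq0,
      out0 w hw hwl hwp⟩⟩ <;> simp only [Finset.mem_erase]
    · exact ⟨fun e => hwy (e ▸ q1), fun e => hw1 (e ▸ q1), k1⟩
    · exact ⟨n2, fun e => hq1 (e ▸ p2), k2⟩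
    · exact ⟨fun e => hwy (e ▸ q3), fun e => hw1 (e ▸ q3), k3⟩
    · exact ⟨hy0.symm, hr.symm, hn.h0⟩
  by_cases hB : ∀ w ∈ S, G.Adj q w → w ≠ p → ∃ x ∈ X, x ≠ r₀ ∧ x ≠ r₁ ∧ ¬ c q x ∧ ¬ c w x
  · refine finish r₀ y (Or.inr ⟨rfl, rfl⟩) fun w hw hqw hwp => ?_
    have hwl := notl w hqw hw
    have hw1 := out1 w hw hwl hwp
    have hw0 := out0 w hw hwl hwp
    have hwy := hside w hw hwl hwp hqw.ne' y hy hpy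
    obtain ⟨x4, k4, n4, n4', p4, q4⟩ := hB w hw hqw hwp
    obtain ⟨⟨x1, k1, p1, q1⟩, -, ⟨x3, k3, p3, q3⟩, -⟩ := (hc q h.hq w hw).1 hqw
    refine ⟨⟨x1, ?_, p1, q1⟩, ⟨y, ?_, hqy, hwy⟩, ⟨x3, ?_, p3, q3⟩, ⟨x4, ?_, p4, q4⟩⟩ <;>
      simp only [Finset.mem_erase]
    · exact ⟨fun e => hw0 (e ▸ q1), fun e => hw1 (e ▸ q1), k1⟩
    · exact ⟨hy0, hy1, hy⟩
    · exact ⟨fun e => hw0 (e ▸ q3), fun e => hw1 (e ▸ q3), k3⟩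
    · exact ⟨n4, n4', k4⟩
  exfalso
  push Not at hA hB
  -- a neighbor of `q` whose column contains all rows except `r₀`, `r₁` and `y`
  obtain ⟨w, hw, hqw, hwp, hfull⟩ : ∃ w ∈ S, G.Adj q w ∧ w ≠ p ∧
      ∀ x ∈ X, ¬ c w x → x = r₀ ∨ x = r₁ ∨ x = y := by
    obtain ⟨a, ha, hqa, hap, hA⟩ := hA
    obtain ⟨b, hb, hqb, hbp, hB⟩ := hB
    have hA' : ∀ x ∈ X, c q x → ¬ c a x → x = y := fun x hx h1 h2 => by
      by_contra hne
      exact h2 (hA x hx hne h1)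
    have hB' : ∀ x ∈ X, ¬ c q x → ¬ c b x → x = r₀ ∨ x = r₁ := fun x hx h1 h2 => by
      by_contra hne
      push Not at hne
      exact h2 (hB x hx hne.1 hne.2 h1)
    have hal := notl a hqa ha
    have hbl := notl b hqb hb
    have hncr : ¬ Cross X (c a) (c b) := fun h' => hG q a b hqa hqb ((hc a ha b hb).2 h')
    obtain ⟨⟨x, hx, hqx, hbx⟩, -⟩ := (hc q h.hq b hb).1 hqb
    have hax : c a x := by
      by_contra hax
      exact hside b hb hbl hbp hqb.ne' y hy hpy (hA' x hx hqx hax ▸ hbx)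
    by_cases hsub : ∀ z ∈ X, c a z → c b z
    · refine ⟨b, hb, hqb, hbp, fun z hz hbz => ?_⟩
      by_cases hqz : c q z
      · exact Or.inr (Or.inr (hA' z hz hqz fun haz => hbz (hsub z hz haz)))
      · exact (hB' z hz hqz hbz).imp_right Or.inl
    by_cases hsub' : ∀ z ∈ X, c b z → c a z
    · refine ⟨a, ha, hqa, hap, fun z hz haz => ?_⟩
      by_cases hqz : c q z
      · exact Or.inr (Or.inr (hA' z hz hqz haz))
      · exact (hB' z hz hqz fun hbz => haz (hsub' z hz hbz)).imp_right Or.inl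
    · push Not at hsub hsub'
      obtain ⟨z, hz, haz, hbz⟩ := hsub
      obtain ⟨z', hz', hbz', haz'⟩ := hsub'
      exact absurd ⟨⟨x, hx, hax, hbx⟩, ⟨z, hz, haz, hbz⟩, ⟨z', hz', haz', hbz'⟩,
        ⟨r₀, hn.h0, out0 a ha hal hap, out0 b hb hbl hbp⟩⟩ hncr
  have hwl := notl w hqw hw
  -- such a neighbor is a leaf, so that `q` has degree two
  obtain ⟨u, -, -, -, hx⟩ := hL w hw q h.hq hqw.symm (by
    intro v hv hwv
    by_contra hvq
    have hvl : v ≠ l := by rintro rfl; exact hwp (h.nl w hw hwv.symm)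
    have hvp : v ≠ p := by
      rintro rfl
      exact (h.np w hw hwv.symm).elim hwl hqw.ne'
    obtain ⟨-, -, ⟨x, hx, hwx, hvx⟩, -⟩ := (hc w hw v hv).1 hwv
    rcases hfull x hx hwx with rfl | rfl | rfl
    · exact out0 v hv hvl hvp hvx
    · exact out1 v hv hvl hvp hvx
    · exact hside v hv hvl hvp hvq _ hx hpy hvx)
  obtain rfl := (hx p h.hp h.pq.symm).resolve_left hwp.symm
  exact h01 (((hx w₀ hw₀ h0).resolve_right hp0).trans ((hx w₁ hw₁ h1).resolve_right hp1).symm)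

/-- One half of the decomposition at `p`: if `P` is a union of components of `S - {l, p, q}` whose
columns lie inside the column of `p`, then the rows of `p` and two further ones represent the
smaller skeleton `P ∪ {l, p, q}`. -/
theorem bound_of_part {S P : Finset V} {l p q w₀ w₁ : V} (h : Pendant G S l p q)
    (hS : Conn G S) (hL : LeafCondition G S) {X : Finset ℕ} {c : V → ℕ → Prop}
    (hc : CrossRep G S X c) {r₀ r₁ : ℕ} (hn : Normal S X c l p r₀ r₁)
    (ih : LowerBoundBelow G S.card)
    (hw₀ : w₀ ∈ S) (hw₁ : w₁ ∈ S) (h0 : G.Adj q w₀) (h1 : G.Adj q w₁) (hp0 : w₀ ≠ p)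
    (hp1 : w₁ ≠ p) (h01 : w₀ ≠ w₁) (hPS : P ⊆ S) (hlP : l ∉ P) (hpP : p ∉ P) (hqP : q ∉ P)
    (hcl : ∀ v ∈ P, ∀ w ∈ S, w ≠ l → w ≠ p → w ≠ q → G.Adj v w → w ∈ P) (hne : P.Nonempty)
    (hlt : P.card + 3 < S.card) (hside : ∀ w ∈ P, ∀ x ∈ X, ¬ c p x → ¬ c w x) :
    P.card + 3 + 1 ≤ (X.filter (c p)).card + 2 := by
  have hpl : p ≠ l := h.lp.ne'
  have hqp : q ≠ p := h.pq.ne'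
  have hq0 := hn.rest q h.hq h.ql hqp r₀ hn.h0 hn.l0
  have hq1 := hn.rest q h.hq h.ql hqp r₁ hn.h1 hn.l1
  have hnbr : ∀ v ∈ P, ∀ w ∈ S, G.Adj v w → w ∈ P ∨ w = q := by
    intro v hv w hw hvw
    by_cases hwl : w = l
    · subst hwl
      exact absurd (h.nl v (hPS hv) hvw.symm ▸ hv) hpP
    by_cases hwp : w = p
    · subst hwp
      rcases h.np v (hPS hv) hvw.symm with rfl | rfl
      · exact absurd hv hlP
      · exact absurd hv hqP
    by_cases hwq : w = q
    · exact Or.inr hwq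
    · exact Or.inl (hcl v hv w hw hwl hwp hwq hvw)
  obtain ⟨a, haP, hqa⟩ : ∃ a ∈ P, G.Adj q a := by
    by_contra hcon
    push Not at hcon
    have := hS P hPS hne fun v hv w hw hvw => (hnbr v hv w hw hvw).resolve_right (by
      rintro rfl
      exact hcon v hv hvw.symm)
    exact hqP (this ▸ h.hq)
  have hPlp : ∀ w ∈ P, w ≠ l ∧ w ≠ p ∧ w ≠ q := fun w hw =>
    ⟨by rintro rfl; exact hlP hw, by rintro rfl; exact hpP hw, by rintro rfl; exact hqP hw⟩
  set S' : Finset V := insert l (insert p (insert q P)) with hS'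
  have hmem : ∀ x, x ∈ S' ↔ x = l ∨ x = p ∨ x = q ∨ x ∈ P := by simp [hS']
  have hS'S : S' ⊆ S := by
    intro x hx
    rcases (hmem x).1 hx with rfl | rfl | rfl | hx
    exacts [h.hl, h.hp, h.hq, hPS hx]
  have hcardS' : S'.card = P.card + 3 := by
    rw [hS', Finset.card_insert_of_notMem (by simp [hpl.symm, h.ql.symm, hlP]),
      Finset.card_insert_of_notMem (by simp [hqp.symm, hpP]), Finset.card_insert_of_notMem hqP]
  -- only `q` has neighbors outside `S'`
  have hexit : ∀ v ∈ S', ∀ w ∈ S, G.Adj v w → w ∈ S' ∨ v = q := by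
    intro v hv w hw hvw
    rcases (hmem v).1 hv with rfl | rfl | rfl | hv
    · exact Or.inl ((hmem w).2 (Or.inr (Or.inl (h.nl w hw hvw))))
    · exact Or.inl ((hmem w).2 ((h.np w hw hvw).imp_right fun e => Or.inr (Or.inl e)))
    · exact Or.inr rfl
    · exact Or.inl ((hmem w).2 (Or.inr (Or.inr (hnbr v hv w hw hvw).symm)))
  have hconn : Conn G S' := by
    intro A hA hne' hclA
    by_cases hqA : q ∈ A
    · have := hS (A ∪ (S \ S')) (Finset.union_subset (hA.trans hS'S) Finset.sdiff_subset)
        (hne'.mono Finset.subset_union_left) (by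
        intro a ha b hb hab
        rw [Finset.mem_union, Finset.mem_sdiff] at ha ⊢
        by_cases hbS : b ∈ S'
        · left
          rcases ha with ha | ha
          · exact hclA a ha b hbS hab
          · rcases hexit b hbS a ha.1 hab.symm with h' | rfl
            · exact absurd h' ha.2
            · exact hqA
        · exact Or.inr ⟨hb, hbS⟩)
      refine Finset.Subset.antisymm hA fun x hx => ?_
      have hx' := hS'S hx
      rw [← this, Finset.mem_union, Finset.mem_sdiff] at hx'
      exact hx'.resolve_right fun h' => h'.2 hx
    · exfalso
      have := hS A (hA.trans hS'S) hne' fun a ha b hb hab => by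
        rcases hexit a (hA ha) b hb hab with h' | rfl
        · exact hclA a ha b h' hab
        · exact absurd ha hqA
      exact hqA (this ▸ h.hq)
  have hleaf : LeafCondition G S' := by
    intro v hv w hw hvw huniq
    rcases (hmem v).1 hv with rfl | rfl | rfl | hvP
    · obtain rfl := h.nl w (hS'S hw) hvw
      exact ⟨q, by simp [hS'], h.ql, h.pq, fun x hx => h.np x (hS'S hx)⟩
    · exact absurd ((huniq l (by simp [hS']) h.lp.symm).trans
        (huniq q (by simp [hS']) h.pq).symm) h.ql.symm
    · exact absurd ((huniq p (by simp [hS']) h.pq.symm).trans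
        (huniq a (by simp [hS', haP]) hqa).symm) (hPlp a haP).2.1.symm
    · obtain ⟨u, hu, huv, hwu, hx⟩ := hL v (hPS hvP) w (hS'S hw) hvw fun x hx hvx =>
        huniq x ((hmem x).2 (Or.inr (Or.inr (hnbr v hvP x hx hvx).symm))) hvx
      rcases hnbr v hvP w (hS'S hw) hvw with hwP | rfl
      · exact ⟨u, (hmem u).2 (Or.inr (Or.inr (hnbr w hwP u hu hwu).symm)), huv, hwu,
          fun x hx' => hx x (hS'S hx')⟩
      · obtain rfl := (hx p h.hp h.pq.symm).resolve_left (hPlp v hvP).2.1.symm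
        exact absurd (((hx w₀ hw₀ h0).resolve_right hp0).trans
          ((hx w₁ hw₁ h1).resolve_right hp1).symm) h01
  obtain ⟨⟨z, hz, hpz, hqz⟩, -, ⟨y, hy, hpy, hqy⟩, -⟩ := (hc p h.hp q h.hq).1 h.pq
  have hlz : ¬ c l z := fun h' => hn.rest q h.hq h.ql hqp z hz h' hqz
  have hly : ¬ c l y := fun h' => hn.rest q h.hq h.ql hqp y hy h' hqy
  set X' : Finset ℕ := X.filter (c p) ∪ {r₀, y} with hX'
  have hX'X : X' ⊆ X := by
    rw [hX']
    refine Finset.union_subset (Finset.filter_subset _ _) ?_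
    intro x hx
    simp only [Finset.mem_insert, Finset.mem_singleton] at hx
    rcases hx with rfl | rfl
    exacts [hn.h0, hy]
  have hin : ∀ x ∈ X, c p x → x ∈ X' := fun x hx hpx => by simp [hX', hx, hpx]
  have h0X' : r₀ ∈ X' := by simp [hX']
  have hyX' : y ∈ X' := by simp [hX']
  have cr_lp : Cross X' (c l) (c p) :=
    ⟨⟨r₁, hin _ hn.h1 hn.p1, hn.l1, hn.p1⟩, ⟨r₀, h0X', hn.l0, hn.p0⟩, ⟨z, hin _ hz hpz, hlz, hpz⟩,
      ⟨y, hyX', hly, hpy⟩⟩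
  have cr_pq : Cross X' (c p) (c q) :=
    ⟨⟨z, hin _ hz hpz, hpz, hqz⟩, ⟨r₁, hin _ hn.h1 hn.p1, hn.p1, hq1⟩, ⟨y, hyX', hpy, hqy⟩,
      ⟨r₀, h0X', hn.p0, hq0⟩⟩
  have cr_qP : ∀ w ∈ P, G.Adj q w → Cross X' (c q) (c w) := by
    intro w hw hqw
    obtain ⟨⟨x1, k1, p1, q1⟩, -, ⟨x3, k3, p3, q3⟩, -⟩ := (hc q h.hq w (hPS hw)).1 hqw
    exact ⟨⟨x1, hin _ k1 (by_contra fun g => hside w hw _ k1 g q1), p1, q1⟩,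
      ⟨y, hyX', hqy, hside w hw y hy hpy⟩,
      ⟨x3, hin _ k3 (by_contra fun g => hside w hw _ k3 g q3), p3, q3⟩,
      ⟨r₀, h0X', hq0, hside w hw r₀ hn.h0 hn.p0⟩⟩
  have cr_PP : ∀ v ∈ P, ∀ w ∈ P, G.Adj v w → Cross X' (c v) (c w) := by
    intro v hv w hw hvw
    obtain ⟨⟨x1, k1, p1, q1⟩, ⟨x2, k2, p2, q2⟩, ⟨x3, k3, p3, q3⟩, -⟩ :=
      (hc v (hPS hv) w (hPS hw)).1 hvw
    exact ⟨⟨x1, hin _ k1 (by_contra fun g => hside w hw _ k1 g q1), p1, q1⟩,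
      ⟨x2, hin _ k2 (by_contra fun g => hside v hv _ k2 g p2), p2, q2⟩,
      ⟨x3, hin _ k3 (by_contra fun g => hside w hw _ k3 g q3), p3, q3⟩,
      ⟨r₀, h0X', hside v hv r₀ hn.h0 hn.p0, hside w hw r₀ hn.h0 hn.p0⟩⟩
  have := ih S' (by omega) (by omega) hconn hleaf c X' (hc.restrict hS'S hX'X (by
    intro u hu v hv huv
    rcases (hmem u).1 hu with rfl | rfl | rfl | huP
    · obtain rfl := h.nl v (hS'S hv) huv
      exact cr_lp
    · rcases h.np v (hS'S hv) huv with rfl | rfl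
      · exact cr_lp.symm
      · exact cr_pq
    · rcases (hmem v).1 hv with rfl | rfl | rfl | hvP
      · exact absurd (h.nl u (hS'S hu) huv.symm) hqp
      · exact cr_pq.symm
      · exact absurd huv G.irrefl
      · exact cr_qP v hvP huv
    · rcases hnbr u huP v (hS'S hv) huv with hvP | rfl
      · exact cr_PP u huP v hvP huv
      · exact (cr_qP u huP huv.symm).symm))
  have hcardX' : X'.card ≤ (X.filter (c p)).card + 2 :=
    (Finset.card_union_le _ _).trans (Nat.add_le_add_left Finset.card_le_two _)
  omega

/-- If `q` has at least three neighbors, then the columns of the vertices beyond `q`, which do not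
cross that of `p`, lie inside the column of `p` or inside its complement, and adjacent vertices lie
on the same side. If both sides occur, each side yields a smaller skeleton, and the rows are
divided between the two. -/
theorem bound_of_degree_ge_three {S : Finset V} {l p q w₀ w₁ : V} (h : Pendant G S l p q)
    (hG : ∀ u v w, G.Adj u v → G.Adj u w → ¬ G.Adj v w) (hS : Conn G S)
    (hL : LeafCondition G S) {X : Finset ℕ} {c : V → ℕ → Prop} (hc : CrossRep G S X c) {r₀ r₁ : ℕ}
    (hn : Normal S X c l p r₀ r₁) (ih : LowerBoundBelow G S.card)
    (hw₀ : w₀ ∈ S) (hw₁ : w₁ ∈ S) (h0 : G.Adj q w₀) (h1 : G.Adj q w₁) (hp0 : w₀ ≠ p)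
    (hp1 : w₁ ≠ p) (h01 : w₀ ≠ w₁) : S.card + 1 ≤ X.card := by
  have hpl : p ≠ l := h.lp.ne'
  have hqp : q ≠ p := h.pq.ne'
  -- complementing the column of `p` exchanges the roles of `r₀` and `r₁`
  obtain ⟨c', hc'p, hc'w⟩ : ∃ c' : V → ℕ → Prop, (∀ x, c' p x ↔ ¬ c p x) ∧
      ∀ w, w ≠ p → c' w = c w :=
    ⟨fun v x => if v = p then ¬ c v x else c v x, by simp, fun w hw => by simp [hw]⟩
  have hc' : CrossRep G S X c' := hc.flip fun v => by
    by_cases hv : v = p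
    · subst hv; exact Or.inr hc'p
    · exact Or.inl fun x => by rw [hc'w v hv]
  have hn' : Normal S X c' l p r₁ r₀ := by
    refine ⟨hn.h1, hn.h0, ?_, ?_, ?_, ?_, ?_⟩
    · rw [hc'w l hpl.symm]; exact hn.l1
    · rw [hc'w l hpl.symm]; exact hn.l0
    · rw [hc'p]; exact not_not.2 hn.p1
    · rw [hc'p]; exact hn.p0
    · intro w hw hwl hwp x hx
      rw [hc'w l hpl.symm, hc'w w hwp]
      exact hn.rest w hw hwl hwp x hx
  set R : Finset V := ((S.erase l).erase p).erase q with hR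
  have hmemR : ∀ x, x ∈ R ↔ x ≠ q ∧ x ≠ p ∧ x ≠ l ∧ x ∈ S := by simp [hR]
  set P := R.filter fun w => ∀ x ∈ X, ¬ c p x → ¬ c w x with hP
  set N := R.filter fun w => ∀ x ∈ X, c p x → ¬ c w x with hN
  have hPN : ∀ w ∈ R, w ∈ P ∨ w ∈ N := by
    intro w hw
    have hwR := (hmemR w).1 hw
    rw [hP, hN, Finset.mem_filter, Finset.mem_filter]
    by_contra hcon
    push Not at hcon
    obtain ⟨x, hx, hpx, hwx⟩ := hcon.1 hw
    obtain ⟨x', hx', hpx', hwx'⟩ := hcon.2 hw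
    have : Cross X (c p) (c w) :=
      ⟨⟨x', hx', hpx', hwx'⟩, ⟨r₁, hn.h1, hn.p1,
        hn.rest w hwR.2.2.2 hwR.2.2.1 hwR.2.1 _ hn.h1 hn.l1⟩,
        ⟨x, hx, hpx, hwx⟩, ⟨r₀, hn.h0, hn.p0, hn.rest w hwR.2.2.2 hwR.2.2.1 hwR.2.1 _ hn.h0 hn.l0⟩⟩
    exact (h.np w hwR.2.2.2 ((hc p h.hp w hwR.2.2.2).2 this)).elim hwR.2.2.1 hwR.1
  have hadj : ∀ v ∈ P, ∀ w ∈ N, ¬ G.Adj v w := by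
    intro v hv w hw hvw
    rw [hP, Finset.mem_filter] at hv
    rw [hN, Finset.mem_filter] at hw
    obtain ⟨⟨x, hx, hvx, hwx⟩, -⟩ :=
      (hc v ((hmemR v).1 hv.1).2.2.2 w ((hmemR w).1 hw.1).2.2.2).1 hvw
    by_cases hpx : c p x
    · exact hw.2 x hx hpx hwx
    · exact hv.2 x hx hpx hvx
  have hPR : P ⊆ R := Finset.filter_subset _ _
  have hNR : N ⊆ R := Finset.filter_subset _ _
  have hRS : R ⊆ S := fun x hx => ((hmemR x).1 hx).2.2.2
  have hcardR : R.card + 3 = S.card := by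
    have e1 := Finset.card_erase_add_one h.hl
    have e2 : ((S.erase l).erase p).card + 1 = _ := Finset.card_erase_add_one (by simp [hpl, h.hp])
    have e3 : R.card + 1 = _ := Finset.card_erase_add_one (by simp [hqp, h.ql, h.hq])
    omega
  by_cases hNe : N = ∅
  · refine bound_of_one_side h hG hS hL hc hn ih hw₀ hw₁ h0 h1 hp0 hp1 h01
      fun w hw hwl hwp hwq => ?_
    have : w ∈ P := (hPN w ((hmemR w).2 ⟨hwq, hwp, hwl, hw⟩)).resolve_right (by simp [hNe])
    exact (Finset.mem_filter.1 this).2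
  by_cases hPe : P = ∅
  · refine bound_of_one_side h hG hS hL hc' hn' ih hw₀ hw₁ h0 h1 hp0 hp1 h01
      fun w hw hwl hwp hwq x hx hpx => ?_
    have : w ∈ N := (hPN w ((hmemR w).2 ⟨hwq, hwp, hwl, hw⟩)).resolve_left (by simp [hPe])
    rw [hc'w w hwp]
    exact (Finset.mem_filter.1 this).2 x hx (by rwa [hc'p, not_not] at hpx)
  have hdisj : Disjoint P N := by
    rw [Finset.disjoint_left]
    intro w hwP hwN
    have hwS := hRS (hPR hwP)
    rw [hP, Finset.mem_filter] at hwP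
    rw [hN, Finset.mem_filter] at hwN
    -- an empty column crosses nothing, but `w` has a neighbor
    have hempty : ∀ x ∈ X, ¬ c w x := fun x hx => by
      by_cases hpx : c p x
      · exact hwN.2 x hx hpx
      · exact hwP.2 x hx hpx
    have := hS {w} (by simpa using hwS) (by simp) (by
      intro a ha b hb hab
      rw [Finset.mem_singleton] at ha
      subst ha
      obtain ⟨⟨x, hx, hax, -⟩, -⟩ := (hc a hwS b hb).1 hab
      exact absurd hax (hempty x hx))
    have hl : l ∈ ({w} : Finset V) := this ▸ h.hl
    exact ((hmemR w).1 hwP.1).2.2.1 (Finset.mem_singleton.1 hl).symm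
  have hsum : P.card + N.card = R.card := by
    rw [← Finset.card_union_of_disjoint hdisj]
    congr 1
    ext w
    rw [Finset.mem_union]
    exact ⟨fun h' => h'.elim (fun g => hPR g) fun g => hNR g, hPN w⟩
  have hPpos : 0 < P.card := Finset.card_pos.2 (Finset.nonempty_iff_ne_empty.2 hPe)
  have hNpos : 0 < N.card := Finset.card_pos.2 (Finset.nonempty_iff_ne_empty.2 hNe)
  have hlR : l ∉ R := by simp [hR]
  have hpR : p ∉ R := by simp [hR]
  have hqR : q ∉ R := by simp [hR]
  have b1 := bound_of_part (P := P) h hS hL hc hn ih hw₀ hw₁ h0 h1 hp0 hp1 h01 (hPR.trans hRS)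
    (fun g => hlR (hPR g)) (fun g => hpR (hPR g)) (fun g => hqR (hPR g))
    (fun v hv w hw hwl hwp hwq hvw => (hPN w ((hmemR w).2 ⟨hwq, hwp, hwl, hw⟩)).resolve_right
      fun g => hadj v hv w g hvw)
    (Finset.card_pos.1 hPpos) (by omega) (fun w hw => (Finset.mem_filter.1 hw).2)
  have b2 := bound_of_part (P := N) h hS hL hc' hn' ih hw₀ hw₁ h0 h1 hp0 hp1 h01 (hNR.trans hRS)
    (fun g => hlR (hNR g)) (fun g => hpR (hNR g)) (fun g => hqR (hNR g))
    (fun v hv w hw hwl hwp hwq hvw => (hPN w ((hmemR w).2 ⟨hwq, hwp, hwl, hw⟩)).resolve_left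
      fun g => hadj w g v hv hvw.symm)
    (Finset.card_pos.1 hNpos) (by omega) (by
      intro w hw x hx hpx
      rw [hc'w w ((hmemR w).1 (hNR hw)).2.1]
      exact (Finset.mem_filter.1 hw).2 x hx (by rwa [hc'p, not_not] at hpx))
  have hsplit : (X.filter (c p)).card + (X.filter (c' p)).card = X.card := by
    rw [show X.filter (c' p) = X.filter (fun x => ¬ c p x) from
      Finset.filter_congr fun x _ => hc'p x]
    exact Finset.card_filter_add_card_filter_not _
  omega

/-- A skeleton with at least three vertices whose edges are exactly the crossing pairs of columns
has more rows than vertices. -/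
theorem card_lt_card_of_crossRep (hG : ∀ S : Finset V, S.Nonempty →
      ∃ v ∈ S, ∀ x ∈ S, ∀ y ∈ S, G.Adj v x → G.Adj v y → x = y) :
    ∀ (N : ℕ) (S : Finset V), S.card = N → 3 ≤ S.card → Conn G S → LeafCondition G S →
      ∀ (c : V → ℕ → Prop) (X : Finset ℕ), CrossRep G S X c → S.card + 1 ≤ X.card := by
  have htri : ∀ u v w, G.Adj u v → G.Adj u w → ¬ G.Adj v w := by
    intro u v w huv huw hvw
    obtain ⟨a, ha, hx⟩ := hG {u, v, w} (by simp)
    simp only [Finset.mem_insert, Finset.mem_singleton] at ha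
    rcases ha with rfl | rfl | rfl
    · exact hvw.ne (hx v (by simp) w (by simp) huv huw)
    · exact huw.ne (hx u (by simp) w (by simp) huv.symm hvw)
    · exact huv.ne (hx u (by simp) v (by simp) huw.symm hvw.symm)
  intro N
  induction N using Nat.strong_induction_on with
  | _ N IH =>
  intro S hSN h3 hS hL c X hc
  have ih : LowerBoundBelow G S.card := fun S' hlt h3' hS' hL' c' X' hc' =>
    IH S'.card (hSN ▸ hlt) S' rfl h3' hS' hL' c' X' hc'
  obtain ⟨l, hl, huniq⟩ := hG S (Finset.card_pos.1 (by omega))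
  obtain ⟨p, hp, hlp⟩ : ∃ p ∈ S, G.Adj l p := by
    by_contra hcon
    push Not at hcon
    have := hS {l} (by simpa using hl) (by simp) (by
      intro a ha b hb hab
      rw [Finset.mem_singleton] at ha
      exact absurd hab (ha ▸ hcon b hb))
    rw [← this] at h3
    simp at h3
  have nl : ∀ x ∈ S, G.Adj l x → x = p := fun x hx hlx => huniq x hx p hp hlx hlp
  obtain ⟨q, hq, hql, hpq, np⟩ := hL l hl p hp hlp nl
  have h : Pendant G S l p q := ⟨hl, hp, hq, hlp, hpq, hql, nl, np⟩
  by_cases hw : ∃ w₀ ∈ S, G.Adj q w₀ ∧ w₀ ≠ p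
  · obtain ⟨w₀, hw₀, h0, hp0⟩ := hw
    obtain ⟨c', r₀, r₁, hc', hn⟩ := h.exists_normal hS hc
    by_cases hw' : ∃ w₁ ∈ S, G.Adj q w₁ ∧ w₁ ≠ p ∧ w₀ ≠ w₁
    · obtain ⟨w₁, hw₁, h1, hp1, h01⟩ := hw'
      exact bound_of_degree_ge_three h htri hS hL hc' hn ih hw₀ hw₁ h0 h1 hp0 hp1 h01
    · push Not at hw'
      refine bound_of_degree_two h hS hL hc' hn ih hw₀ h0 hp0 fun x hx hqx => ?_
      by_cases hxp : x = p
      · exact Or.inl hxp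
      · exact Or.inr (hw' x hx hqx hxp).symm
  · -- the skeleton is the path `l, p, q`
    push Not at hw
    have := hS {l, p, q} (by
        intro x hx
        simp only [Finset.mem_insert, Finset.mem_singleton] at hx
        rcases hx with rfl | rfl | rfl <;> assumption) (by simp) (by
      intro a ha b hb hab
      simp only [Finset.mem_insert, Finset.mem_singleton] at ha ⊢
      rcases ha with rfl | rfl | rfl
      · exact Or.inr (Or.inl (nl b hb hab))
      · exact (np b hb hab).imp_right Or.inr
      · exact Or.inr (Or.inl (hw b hb hab)))
    have h4 := ((hc l hl p hp).1 hlp).four_le_card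
    have : S.card ≤ 3 := by rw [← this]; exact Finset.card_le_three
    omega

end LowerBound

/-! ### Rooted trees -/

section Rooted

variable {V : Type*} {G : SimpleGraph V}

/-- `G` is the tree with root `ρ` in which the parent of each vertex `v ≠ ρ` is `par v`; the value
`par ρ` is irrelevant. The function `dep` (for instance the distance from the root) witnesses that
there are no cycles. -/
structure IsRooted (G : SimpleGraph V) (ρ : V) (par : V → V) (dep : V → ℕ) : Prop where
  adj_iff : ∀ u v, G.Adj u v ↔ (u ≠ ρ ∧ par u = v) ∨ (v ≠ ρ ∧ par v = u)
  dep_lt : ∀ v, v ≠ ρ → dep (par v) < dep v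

/-- The parent of a vertex is its neighbor on the path to the root. -/
theorem exists_isRooted (hG : G.IsTree) (ρ : V) : ∃ par dep, IsRooted G ρ par dep := by
  have huniq : ∀ u v v', G.Adj u v → G.Adj u v' → G.dist ρ u = G.dist ρ v + 1 →
      G.dist ρ u = G.dist ρ v' + 1 → v = v' := by
    intro u v v' hv hv' hd hd'
    obtain ⟨p, hp⟩ := hG.connected.exists_walk_length_eq_dist ρ v
    obtain ⟨p', hp'⟩ := hG.connected.exists_walk_length_eq_dist ρ v'
    have h1 : (p.concat hv.symm).IsPath :=
      SimpleGraph.Walk.isPath_of_length_eq_dist _ (by rw [SimpleGraph.Walk.length_concat]; omega)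
    have h2 : (p'.concat hv'.symm).IsPath :=
      SimpleGraph.Walk.isPath_of_length_eq_dist _ (by rw [SimpleGraph.Walk.length_concat]; omega)
    have h3 := congrArg SimpleGraph.Walk.penultimate
      ((hG.existsUnique_path ρ u).unique h1 h2)
    simpa using h3
  have hex : ∀ u, u ≠ ρ → ∃ v, G.Adj u v ∧ G.dist ρ u = G.dist ρ v + 1 := by
    intro u hu
    obtain ⟨p, hp⟩ := hG.connected.exists_walk_length_eq_dist u ρ
    cases p with
    | nil => exact absurd rfl hu
    | cons h p =>
      rename_i v
      refine ⟨v, h, ?_⟩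
      have h1 : G.dist v ρ ≤ p.length := SimpleGraph.dist_le p
      rw [SimpleGraph.Walk.length_cons, SimpleGraph.dist_comm] at hp
      rw [SimpleGraph.dist_comm] at h1
      rcases hG.dist_eq_dist_add_one_of_adj ρ h with h2 | h2 <;> omega
  classical
  refine ⟨fun u => if hu : u ≠ ρ then (hex u hu).choose else u, G.dist ρ, ?_, ?_⟩
  · have key : ∀ u (hu : u ≠ ρ), G.Adj u (hex u hu).choose ∧
        G.dist ρ u = G.dist ρ (hex u hu).choose + 1 := fun u hu => (hex u hu).choose_spec
    have key' : ∀ u v, G.Adj u v → G.dist ρ u = G.dist ρ v + 1 →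
        ∃ hu : u ≠ ρ, (hex u hu).choose = v := by
      intro u v huv hd
      have hu : u ≠ ρ := by
        rintro rfl
        simp at hd
      exact ⟨hu, huniq u _ v (key u hu).1 huv (key u hu).2 hd⟩
    intro u v
    constructor
    · intro huv
      rcases hG.dist_eq_dist_add_one_of_adj ρ huv with h | h
      · obtain ⟨hu, h'⟩ := key' u v huv h
        exact Or.inl ⟨hu, by simp only [hu, ne_eq, not_false_iff, dif_pos]; exact h'⟩
      · obtain ⟨hu, h'⟩ := key' v u huv.symm h
        exact Or.inr ⟨hu, by simp only [hu, ne_eq, not_false_iff, dif_pos]; exact h'⟩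
    · rintro (⟨hu, h⟩ | ⟨hu, h⟩)
      · simp only [hu, ne_eq, not_false_iff, dif_pos] at h
        exact h ▸ (key u hu).1
      · simp only [hu, ne_eq, not_false_iff, dif_pos] at h
        exact h ▸ (key v hu).1.symm
  · intro v hv
    simp only [hv, ne_eq, not_false_iff, dif_pos]
    have := (hex v hv).choose_spec.2
    omega

namespace IsRooted

variable {ρ : V} {par : V → V} {dep : V → ℕ}

theorem adj_par (h : IsRooted G ρ par dep) {v : V} (hv : v ≠ ρ) : G.Adj v (par v) :=
  (h.adj_iff _ _).2 (Or.inl ⟨hv, rfl⟩)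

theorem par_ne (h : IsRooted G ρ par dep) {v : V} (hv : v ≠ ρ) : par v ≠ v :=
  (h.adj_par hv).ne'

/-- Forests are `1`-degenerate: a deepest vertex of `S` has only its parent as a neighbor in `S`. -/
theorem exists_unique_neighbor (h : IsRooted G ρ par dep) (S : Finset V) (hS : S.Nonempty) :
    ∃ v ∈ S, ∀ x ∈ S, ∀ y ∈ S, G.Adj v x → G.Adj v y → x = y := by
  obtain ⟨v, hv, hmax⟩ := S.exists_max_image dep hS
  have key : ∀ x ∈ S, G.Adj v x → par v = x := by
    intro x hx hvx
    rcases (h.adj_iff _ _).1 hvx with ⟨-, h'⟩ | ⟨hne, h'⟩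
    · exact h'
    · have h1 := h.dep_lt x hne
      have h2 := hmax x hx
      rw [h'] at h1
      omega
  exact ⟨v, hv, fun x hx y hy hvx hvy => (key x hx hvx).symm.trans (key y hy hvy)⟩

end IsRooted

/-- A vertex without children that is not the root. (A root of degree one does not count.) -/
def IsLeafOf (ρ : V) (par : V → V) (v : V) : Prop :=
  v ≠ ρ ∧ ∀ c, c ≠ ρ → par c ≠ v

/-- A vertex that is not a leaf, although all of its children are leaves. -/
def IsLastInner (ρ : V) (par : V → V) (v : V) : Prop :=
  ¬ IsLeafOf ρ par v ∧ ∀ c, c ≠ ρ → par c = v → IsLeafOf ρ par c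

open scoped Classical in
/-- The size of the representation built from the rooted tree: one point to begin with, one point
for each inner vertex, and another one if all children of that vertex are leaves. -/
noncomputable def weight [Fintype V] (ρ : V) (par : V → V) : ℕ :=
  1 + (Finset.univ.filter fun v => ¬ IsLeafOf ρ par v).card +
    (Finset.univ.filter fun v => IsLastInner ρ par v).card

end Rooted

/-! ### Skeletons as vertex sets -/

section Skeleton

open scoped Classical

variable {V : Type*} {T : SimpleGraph V}

theorem conn_univ {W : Type*} [Fintype W] {G : SimpleGraph W} (hG : G.Connected) :
    Conn G Finset.univ := by
  intro A _ ⟨a, ha⟩ hcl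
  rw [Finset.eq_univ_iff_forall]
  intro b
  obtain ⟨p⟩ := hG a b
  induction p with
  | nil => exact ha
  | cons h _ ih => exact ih (hcl _ ha _ (Finset.mem_univ _) h)

theorem leafCondition_univ {W : Type*} [Fintype W] {G : SimpleGraph W} (hG : IsSkeleton G) :
    LeafCondition G Finset.univ := by
  intro v _ w _ hvw huniq
  have h1 : G.neighborSet v = {w} := by
    ext x
    simp only [SimpleGraph.mem_neighborSet, Set.mem_singleton_iff]
    exact ⟨fun h => huniq x (Finset.mem_univ _) h, fun h => h ▸ hvw⟩
  obtain ⟨a, b, hab, hN⟩ := Set.ncard_eq_two.1 (hG.2 v w (by rw [h1, Set.ncard_singleton]) hvw)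
  have hmem : ∀ x, G.Adj w x ↔ x = a ∨ x = b := fun x => by
    rw [← SimpleGraph.mem_neighborSet, hN]; simp
  rcases (hmem v).1 hvw.symm with rfl | rfl
  · exact ⟨b, Finset.mem_univ _, hab.symm, (hmem b).2 (Or.inr rfl), fun x _ h => (hmem x).1 h⟩
  · exact ⟨a, Finset.mem_univ _, hab, (hmem a).2 (Or.inl rfl), fun x _ h => ((hmem x).1 h).symm⟩

/-- A connected subgraph of a forest is induced. -/
theorem coe_adj_iff (hT : T.IsAcyclic) (S : T.Subgraph) (hS : S.coe.Connected) (u v : S.verts) :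
    S.coe.Adj u v ↔ T.Adj u v := by
  refine ⟨fun h => S.adj_sub h, fun h => ?_⟩
  obtain ⟨p, hp⟩ := (hS u v).exists_isPath
  have h1 : (p.map S.hom).IsPath := hp.map S.hom_injective
  have h : T.Adj (S.hom u) (S.hom v) := h
  have h2 := (hT.subsingleton_path _ _).elim ⟨_, h1⟩ (SimpleGraph.Path.singleton h)
  have h3 := congrArg (fun q : T.Path (S.hom u) (S.hom v) => q.1.length) h2
  simp only [SimpleGraph.Path.singleton] at h3
  rw [SimpleGraph.Walk.length_map] at h3
  exact SimpleGraph.Walk.adj_of_length_eq_one h3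

theorem overlap_iff_cross {A B X : Finset ℕ} (hA : A ⊆ X) (hB : B ⊆ X)
    (hX : ∃ x ∈ X, x ∉ A ∧ x ∉ B) : Overlap A B ↔ Cross X (· ∈ A) (· ∈ B) := by
  constructor
  · rintro ⟨⟨x, hx⟩, h1, h2⟩
    rw [Finset.not_subset] at h1 h2
    obtain ⟨y, hy, hy'⟩ := h1
    obtain ⟨z, hz, hz'⟩ := h2
    rw [Finset.mem_inter] at hx
    exact ⟨⟨x, hA hx.1, hx⟩, ⟨y, hA hy, hy, hy'⟩, ⟨z, hB hz, hz', hz⟩, hX⟩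
  · rintro ⟨⟨x, -, hx⟩, ⟨y, -, hy, hy'⟩, ⟨z, -, hz', hz⟩, -⟩
    exact ⟨⟨x, Finset.mem_inter.2 hx⟩, fun h => hy' (h hy), fun h => hz' (h hz)⟩

/-- The sets assigned to the vertices of a skeleton are columns whose rows are the used points and
one point outside of all sets; with this point, overlapping is the same as crossing. -/
theorem ncard_verts_le_size [Fintype V] (hT : T.IsTree) (S : T.Subgraph) (hS : IsSkeleton S.coe)
    (h3 : 3 ≤ S.verts.ncard) (f : V → Finset ℕ) (hf : IsOverlapRep T f) :
    S.verts.ncard ≤ size f := by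
  have : Fintype S.verts := Fintype.ofFinite _
  have hcard : (Finset.univ : Finset S.verts).card = S.verts.ncard := by
    rw [Finset.card_univ, ← Nat.card_eq_fintype_card, Nat.card_coe_set_eq]
  set U := Finset.univ.biUnion f with hU
  have hfU : ∀ v, f v ⊆ U := fun v => Finset.subset_biUnion_of_mem f (Finset.mem_univ v)
  -- an extra row outside of all sets turns overlapping into crossing
  obtain ⟨y, hy⟩ := Infinite.exists_notMem_finset U
  obtain ⟨ρ, -⟩ : ∃ x : S.verts, x ∈ (Finset.univ : Finset S.verts) :=
    (Finset.card_pos.1 (by omega))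
  obtain ⟨par, dep, hr⟩ := exists_isRooted hS.1 ρ
  have := card_lt_card_of_crossRep hr.exists_unique_neighbor _ Finset.univ rfl (by omega)
    (conn_univ hS.1.connected) (leafCondition_univ hS) (fun v x => x ∈ f v) (insert y U) (by
      intro u _ v _
      rw [coe_adj_iff hT.isAcyclic S hS.1.connected, hf]
      exact overlap_iff_cross ((hfU _).trans (Finset.subset_insert _ _))
        ((hfU _).trans (Finset.subset_insert _ _))
        ⟨y, Finset.mem_insert_self _ _, fun h => hy (hfU _ h), fun h => hy (hfU _ h)⟩)
  rw [Finset.card_insert_of_notMem hy, hcard] at this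
  have h' : U.card = size f := rfl
  omega

/-- The condition on leaves carries over from a vertex set to the subgraph induced by it. -/
theorem isSkeleton_induce {S : Finset V} (hT : T.IsAcyclic)
    (hconn : ((⊤ : T.Subgraph).induce (S : Set V)).coe.Connected) (hleaf : LeafCondition T S) :
    IsSkeleton ((⊤ : T.Subgraph).induce (S : Set V)).coe := by
  refine ⟨⟨hconn, hT.subgraph _⟩, ?_⟩
  rintro ⟨v, hv⟩ ⟨w, hw⟩ h1 hvw
  simp only [SimpleGraph.Subgraph.induce_verts, Finset.mem_coe] at hv hw
  have hadj : ∀ a b : ((⊤ : T.Subgraph).induce (S : Set V)).verts,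
      ((⊤ : T.Subgraph).induce (S : Set V)).coe.Adj a b ↔ T.Adj a b := by
    rintro ⟨a, ha⟩ ⟨b, hb⟩
    simp only [SimpleGraph.Subgraph.induce_verts, Finset.mem_coe] at ha hb
    simp [SimpleGraph.Subgraph.coe_adj, ha, hb]
  obtain ⟨z, hz⟩ := Set.ncard_eq_one.1 h1
  have huniq : ∀ x ∈ S, T.Adj v x → x = w := by
    intro x hx hvx
    have e1 : (⟨x, hx⟩ : ((⊤ : T.Subgraph).induce (S : Set V)).verts) = z := by
      rw [← Set.mem_singleton_iff, ← hz]
      exact (hadj _ _).2 hvx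
    have e2 : (⟨w, hw⟩ : ((⊤ : T.Subgraph).induce (S : Set V)).verts) = z := by
      rw [← Set.mem_singleton_iff, ← hz]
      exact hvw
    exact congrArg Subtype.val (e1.trans e2.symm)
  obtain ⟨u, hu, huv, hwu, hall⟩ := hleaf v hv w hw ((hadj _ _).1 hvw) huniq
  refine Set.ncard_eq_two.2 ⟨⟨v, hv⟩, ⟨u, hu⟩, fun e => huv (congrArg Subtype.val e).symm, ?_⟩
  ext ⟨x, hx⟩
  simp only [SimpleGraph.mem_neighborSet, Set.mem_insert_iff, Set.mem_singleton_iff, hadj]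
  rw [Subtype.ext_iff, Subtype.ext_iff]
  constructor
  · exact hall x hx
  · rintro (h | h)
    · obtain rfl : x = v := h
      exact ((hadj _ _).1 hvw).symm
    · obtain rfl : x = u := h
      exact hwu

/-- The inner vertices, one leaf child for each inner vertex all of whose children are leaves, and
one further leaf at the root form a skeleton with `weight ρ par` vertices. -/
theorem exists_skeleton_of_weight [Fintype V] (hT : T.IsTree) {ρ : V} {par : V → V}
    {dep : V → ℕ} (h : IsRooted T ρ par dep)
    (htwo : ∃ a b, a ≠ b ∧ a ≠ ρ ∧ b ≠ ρ ∧ par a = ρ ∧ par b = ρ)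
    (hone : ∀ a b, a ≠ ρ → b ≠ ρ → par a = ρ → par b = ρ → ¬ IsLeafOf ρ par a →
      ¬ IsLeafOf ρ par b → a = b) :
    ∃ S : T.Subgraph, IsSkeleton S.coe ∧ S.verts.ncard = weight ρ par := by
  have hinner_par : ∀ v, v ≠ ρ → ¬ IsLeafOf ρ par (par v) := fun v hv hl => hl.2 v hv rfl
  have hchild : ∀ v, ¬ IsLeafOf ρ par v → ∃ c, c ≠ ρ ∧ par c = v := by
    intro v hv
    by_cases hvρ : v = ρ
    · obtain ⟨a, b, -, ha, -, ha', -⟩ := htwo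
      exact ⟨a, ha, ha'.trans hvρ.symm⟩
    · by_contra hcon
      push Not at hcon
      exact hv ⟨hvρ, hcon⟩
  have hlam : ∀ v, ∃ c, IsLastInner ρ par v → c ≠ ρ ∧ par c = v := by
    intro v
    by_cases hv : IsLastInner ρ par v
    · obtain ⟨c, hc⟩ := hchild v hv.1
      exact ⟨c, fun _ => hc⟩
    · exact ⟨v, fun h' => absurd h' hv⟩
  choose lam hlam using hlam
  have hlam_leaf : ∀ v, IsLastInner ρ par v → IsLeafOf ρ par (lam v) := fun v hv =>
    hv.2 _ (hlam v hv).1 (hlam v hv).2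
  obtain ⟨e, heρ, hep, hel, hne⟩ : ∃ e, e ≠ ρ ∧ par e = ρ ∧ IsLeafOf ρ par e ∧
      (IsLastInner ρ par ρ → e ≠ lam ρ) := by
    obtain ⟨a, b, hab, ha, hb, ha', hb'⟩ := htwo
    by_cases hρ : IsLastInner ρ par ρ
    · by_cases hal : a = lam ρ
      · exact ⟨b, hb, hb', hρ.2 b hb hb', fun _ => hal ▸ hab.symm⟩
      · exact ⟨a, ha, ha', hρ.2 a ha ha', fun _ => hal⟩
    · by_cases hal : IsLeafOf ρ par a
      · exact ⟨a, ha, ha', hal, fun g => absurd g hρ⟩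
      · refine ⟨b, hb, hb', by_contra fun hbl => hab (hone a b ha hb ha' hb' hal hbl),
          fun g => absurd g hρ⟩
  set N := Finset.univ.filter fun v => ¬ IsLeafOf ρ par v with hN
  set N₀ := Finset.univ.filter fun v => IsLastInner ρ par v with hN₀
  have memN : ∀ v, v ∈ N ↔ ¬ IsLeafOf ρ par v := by simp [hN]
  have memN₀ : ∀ v, v ∈ N₀ ↔ IsLastInner ρ par v := by simp [hN₀]
  set S := insert e (N ∪ N₀.image lam) with hS
  have memS : ∀ v, v ∈ S ↔ v = e ∨ ¬ IsLeafOf ρ par v ∨ ∃ u, IsLastInner ρ par u ∧ lam u = v := by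
    simp [hS, memN, memN₀]
  have hNS : ∀ v, ¬ IsLeafOf ρ par v → v ∈ S := fun v hv => (memS v).2 (Or.inr (Or.inl hv))
  have hlamS : ∀ v, IsLastInner ρ par v → lam v ∈ S := fun v hv =>
    (memS _).2 (Or.inr (Or.inr ⟨v, hv, rfl⟩))
  have heS : e ∈ S := (memS _).2 (Or.inl rfl)
  have hρleaf : ¬ IsLeafOf ρ par ρ := fun g => g.1 rfl
  have hcard : S.card = weight ρ par := by
    have h1 : e ∉ N ∪ N₀.image lam := by
      simp only [Finset.mem_union, memN, Finset.mem_image, memN₀, not_or, not_not]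
      refine ⟨hel, ?_⟩
      rintro ⟨u, hu, rfl⟩
      have : u = ρ := (hlam u hu).2.symm.trans hep
      subst this
      exact hne hu rfl
    have h2 : Disjoint N (N₀.image lam) := by
      rw [Finset.disjoint_left]
      intro x hx hx'
      obtain ⟨u, hu, rfl⟩ := Finset.mem_image.1 hx'
      exact (memN _).1 hx (hlam_leaf u ((memN₀ _).1 hu))
    have h3 : (N₀.image lam).card = N₀.card := by
      refine Finset.card_image_of_injOn fun u hu v hv huv => ?_
      rw [← (hlam u ((memN₀ _).1 hu)).2, ← (hlam v ((memN₀ _).1 hv)).2, huv]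
    rw [hS, Finset.card_insert_of_notMem h1, Finset.card_union_of_disjoint h2, h3]
    change N.card + N₀.card + 1 = 1 + N.card + N₀.card
    omega
  -- the vertices that have a leaf of `S` as a child have degree two in `S`
  have hdeg : ∀ w, (w = ρ ∨ IsLastInner ρ par w) → ∃ a ∈ S, ∃ b ∈ S, a ≠ b ∧ T.Adj w a ∧
      T.Adj w b ∧ ∀ x ∈ S, T.Adj w x → x = a ∨ x = b := by
    intro w hw
    have hleafS : ∀ x ∈ S, x ≠ ρ → par x = w → IsLeafOf ρ par x →
        (w = ρ ∧ x = e) ∨ (IsLastInner ρ par w ∧ x = lam w) := by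
      intro x hx hxρ hxw hxl
      rcases (memS x).1 hx with rfl | hx | ⟨u, hu, rfl⟩
      · exact Or.inl ⟨hxw.symm.trans hep, rfl⟩
      · exact absurd hxl hx
      · have : u = w := (hlam u hu).2.symm.trans hxw
        subst this
        exact Or.inr ⟨hu, rfl⟩
    by_cases hwρ : w = ρ
    · subst hwρ
      have hnbr : ∀ x, T.Adj w x → x ≠ w ∧ par x = w := fun x hx =>
        ((h.adj_iff _ _).1 hx).resolve_left fun g => g.1 rfl
      by_cases hw₀ : IsLastInner w par w
      · refine ⟨e, heS, lam w, hlamS w hw₀, hne hw₀, (h.adj_iff _ _).2 (Or.inr ⟨heρ, hep⟩),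
          (h.adj_iff _ _).2 (Or.inr (hlam w hw₀)), fun x hx hwx => ?_⟩
        obtain ⟨h1, h2⟩ := hnbr x hwx
        exact (hleafS x hx h1 h2 (hw₀.2 x h1 h2)).imp And.right And.right
      · have : ∃ c, c ≠ w ∧ par c = w ∧ ¬ IsLeafOf w par c := by
          by_contra hcon
          push Not at hcon
          exact hw₀ ⟨hρleaf, hcon⟩
        obtain ⟨c, hcρ, hcp, hcl⟩ := this
        refine ⟨e, heS, c, hNS c hcl, fun g => hcl (g ▸ hel), (h.adj_iff _ _).2 (Or.inr ⟨heρ, hep⟩),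
          (h.adj_iff _ _).2 (Or.inr ⟨hcρ, hcp⟩), fun x hx hwx => ?_⟩
        obtain ⟨h1, h2⟩ := hnbr x hwx
        by_cases hxl : IsLeafOf w par x
        · rcases hleafS x hx h1 h2 hxl with h3 | h3
          · exact Or.inl h3.2
          · exact absurd h3.1 hw₀
        · exact Or.inr (hone x c h1 hcρ h2 hcp hxl hcl)
    · have hw₀ := hw.resolve_left hwρ
      refine ⟨par w, hNS _ (hinner_par w hwρ), lam w, hlamS w hw₀,
        fun g => hinner_par w hwρ (g ▸ hlam_leaf w hw₀), h.adj_par hwρ,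
        (h.adj_iff _ _).2 (Or.inr (hlam w hw₀)), fun x hx hwx => ?_⟩
      rcases (h.adj_iff _ _).1 hwx with ⟨-, h1⟩ | ⟨h1, h2⟩
      · exact Or.inl h1.symm
      · exact Or.inr ((hleafS x hx h1 h2 (hw₀.2 x h1 h2)).resolve_left fun g => hwρ g.1).2
  have hleaf : LeafCondition T S := by
    intro v hv w hw hvw huniq
    by_cases hvl : IsLeafOf ρ par v
    · have hwv : par v = w :=
        ((h.adj_iff _ _).1 hvw).elim And.right fun g => absurd g.2 (hvl.2 w g.1)
      have hw' : w = ρ ∨ IsLastInner ρ par w := by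
        rcases (memS v).1 hv with rfl | hv | ⟨u, hu, rfl⟩
        · exact Or.inl (hwv.symm.trans hep)
        · exact absurd hvl hv
        · exact Or.inr (hwv ▸ (hlam u hu).2.symm ▸ hu)
      obtain ⟨a, ha, b, hb, hab, hwa, hwb, hall⟩ := hdeg w hw'
      rcases hall v hv hvw.symm with rfl | rfl
      · exact ⟨b, hb, hab.symm, hwb, hall⟩
      · exact ⟨a, ha, hab, hwa, fun x hx hwx => (hall x hx hwx).symm⟩
    · exfalso
      by_cases hv' : v = ρ ∨ IsLastInner ρ par v
      · obtain ⟨a, ha, b, hb, hab, hwa, hwb, -⟩ := hdeg v hv'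
        exact hab ((huniq a ha hwa).trans (huniq b hb hwb).symm)
      · push Not at hv'
        have : ∃ c, c ≠ ρ ∧ par c = v ∧ ¬ IsLeafOf ρ par c := by
          by_contra hcon
          push Not at hcon
          exact hv'.2 ⟨hvl, hcon⟩
        obtain ⟨c, hcρ, hcp, hcl⟩ := this
        have e1 := huniq c (hNS c hcl) ((h.adj_iff _ _).2 (Or.inr ⟨hcρ, hcp⟩))
        have e2 := huniq (par v) (hNS _ (hinner_par v hv'.1)) (h.adj_par hv'.1)
        have d1 := h.dep_lt c hcρ
        have d2 := h.dep_lt v hv'.1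
        rw [hcp, e1, ← e2] at d1
        omega
  have hconn : ((⊤ : T.Subgraph).induce (S : Set V)).coe.Connected := by
    have key : ∀ n v (hv : v ∈ S), dep v = n →
        ((⊤ : T.Subgraph).induce (S : Set V)).coe.Reachable ⟨v, hv⟩ ⟨ρ, hNS ρ hρleaf⟩ := by
      intro n
      induction n using Nat.strong_induction_on with
      | _ n ih =>
        intro v hv hvn
        by_cases hvρ : v = ρ
        · subst hvρ; exact SimpleGraph.Reachable.refl _
        · have hp := hNS _ (hinner_par v hvρ)
          refine SimpleGraph.Reachable.trans (SimpleGraph.Adj.reachable ?_)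
            (ih _ (hvn ▸ h.dep_lt v hvρ) (par v) hp rfl)
          simp [SimpleGraph.Subgraph.coe_adj, hv, hp, h.adj_par hvρ]
    exact { preconnected := fun u v => (key _ u.1 u.2 rfl).trans (key _ v.1 v.2 rfl).symm,
            nonempty := ⟨⟨ρ, hNS ρ hρleaf⟩⟩ }
  refine ⟨_, isSkeleton_induce hT.isAcyclic hconn hleaf, ?_⟩
  rw [SimpleGraph.Subgraph.induce_verts, Set.ncard_coe_finset, hcard]

end Skeleton

/-! ### Building a representation by a stack traversal -/

section Traversal

open scoped Classical

variable {V : Type*} {T : SimpleGraph V}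

theorem overlap_Ico {a b c d : ℕ} (hab : a < b) (hcd : c < d) :
    Overlap (Finset.Ico a b) (Finset.Ico c d) ↔
      (a < c ∧ c < b ∧ b < d) ∨ (c < a ∧ a < d ∧ d < b) := by
  unfold Overlap
  rw [Finset.Ico_subset_Ico_iff hab, Finset.Ico_subset_Ico_iff hcd, Finset.Ico_inter_Ico,
    Finset.nonempty_Ico]
  simp only [sup_lt_iff, lt_inf_iff]
  omega

theorem overlap_comm {A B : Finset ℕ} : Overlap A B ↔ Overlap B A := by
  unfold Overlap
  rw [Finset.inter_comm]
  tauto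

/-- The state of a traversal of the rooted tree: `D` is the set of vertices visited so far, `stk` is
the stack of pending vertices, a vertex `v ∈ D` has received the interval `[lo v, hi v)`, the left
ends of pending vertices are known, and the points below `cnt` have been used. The fields `sep` and
`rep` say that the intervals chosen so far are correct, whatever right ends beyond `cnt` the pending
vertices will get. By `hi_par` and `top`, a pending leaf either still has a point beyond the
interval of its parent at its disposal, or will be visited only after an inner vertex that uses one.
-/
structure Traversal (T : SimpleGraph V) (ρ : V) (par : V → V) (D : Finset V) (stk : List V)
    (lo hi : V → ℕ) (cnt : ℕ) : Prop where
  nodup : stk.Nodup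
  disj : ∀ s ∈ stk, s ∉ D
  par_visited : ∀ v ∈ D, v ≠ ρ → par v ∈ D
  par_pending : ∀ s ∈ stk, s ≠ ρ → par s ∈ D
  child : ∀ v ∈ D, ∀ c, c ≠ ρ → par c = v → c ∈ D ∨ c ∈ stk
  root : ρ ∈ D ∨ ρ ∈ stk
  sorted : stk.Pairwise fun a b => lo b ≤ lo a
  lo_lt : ∀ s ∈ stk, lo s < cnt
  lo_lt_hi : ∀ w ∈ D, lo w < hi w
  hi_le : ∀ w ∈ D, hi w ≤ cnt
  sep : ∀ w ∈ D, ∀ s ∈ stk, (lo w < lo s ∧ lo s < hi w) ↔ (s ≠ ρ ∧ par s = w)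
  rep : ∀ u ∈ D, ∀ w ∈ D, T.Adj u w ↔
    Overlap (Finset.Ico (lo u) (hi u)) (Finset.Ico (lo w) (hi w))
  hi_par : ∀ s ∈ stk, s ≠ ρ → hi (par s) = lo s + 1
  top : (∀ s ∈ stk, lo s + 2 ≤ cnt) ∨ ∃ t rest, stk = t :: rest ∧ ¬ IsLeafOf ρ par t
  count : cnt = 1 + (D.filter fun v => ¬ IsLeafOf ρ par v).card +
    (D.filter fun v => IsLastInner ρ par v).card

namespace Traversal

variable {ρ : V} {par : V → V} {dep : V → ℕ} {D : Finset V} {stk : List V} {lo hi : V → ℕ}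
  {cnt : ℕ}

theorem start (hlo : lo ρ = 0) : Traversal T ρ par ∅ [ρ] lo hi 1 := by
  constructor <;> simp [hlo]
  exact fun h => h.1 rfl

/-- The only visited neighbor of the top of the stack is its parent. -/
theorem adj_top_iff {v : V} (h : Traversal T ρ par D (v :: stk) lo hi cnt)
    (hr : IsRooted T ρ par dep) {w : V} (hw : w ∈ D) :
    T.Adj w v ↔ (lo w < lo v ∧ lo v < hi w) := by
  rw [h.sep w hw v (by simp), hr.adj_iff]
  constructor
  · rintro (⟨h1, h2⟩ | h1)
    · exact absurd (h2 ▸ h.par_visited w hw h1) (h.disj v (by simp))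
    · exact h1
  · exact Or.inr

/-- Closing the interval of the top of the stack, so that it overlaps the intervals of its visited
neighbors only, does not disturb the correctness of the intervals. -/
theorem rep_insert {v : V} (h : Traversal T ρ par D (v :: stk) lo hi cnt)
    (hr : IsRooted T ρ par dep) {hi' : V → ℕ} (hhi : ∀ w, w ≠ v → hi' w = hi w)
    (hv : cnt ≤ hi' v) (hlt : ∀ w ∈ D, T.Adj w v → hi w < hi' v) :
    ∀ u ∈ insert v D, ∀ w ∈ insert v D, T.Adj u w ↔
      Overlap (Finset.Ico (lo u) (hi' u)) (Finset.Ico (lo w) (hi' w)) := by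
  have hvD : v ∉ D := h.disj v (by simp)
  have hne : ∀ w ∈ D, w ≠ v := fun w hw g => hvD (g ▸ hw)
  have key : ∀ w ∈ D, T.Adj w v ↔
      Overlap (Finset.Ico (lo w) (hi' w)) (Finset.Ico (lo v) (hi' v)) := by
    intro w hw
    have h1 := h.lo_lt_hi w hw
    have h2 := h.hi_le w hw
    have h3 := h.lo_lt v (by simp)
    rw [hhi w (hne w hw), overlap_Ico h1 (by omega)]
    constructor
    · intro hwv
      have h4 := hlt w hw hwv
      have h5 := (h.adj_top_iff hr hw).1 hwv
      omega
    · intro h4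
      rw [h.adj_top_iff hr hw]
      omega
  intro u hu w hw
  rcases Finset.mem_insert.1 hu with rfl | hu' <;> rcases Finset.mem_insert.1 hw with rfl | hw'
  · simp [Overlap]
  · rw [SimpleGraph.adj_comm, overlap_comm]
    exact key w hw'
  · exact key u hu'
  · rw [hhi u (hne u hu'), hhi w (hne w hw')]
    exact h.rep u hu' w hw'

/-- A leaf on top of the stack receives the interval `[lo v, cnt)`, which needs no new point and
ends after that of its parent. -/
theorem leaf_step {v : V} (h : Traversal T ρ par D (v :: stk) lo hi cnt)
    (hr : IsRooted T ρ par dep) (hv : IsLeafOf ρ par v) {hi' : V → ℕ} (hhi : hi' v = cnt)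
    (hhi' : ∀ w, w ≠ v → hi' w = hi w) : Traversal T ρ par (insert v D) stk lo hi' cnt := by
  have hvD : v ∉ D := h.disj v (by simp)
  have hne : ∀ w ∈ D, w ≠ v := fun w hw g => hvD (g ▸ hw)
  have hvs : v ∉ stk := (List.nodup_cons.1 h.nodup).1
  have htop : ∀ s ∈ v :: stk, lo s + 2 ≤ cnt := by
    rcases h.top with h' | ⟨t, rest, h1, h2⟩
    · exact h'
    · rw [(List.cons.inj h1).1] at hv
      exact absurd hv h2
  have hmem : ∀ s ∈ stk, s ∈ v :: stk := fun s hs => List.mem_cons_of_mem _ hs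
  refine ⟨(List.nodup_cons.1 h.nodup).2, ?_, ?_, ?_, ?_, ?_, (List.pairwise_cons.1 h.sorted).2,
    fun s hs => h.lo_lt s (hmem s hs), ?_, ?_, ?_, ?_, ?_,
    Or.inl fun s hs => htop s (hmem s hs), ?_⟩
  · intro s hs
    rw [Finset.mem_insert, not_or]
    exact ⟨fun g => hvs (g ▸ hs), h.disj s (hmem s hs)⟩
  · intro w hw hwρ
    rcases Finset.mem_insert.1 hw with rfl | hw
    · exact Finset.mem_insert_of_mem (h.par_pending w (by simp) hwρ)
    · exact Finset.mem_insert_of_mem (h.par_visited w hw hwρ)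
  · exact fun s hs hsρ => Finset.mem_insert_of_mem (h.par_pending s (hmem s hs) hsρ)
  · intro w hw c hcρ hcw
    rcases Finset.mem_insert.1 hw with rfl | hw
    · exact absurd hcw (hv.2 c hcρ)
    · rcases h.child w hw c hcρ hcw with h' | h'
      · exact Or.inl (Finset.mem_insert_of_mem h')
      · rcases List.mem_cons.1 h' with rfl | h'
        · exact Or.inl (Finset.mem_insert_self _ _)
        · exact Or.inr h'
  · rcases h.root with h' | h'
    · exact Or.inl (Finset.mem_insert_of_mem h')
    · rcases List.mem_cons.1 h' with h' | h'
      · exact absurd h'.symm hv.1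
      · exact Or.inr h'
  · intro w hw
    rcases Finset.mem_insert.1 hw with rfl | hw
    · rw [hhi]; exact h.lo_lt w (by simp)
    · rw [hhi' w (hne w hw)]; exact h.lo_lt_hi w hw
  · intro w hw
    rcases Finset.mem_insert.1 hw with rfl | hw
    · exact hhi.le
    · rw [hhi' w (hne w hw)]; exact h.hi_le w hw
  · intro w hw s hs
    rcases Finset.mem_insert.1 hw with rfl | hw
    · refine iff_of_false (fun g => ?_) fun g => hv.2 s g.1 g.2
      have := (List.pairwise_cons.1 h.sorted).1 s hs
      omega
    · rw [hhi' w (hne w hw)]; exact h.sep w hw s (hmem s hs)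
  · refine h.rep_insert hr hhi' hhi.ge fun w hw hwv => ?_
    have h1 := (h.sep w hw v (by simp)).1 ((h.adj_top_iff hr hw).1 hwv)
    have h2 := h.hi_par v (by simp) h1.1
    have h3 := htop v (by simp)
    rw [h1.2] at h2
    omega
  · intro s hs hsρ
    rw [hhi' _ (hne _ (h.par_pending s (hmem s hs) hsρ))]
    exact h.hi_par s (hmem s hs) hsρ
  · rw [Finset.filter_insert, Finset.filter_insert, if_neg (not_not.2 hv), if_neg fun g => g.1 hv]
    exact h.count

/-- An inner vertex `v` on top of the stack receives the interval `[lo v, cnt + 1)`, and the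
intervals of its children `ch` begin at `cnt`. A point is left out if all children are leaves,
because their intervals have to extend beyond that of `v`; otherwise the inner child on top of the
stack uses such a point. -/
theorem inner_step {v : V} (h : Traversal T ρ par D (v :: stk) lo hi cnt)
    (hr : IsRooted T ρ par dep) (hv : ¬ IsLeafOf ρ par v) {ch : List V} (hch : ch.Nodup)
    (hmem_ch : ∀ c, c ∈ ch ↔ c ≠ ρ ∧ par c = v)
    (hhead : ¬ IsLastInner ρ par v → ∃ t rest, ch = t :: rest ∧ ¬ IsLeafOf ρ par t)
    {lo' hi' : V → ℕ} {cnt' : ℕ} (hlo : ∀ c ∈ ch, lo' c = cnt) (hlo' : ∀ w, w ∉ ch → lo' w = lo w)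
    (hhi : hi' v = cnt + 1) (hhi' : ∀ w, w ≠ v → hi' w = hi w)
    (hcnt : cnt' = if IsLastInner ρ par v then cnt + 2 else cnt + 1) :
    Traversal T ρ par (insert v D) (ch ++ stk) lo' hi' cnt' := by
  have hvD : v ∉ D := h.disj v (by simp)
  have hne : ∀ w ∈ D, w ≠ v := fun w hw g => hvD (g ▸ hw)
  have hvs : v ∉ stk := (List.nodup_cons.1 h.nodup).1
  have hmem : ∀ s ∈ stk, s ∈ v :: stk := fun s hs => List.mem_cons_of_mem _ hs
  have hcnt1 : cnt + 1 ≤ cnt' := by rw [hcnt]; split_ifs <;> omega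
  have chD : ∀ c ∈ ch, c ∉ D := fun c hc hcD =>
    hvD (((hmem_ch c).1 hc).2 ▸ h.par_visited c hcD ((hmem_ch c).1 hc).1)
  have chs : ∀ c ∈ ch, c ∉ v :: stk := fun c hc hcs =>
    hvD (((hmem_ch c).1 hc).2 ▸ h.par_pending c hcs ((hmem_ch c).1 hc).1)
  have lov : lo' v = lo v := hlo' v fun g => chs v g (by simp)
  have los : ∀ s ∈ stk, lo' s = lo s := fun s hs => hlo' s fun g => chs s g (hmem s hs)
  have loD : ∀ w ∈ D, lo' w = lo w := fun w hw => hlo' w fun g => chD w g hw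
  have lt_v := h.lo_lt v (by simp)
  refine ⟨?_, ?_, ?_, ?_, ?_, ?_, ?_, ?_, ?_, ?_, ?_, ?_, ?_, ?_, ?_⟩
  · exact List.nodup_append.2 ⟨hch, (List.nodup_cons.1 h.nodup).2, fun a ha b hb g =>
      chs a ha (g ▸ hmem b hb)⟩
  · intro s hs
    rw [Finset.mem_insert, not_or]
    rcases List.mem_append.1 hs with hs | hs
    · exact ⟨fun g => chs s hs (g ▸ by simp), chD s hs⟩
    · exact ⟨fun g => hvs (g ▸ hs), h.disj s (hmem s hs)⟩
  · intro w hw hwρ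
    rcases Finset.mem_insert.1 hw with rfl | hw
    · exact Finset.mem_insert_of_mem (h.par_pending w (by simp) hwρ)
    · exact Finset.mem_insert_of_mem (h.par_visited w hw hwρ)
  · intro s hs hsρ
    rcases List.mem_append.1 hs with hs | hs
    · rw [((hmem_ch s).1 hs).2]; exact Finset.mem_insert_self _ _
    · exact Finset.mem_insert_of_mem (h.par_pending s (hmem s hs) hsρ)
  · intro w hw c hcρ hcw
    rw [Finset.mem_insert, List.mem_append]
    rcases Finset.mem_insert.1 hw with rfl | hw
    · exact Or.inr (Or.inl ((hmem_ch c).2 ⟨hcρ, hcw⟩))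
    · rcases h.child w hw c hcρ hcw with h' | h'
      · exact Or.inl (Or.inr h')
      · exact (List.mem_cons.1 h').imp Or.inl Or.inr
  · rw [Finset.mem_insert, List.mem_append]
    rcases h.root with h' | h'
    · exact Or.inl (Or.inr h')
    · exact (List.mem_cons.1 h').imp Or.inl Or.inr
  · rw [List.pairwise_append]
    refine ⟨?_, ?_, ?_⟩
    · exact List.pairwise_of_forall_mem_list fun a ha b hb => by rw [hlo a ha, hlo b hb]
    · refine (List.pairwise_cons.1 h.sorted).2.imp_of_mem fun ha hb hab => ?_
      rw [los _ ha, los _ hb]; exact hab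
    · intro a ha b hb
      rw [hlo a ha, los b hb]
      exact (h.lo_lt b (hmem b hb)).le
  · intro s hs
    rcases List.mem_append.1 hs with hs | hs
    · rw [hlo s hs]; omega
    · rw [los s hs]
      have := h.lo_lt s (hmem s hs)
      omega
  · intro w hw
    rcases Finset.mem_insert.1 hw with rfl | hw
    · rw [hhi, lov]; omega
    · rw [hhi' w (hne w hw), loD w hw]; exact h.lo_lt_hi w hw
  · intro w hw
    rcases Finset.mem_insert.1 hw with rfl | hw
    · rw [hhi]; exact hcnt1
    · rw [hhi' w (hne w hw)]
      have := h.hi_le w hw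
      omega
  · intro w hw s hs
    rcases Finset.mem_insert.1 hw with rfl | hw <;> rcases List.mem_append.1 hs with hs | hs
    · rw [hhi, lov, hlo s hs]
      exact iff_of_true (by omega) ((hmem_ch s).1 hs)
    · rw [lov, los s hs]
      refine iff_of_false (fun g => ?_) fun g => hvD (g.2 ▸ h.par_pending s (hmem s hs) g.1)
      have := (List.pairwise_cons.1 h.sorted).1 s hs
      omega
    · rw [hhi' w (hne w hw), hlo s hs, loD w hw]
      refine iff_of_false (fun g => ?_) fun g => hne w hw (g.2.symm.trans ((hmem_ch s).1 hs).2)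
      have := h.hi_le w hw
      omega
    · rw [hhi' w (hne w hw), loD w hw, los s hs]; exact h.sep w hw s (hmem s hs)
  · intro u hu w hw
    have hlo'' : ∀ x ∈ insert v D, lo' x = lo x := by
      intro x hx
      rcases Finset.mem_insert.1 hx with rfl | hx
      exacts [lov, loD x hx]
    rw [hlo'' u hu, hlo'' w hw]
    refine h.rep_insert hr hhi' (by omega) (fun x hx _ => ?_) u hu w hw
    have := h.hi_le x hx
    omega
  · intro s hs hsρ
    rcases List.mem_append.1 hs with hs | hs
    · rw [((hmem_ch s).1 hs).2, hhi, hlo s hs]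
    · rw [hhi' _ (hne _ (h.par_pending s (hmem s hs) hsρ)), los s hs]
      exact h.hi_par s (hmem s hs) hsρ
  · by_cases hl : IsLastInner ρ par v
    · left
      rw [if_pos hl] at hcnt
      intro s hs
      rcases List.mem_append.1 hs with hs | hs
      · rw [hlo s hs]; omega
      · rw [los s hs]
        have := h.lo_lt s (hmem s hs)
        omega
    · obtain ⟨t, rest, h1, h2⟩ := hhead hl
      exact Or.inr ⟨t, rest ++ stk, by rw [h1, List.cons_append], h2⟩
  · rw [Finset.filter_insert, Finset.filter_insert, if_pos hv,
      Finset.card_insert_of_notMem (by simp [hvD])]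
    have := h.count
    by_cases hl : IsLastInner ρ par v
    · rw [if_pos hl, Finset.card_insert_of_notMem (by simp [hvD])]
      rw [if_pos hl] at hcnt
      omega
    · rw [if_neg hl]
      rw [if_neg hl] at hcnt
      omega

theorem visited_eq_univ [Fintype V] (h : Traversal T ρ par D [] lo hi cnt)
    (hr : IsRooted T ρ par dep) : D = Finset.univ := by
  have key : ∀ n v, dep v = n → v ∈ D := by
    intro n
    induction n using Nat.strong_induction_on with
    | _ n ih =>
      intro v hv
      by_cases hvρ : v = ρ
      · exact hvρ ▸ h.root.resolve_right (by simp)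
      · exact (h.child _ (ih _ (hv ▸ hr.dep_lt v hvρ) _ rfl) v hvρ rfl).resolve_right (by simp)
  exact Finset.eq_univ_iff_forall.2 fun v => key _ v rfl

theorem isOverlapRep [Fintype V] (h : Traversal T ρ par D [] lo hi cnt)
    (hr : IsRooted T ρ par dep) : IsOverlapRep T fun v => Finset.Ico (lo v) (hi v) := by
  have hD := h.visited_eq_univ hr
  subst hD
  exact fun u w => h.rep u (Finset.mem_univ _) w (Finset.mem_univ _)

theorem size_le_weight [Fintype V] (h : Traversal T ρ par D [] lo hi cnt)
    (hr : IsRooted T ρ par dep) : size (fun v => Finset.Ico (lo v) (hi v)) ≤ weight ρ par := by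
  have hD := h.visited_eq_univ hr
  subst hD
  have : cnt = weight ρ par := h.count
  rw [← this]
  unfold size
  calc _ ≤ (Finset.range cnt).card := Finset.card_le_card ?_
    _ = cnt := Finset.card_range _
  intro x hx
  simp only [Finset.mem_biUnion, Finset.mem_Ico, Finset.mem_univ, true_and] at hx
  obtain ⟨v, hv⟩ := hx
  have := h.hi_le v (Finset.mem_univ _)
  rw [Finset.mem_range]
  omega

/-- Every traversal can be completed. -/
theorem exists_final [Fintype V] (hr : IsRooted T ρ par dep) :
    ∀ (n : ℕ) (D : Finset V) (stk : List V) (lo hi : V → ℕ) (cnt : ℕ),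
      Fintype.card V - D.card ≤ n → Traversal T ρ par D stk lo hi cnt →
        ∃ D' lo' hi' cnt', Traversal T ρ par D' [] lo' hi' cnt' := by
  intro n
  induction n with
  | zero =>
    intro D stk lo hi cnt hn h
    have hD : D = Finset.univ := by
      rw [← Finset.card_eq_iff_eq_univ]
      have := D.card_le_univ
      omega
    subst hD
    cases stk with
    | nil => exact ⟨_, _, _, _, h⟩
    | cons v stk => exact absurd (Finset.mem_univ v) (h.disj v (by simp))
  | succ n ih =>
    intro D stk lo hi cnt hn h
    cases stk with
    | nil => exact ⟨_, _, _, _, h⟩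
    | cons v stk =>
      have hcard : Fintype.card V - (insert v D).card ≤ n := by
        rw [Finset.card_insert_of_notMem (h.disj v (by simp))]
        omega
      by_cases hv : IsLeafOf ρ par v
      · exact ih _ _ _ _ _ hcard (h.leaf_step hr hv (hi' := Function.update hi v cnt) (by simp)
          fun w hw => by simp [hw])
      · -- the children that are not leaves are put on top of the others
        let A := Finset.univ.filter fun c => (c ≠ ρ ∧ par c = v) ∧ ¬ IsLeafOf ρ par c
        let B := Finset.univ.filter fun c => (c ≠ ρ ∧ par c = v) ∧ IsLeafOf ρ par c
        have hA : ∀ c, c ∈ A.toList ↔ (c ≠ ρ ∧ par c = v) ∧ ¬ IsLeafOf ρ par c := by simp [A]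
        have hB : ∀ c, c ∈ B.toList ↔ (c ≠ ρ ∧ par c = v) ∧ IsLeafOf ρ par c := by simp [B]
        refine ih _ _ _ _ _ hcard (h.inner_step hr hv (ch := A.toList ++ B.toList)
          (lo' := fun w => if w ∈ A.toList ++ B.toList then cnt else lo w)
          (hi' := Function.update hi v (cnt + 1)) ?_ ?_ ?_ (fun c hc => if_pos hc)
          (fun c hc => if_neg hc) (by simp) (fun w hw => by simp [hw]) rfl)
        · refine List.nodup_append.2 ⟨A.nodup_toList, B.nodup_toList, ?_⟩
          rintro a ha b hb rfl
          exact ((hA a).1 ha).2 ((hB a).1 hb).2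
        · intro c
          rw [List.mem_append, hA, hB]
          tauto
        · intro hl
          have : ∃ c, c ∈ A.toList := by
            by_contra hcon
            push Not at hcon
            refine hl ⟨hv, fun c hc hcv => by_contra fun g => hcon c ((hA c).2 ⟨⟨hc, hcv⟩, g⟩)⟩
          obtain ⟨c, hc⟩ := this
          cases hA' : A.toList with
          | nil => rw [hA'] at hc; simp at hc
          | cons t rest =>
            exact ⟨t, rest ++ B.toList, rfl, ((hA t).1 (by rw [hA']; simp)).2⟩

end Traversal

theorem exists_rep_size_le_weight [Fintype V] {ρ : V} {par : V → V} {dep : V → ℕ}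
    (hr : IsRooted T ρ par dep) : ∃ f, IsOverlapRep T f ∧ size f ≤ weight ρ par := by
  obtain ⟨D, lo, hi, cnt, h⟩ := Traversal.exists_final hr _ ∅ [ρ] (fun _ => 0) (fun _ => 0) 1
    le_rfl (Traversal.start rfl)
  exact ⟨_, h.isOverlapRep hr, h.size_le_weight hr⟩

end Traversal

/-! ### The overlap number of a tree -/

section OverlapNumber

open scoped Classical

variable {V : Type*} {T : SimpleGraph V}

/-- A vertex with at least two neighbors. -/
def IsInner (T : SimpleGraph V) (v : V) : Prop :=
  ∃ a b, a ≠ b ∧ T.Adj v a ∧ T.Adj v b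

/-- A vertex with at least two neighbors, at most one of which has at least two neighbors. -/
def IsGoodRoot (T : SimpleGraph V) (ρ : V) : Prop :=
  IsInner T ρ ∧ ∀ a b, T.Adj ρ a → T.Adj ρ b → IsInner T a → IsInner T b → a = b

/-- The inner vertices span a tree, one of whose vertices has at most one neighbor in this tree. -/
theorem exists_isGoodRoot [Fintype V] (hT : T.IsTree) (h3 : 3 ≤ Fintype.card V) :
    ∃ ρ, IsGoodRoot T ρ := by
  obtain ⟨r⟩ := hT.connected.nonempty
  obtain ⟨par, dep, hr⟩ := exists_isRooted hT r
  have hconn := conn_univ hT.connected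
  have hne : (Finset.univ.filter fun v => IsInner T v).Nonempty := by
    by_contra hcon
    have hno : ∀ v, ¬ IsInner T v := fun v hv => hcon ⟨v, by simp [hv]⟩
    have huniq : ∀ v a b, T.Adj v a → T.Adj v b → a = b := fun v a b ha hb =>
      by_contra fun hab => hno v ⟨a, b, hab, ha, hb⟩
    obtain ⟨s, hs⟩ : ∃ s, T.Adj r s := by
      by_contra hcon
      push Not at hcon
      have := hconn {r} (Finset.subset_univ _) (by simp) (by
        intro a ha b _ hab
        rw [Finset.mem_singleton] at ha
        exact absurd hab (ha ▸ hcon b))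
      have := congrArg Finset.card this
      rw [Finset.card_univ, Finset.card_singleton] at this
      omega
    have := hconn {r, s} (Finset.subset_univ _) (by simp) (by
      intro a ha b _ hab
      simp only [Finset.mem_insert, Finset.mem_singleton] at ha ⊢
      rcases ha with rfl | rfl
      · exact Or.inr (huniq _ _ _ hab hs)
      · exact Or.inl (huniq _ _ _ hab hs.symm))
    have := congrArg Finset.card this
    rw [Finset.card_univ] at this
    have h2 : ({r, s} : Finset V).card ≤ 2 := Finset.card_le_two
    omega
  obtain ⟨ρ, hρ, huniq⟩ := hr.exists_unique_neighbor _ hne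
  refine ⟨ρ, by simpa using hρ, fun a b ha hb hia hib => ?_⟩
  exact huniq a (by simpa using hia) b (by simpa using hib) ha hb

theorem isInner_of_not_isLeafOf {ρ : V} {par : V → V} {dep : V → ℕ}
    (hr : IsRooted T ρ par dep) {v : V} (hvρ : v ≠ ρ) (hv : ¬ IsLeafOf ρ par v) : IsInner T v := by
  have : ∃ c, c ≠ ρ ∧ par c = v := by
    by_contra hcon
    push Not at hcon
    exact hv ⟨hvρ, hcon⟩
  obtain ⟨c, hc, hcv⟩ := this
  refine ⟨c, par v, ?_, (hr.adj_iff _ _).2 (Or.inr ⟨hc, hcv⟩), hr.adj_par hvρ⟩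
  rintro rfl
  have h1 := hr.dep_lt _ hc
  have h2 := hr.dep_lt _ hvρ
  rw [hcv] at h1
  omega

theorem IsGoodRoot.exists_skeleton [Fintype V] (hT : T.IsTree) {ρ : V} (hρ : IsGoodRoot T ρ)
    {par : V → V} {dep : V → ℕ} (hr : IsRooted T ρ par dep) :
    ∃ S : T.Subgraph, IsSkeleton S.coe ∧ S.verts.ncard = weight ρ par := by
  have hnbr : ∀ x, T.Adj ρ x → x ≠ ρ ∧ par x = ρ := fun x hx =>
    ((hr.adj_iff _ _).1 hx).resolve_left fun g => g.1 rfl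
  have hnbr' : ∀ x, x ≠ ρ → par x = ρ → T.Adj ρ x := fun x h1 h2 =>
    (hr.adj_iff _ _).2 (Or.inr ⟨h1, h2⟩)
  refine exists_skeleton_of_weight hT hr ?_ ?_
  · obtain ⟨a, b, hab, ha, hb⟩ := hρ.1
    exact ⟨a, b, hab, (hnbr a ha).1, (hnbr b hb).1, (hnbr a ha).2, (hnbr b hb).2⟩
  · intro a b ha hb ha' hb' hla hlb
    exact hρ.2 a b (hnbr' a ha ha') (hnbr' b hb hb') (isInner_of_not_isLeafOf hr ha hla)
      (isInner_of_not_isLeafOf hr hb hlb)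

theorem three_le_weight [Fintype V] {ρ : V} {par : V → V} {dep : V → ℕ}
    (hr : IsRooted T ρ par dep) : 3 ≤ weight ρ par := by
  have hρ : ¬ IsLeafOf ρ par ρ := fun h => h.1 rfl
  have h1 : (Finset.univ.filter fun v => ¬ IsLeafOf ρ par v).Nonempty := ⟨ρ, by simp [hρ]⟩
  -- a deepest inner vertex has only leaves as children
  obtain ⟨v, hv, hmax⟩ := Finset.exists_max_image _ dep h1
  have h2 : (Finset.univ.filter fun v => IsLastInner ρ par v).Nonempty := by
    refine ⟨v, ?_⟩
    simp only [Finset.mem_filter, Finset.mem_univ, true_and] at hv hmax ⊢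
    refine ⟨hv, fun c hc hcv => by_contra fun hl => ?_⟩
    have h3 := hmax c hl
    have h4 := hr.dep_lt c hc
    rw [hcv] at h4
    omega
  have h3 := Finset.card_pos.2 h1
  have h4 := Finset.card_pos.2 h2
  unfold weight
  omega

theorem three_le_size_of_adj [Fintype V] {u v : V} (huv : T.Adj u v) {f : V → Finset ℕ}
    (hf : IsOverlapRep T f) : 3 ≤ size f := by
  obtain ⟨⟨x, hx⟩, h1, h2⟩ := (hf u v).1 huv
  rw [Finset.not_subset] at h1 h2
  obtain ⟨y, hy, hy'⟩ := h1
  obtain ⟨z, hz, hz'⟩ := h2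
  rw [Finset.mem_inter] at hx
  have hxy : x ≠ y := by rintro rfl; exact hy' hx.2
  have hxz : x ≠ z := by rintro rfl; exact hz' hx.1
  have hyz : y ≠ z := by rintro rfl; exact hy' hz
  have hcard : ({x, y, z} : Finset ℕ).card = 3 := by
    rw [Finset.card_insert_of_notMem (by simp [hxy, hxz]),
      Finset.card_insert_of_notMem (by simp [hyz]), Finset.card_singleton]
  rw [← hcard]
  refine Finset.card_le_card fun w hw => ?_
  simp only [Finset.mem_insert, Finset.mem_singleton] at hw
  rw [Finset.mem_biUnion]
  rcases hw with rfl | rfl | rfl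
  exacts [⟨u, Finset.mem_univ _, hx.1⟩, ⟨u, Finset.mem_univ _, hy⟩, ⟨v, Finset.mem_univ _, hz⟩]

theorem weight_le_three [Fintype V] {ρ : V} {par : V → V} {dep : V → ℕ}
    (hr : IsRooted T ρ par dep) (h2 : Fintype.card V = 2) : weight ρ par ≤ 3 := by
  have key : ∀ v, ¬ IsLeafOf ρ par v → v = ρ := by
    intro v hv
    by_contra hvρ
    have : ∃ c, c ≠ ρ ∧ par c = v := by
      by_contra hcon
      push Not at hcon
      exact hv ⟨hvρ, hcon⟩
    obtain ⟨c, hc, hcv⟩ := this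
    have hcv' : c ≠ v := fun g => hr.par_ne hc (hcv.trans g.symm)
    have : ({ρ, v, c} : Finset V).card = 3 := by
      rw [Finset.card_insert_of_notMem (by simp [Ne.symm hvρ, hc.symm]),
        Finset.card_insert_of_notMem (by simp [hcv'.symm]), Finset.card_singleton]
    have := Finset.card_le_univ ({ρ, v, c} : Finset V)
    omega
  have b1 : (Finset.univ.filter fun v => ¬ IsLeafOf ρ par v).card ≤ 1 :=
    Finset.card_le_one.2 fun u hu v hv =>
      (key u (Finset.mem_filter.1 hu).2).trans (key v (Finset.mem_filter.1 hv).2).symm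
  have b2 : (Finset.univ.filter fun v => IsLastInner ρ par v).card ≤ 1 :=
    Finset.card_le_one.2 fun u hu v hv =>
      (key u (Finset.mem_filter.1 hu).2.1).trans (key v (Finset.mem_filter.1 hv).2.1).symm
  unfold weight
  omega

/-- From a good root, the traversal is optimal: a skeleton with `weight ρ par` vertices needs that
many points. The tree with two vertices has no good root, but every edge needs three points. -/
theorem weight_le_size [Fintype V] (hT : T.IsTree) (h2 : 2 ≤ Fintype.card V) {ρ : V}
    {par : V → V} {dep : V → ℕ} (hr : IsRooted T ρ par dep)
    (hρ : 3 ≤ Fintype.card V → IsGoodRoot T ρ) {f : V → Finset ℕ} (hf : IsOverlapRep T f) :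
    weight ρ par ≤ size f := by
  by_cases h3 : 3 ≤ Fintype.card V
  · obtain ⟨S, hS, hcard⟩ := (hρ h3).exists_skeleton hT hr
    rw [← hcard]
    exact ncard_verts_le_size hT S hS (hcard ▸ three_le_weight hr) f hf
  · refine (weight_le_three hr (by omega)).trans ?_
    have : Nontrivial V := Fintype.one_lt_card_iff_nontrivial.1 (by omega)
    obtain ⟨v, hv⟩ := exists_ne ρ
    exact three_le_size_of_adj (hr.adj_par hv) hf

theorem size_eq_overlapNumber [Fintype V] {k : ℕ} (hk : ∀ g, IsOverlapRep T g → k ≤ size g)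
    {f : V → Finset ℕ} (hf : IsOverlapRep T f) (hfk : size f ≤ k) : size f = overlapNumber T := by
  refine le_antisymm (hfk.trans (le_csInf ⟨_, f, hf, rfl⟩ ?_)) (Nat.sInf_le ⟨f, hf, rfl⟩)
  rintro b ⟨g, hg, rfl⟩
  exact hk g hg

theorem exists_isLargestSkeleton [Fintype V] (hT : T.IsTree) :
    ∃ S : T.Subgraph, IsLargestSkeleton T S := by
  obtain ⟨v⟩ := hT.connected.nonempty
  have hne : {k : ℕ | ∃ S : T.Subgraph, IsSkeleton S.coe ∧ S.verts.ncard = k}.Nonempty := by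
    refine ⟨_, T.singletonSubgraph v, ⟨SimpleGraph.IsTree.coe_singletonSubgraph T v, ?_⟩, rfl⟩
    rintro ⟨a, ha⟩ ⟨b, hb⟩ - hab
    simp at hab
  have hbdd : BddAbove {k : ℕ | ∃ S : T.Subgraph, IsSkeleton S.coe ∧ S.verts.ncard = k} := by
    refine ⟨Fintype.card V, ?_⟩
    rintro _ ⟨S, -, rfl⟩
    rw [← Nat.card_eq_fintype_card]
    exact Set.ncard_le_card _
  obtain ⟨S, hS, hcard⟩ := Nat.sSup_mem hne hbdd
  exact ⟨S, hS, fun S' hS' => hcard ▸ le_csSup hbdd ⟨S', hS', rfl⟩⟩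

theorem overlapNumber_eq_ncard [Fintype V] (hT : T.IsTree) (h3 : 3 ≤ Fintype.card V)
    {S : T.Subgraph} (hS : IsLargestSkeleton T S) : overlapNumber T = S.verts.ncard := by
  obtain ⟨ρ, hρ⟩ := exists_isGoodRoot hT h3
  obtain ⟨par, dep, hr⟩ := exists_isRooted hT ρ
  obtain ⟨S', hS', hcard⟩ := hρ.exists_skeleton hT hr
  have hle : weight ρ par ≤ S.verts.ncard := hcard ▸ hS.2 S' hS'
  have hlow := ncard_verts_le_size hT S hS.1 ((three_le_weight hr).trans hle)
  obtain ⟨f, hf, hfw⟩ := exists_rep_size_le_weight hr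
  have hsize := size_eq_overlapNumber hlow hf (hfw.trans hle)
  exact hsize ▸ le_antisymm (hfw.trans hle) (hlow f hf)

end OverlapNumber

/-! ### Running programs -/

section Programs

open scoped Classical

theorem setReg_reg (σ : State) (x c y : ℕ) :
    (σ.setReg x c).reg y = if y = x then c else σ.reg y := by
  simp [State.setReg, Function.update_apply]

theorem setReg_arr (σ : State) (x c : ℕ) : (σ.setReg x c).arr = σ.arr := rfl

theorem setArr_reg (σ : State) (a i c : ℕ) : (σ.setArr a i c).reg = σ.reg := rfl

theorem setArr_arr (σ : State) (a i c b : ℕ) :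
    (σ.setArr a i c).arr b = if b = a then Function.update (σ.arr a) i c else σ.arr b := by
  simp only [State.setArr, Function.update_apply]

/-- A program without loops. -/
def Prog.LoopFree : Prog → Prop
  | .skip => True
  | .assign _ _ => True
  | .store _ _ _ => True
  | .seq p q => p.LoopFree ∧ q.LoopFree
  | .ite _ p q => p.LoopFree ∧ q.LoopFree
  | .while _ _ => False

/-- The final state of a loop-free program (loops are ignored). -/
noncomputable def Prog.effect : Prog → State → State
  | .skip, σ => σ
  | .assign x e, σ => σ.setReg x (e.eval σ)
  | .store a i e, σ => σ.setArr a (i.eval σ) (e.eval σ)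
  | .seq p q, σ => q.effect (p.effect σ)
  | .ite b p q, σ => if b.Holds σ then p.effect σ else q.effect σ
  | .while _ _, σ => σ

/-- An upper bound for the number of steps of a loop-free program. -/
def Prog.maxCost : Prog → ℕ
  | .skip => 1
  | .assign _ e => e.cost + 1
  | .store _ i e => i.cost + e.cost + 1
  | .seq p q => p.maxCost + q.maxCost
  | .ite b p q => b.cost + (p.maxCost + q.maxCost)
  | .while _ _ => 0

/-- Started in `σ`, the program `p` halts within `t` steps in a state that satisfies `Q`. -/
def Runs (p : Prog) (σ : State) (t : ℕ) (Q : State → Prop) : Prop :=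
  ∃ s τ, Exec p σ s τ ∧ s ≤ t ∧ Q τ

theorem Prog.LoopFree.exec {p : Prog} (hp : p.LoopFree) (σ : State) :
    ∃ s ≤ p.maxCost, Exec p σ s (p.effect σ) := by
  induction p generalizing σ with
  | skip => exact ⟨1, le_rfl, .skip σ⟩
  | assign x e => exact ⟨_, le_rfl, .assign x e σ⟩
  | store a i e => exact ⟨_, le_rfl, .store a i e σ⟩
  | seq p q ihp ihq =>
    obtain ⟨s, hs, h1⟩ := ihp hp.1 σ
    obtain ⟨t, ht, h2⟩ := ihq hp.2 (p.effect σ)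
    exact ⟨s + t, Nat.add_le_add hs ht, .seq h1 h2⟩
  | ite b p q ihp ihq =>
    by_cases hb : b.Holds σ
    · obtain ⟨s, hs, h1⟩ := ihp hp.1 σ
      exact ⟨b.cost + s, Nat.add_le_add_left (hs.trans (Nat.le_add_right _ _)) _,
        by simpa [Prog.effect, hb] using .ite_true hb h1⟩
    · obtain ⟨s, hs, h1⟩ := ihq hp.2 σ
      exact ⟨b.cost + s, Nat.add_le_add_left (hs.trans (Nat.le_add_left _ _)) _,
        by simpa [Prog.effect, hb] using .ite_false hb h1⟩
  | _ => exact hp.elim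

theorem Prog.LoopFree.runs {p : Prog} (hp : p.LoopFree) {σ : State} {Q : State → Prop}
    (hQ : Q (p.effect σ)) : Runs p σ p.maxCost Q := by
  obtain ⟨s, hs, h⟩ := hp.exec σ
  exact ⟨s, _, h, hs, hQ⟩

theorem Runs.mono {p : Prog} {σ : State} {s t : ℕ} {Q R : State → Prop} (h : Runs p σ s Q)
    (hst : s ≤ t) (hQR : ∀ τ, Q τ → R τ) : Runs p σ t R := by
  obtain ⟨s', τ, h1, h2, h3⟩ := h
  exact ⟨s', τ, h1, h2.trans hst, hQR τ h3⟩

theorem Runs.seq {p q : Prog} {σ : State} {s t : ℕ} {Q R : State → Prop} (h : Runs p σ s Q)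
    (h' : ∀ τ, Q τ → Runs q τ t R) : Runs (.seq p q) σ (s + t) R := by
  obtain ⟨s', τ, h1, h2, h3⟩ := h
  obtain ⟨t', υ, h4, h5, h6⟩ := h' τ h3
  exact ⟨s' + t', υ, .seq h1 h4, Nat.add_le_add h2 h5, h6⟩

theorem Runs.ite {b : Test} {p q : Prog} {σ : State} {t : ℕ} {Q : State → Prop}
    (hp : b.Holds σ → Runs p σ t Q) (hq : ¬ b.Holds σ → Runs q σ t Q) :
    Runs (.ite b p q) σ (b.cost + t) Q := by
  by_cases hb : b.Holds σ
  · obtain ⟨s, τ, h1, h2, h3⟩ := hp hb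
    exact ⟨_, τ, .ite_true hb h1, Nat.add_le_add_left h2 _, h3⟩
  · obtain ⟨s, τ, h1, h2, h3⟩ := hq hb
    exact ⟨_, τ, .ite_false hb h1, Nat.add_le_add_left h2 _, h3⟩

theorem Test.one_le_cost (b : Test) : 1 ≤ b.cost := by
  cases b <;> simp [Test.cost]

/-- The rule for loops: `I` is an invariant, indexed by auxiliary data, and `bound` bounds the
number of remaining steps. -/
theorem runs_while {ι : Type*} {b : Test} {p : Prog} (I : ι → State → Prop) (bound : ι → ℕ)
    {Q : State → Prop}
    (hstep : ∀ i σ, I i σ → b.Holds σ →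
      ∃ t, Runs p σ t fun τ => ∃ j, I j τ ∧ b.cost + t + bound j ≤ bound i)
    (hend : ∀ i σ, I i σ → ¬ b.Holds σ → Q σ ∧ b.cost ≤ bound i) {i : ι} {σ : State}
    (h : I i σ) : Runs (.while b p) σ (bound i) Q := by
  have key : ∀ k i σ, bound i = k → I i σ → Runs (.while b p) σ k Q := by
    intro k
    induction k using Nat.strong_induction_on with
    | _ k ih =>
      intro i σ hk h
      by_cases hb : b.Holds σ
      · obtain ⟨t, s, τ, h1, h2, j, h3, h4⟩ := hstep i σ h hb
        have := b.one_le_cost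
        obtain ⟨s', υ, h5, h6, h7⟩ := ih (bound j) (by omega) j τ rfl h3
        exact ⟨_, υ, .while_true hb h1 h5, by omega, h7⟩
      · obtain ⟨h1, h2⟩ := hend i σ h hb
        exact ⟨_, σ, .while_false hb, hk ▸ h2, h1⟩
  exact key _ i σ rfl h

/-- The rule for loops that are executed `N` times. -/
theorem runs_for {b : Test} {p : Prog} (I : ℕ → State → Prop) (N t : ℕ)
    (hstep : ∀ i σ, i < N → I i σ → b.Holds σ ∧ Runs p σ t (I (i + 1)))
    (hend : ∀ σ, I N σ → ¬ b.Holds σ) {σ : State} (h : I 0 σ) :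
    Runs (.while b p) σ (N * (b.cost + t) + b.cost) (I N) := by
  have := runs_while (b := b) (p := p) (Q := I N) (fun i σ => i ≤ N ∧ I i σ)
    (fun i => (N - i) * (b.cost + t) + b.cost) (by
      rintro i σ ⟨hi, h⟩ hb
      have hlt : i < N := lt_of_le_of_ne hi fun e => hend σ (e ▸ h) hb
      refine ⟨t, (hstep i σ hlt h).2.mono le_rfl fun τ hτ => ⟨i + 1, ⟨hlt, hτ⟩, ?_⟩⟩
      have : N - i = N - (i + 1) + 1 := by omega
      rw [this, Nat.add_mul]
      omega) (by
      rintro i σ ⟨hi, h⟩ hb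
      rcases hi.eq_or_lt with rfl | hlt
      · exact ⟨h, Nat.le_add_left _ _⟩
      · exact absurd (hstep i σ hlt h).1 hb) (i := 0) (σ := σ) ⟨Nat.zero_le _, h⟩
  simpa using this

/-! ### Adjacency lists -/

variable {n : ℕ}

/-- The pointer `e` is the head of a linked list with entries `l` among the cells `1, …, b`; the
pointer `0` is the empty list. -/
def LinkedTo (nxt tgt : ℕ → ℕ) (b : ℕ) : ℕ → List (Fin n) → Prop
  | e, [] => e = 0
  | e, w :: l => e ≠ 0 ∧ e ≤ b ∧ tgt e = w ∧ LinkedTo nxt tgt b (nxt e) l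

theorem LinkedTo.frame {nxt tgt nxt' tgt' : ℕ → ℕ} {b b' : ℕ} (hb : b ≤ b')
    (h1 : ∀ e, e ≤ b → nxt' e = nxt e) (h2 : ∀ e, e ≤ b → tgt' e = tgt e) :
    ∀ {l : List (Fin n)} {e : ℕ}, LinkedTo nxt tgt b e l → LinkedTo nxt' tgt' b' e l
  | [], _, h => h
  | w :: l, e, ⟨h3, h4, h5, h6⟩ => ⟨h3, h4.trans hb, (h2 e h4).trans h5, by
      rw [h1 e h4]; exact LinkedTo.frame hb h1 h2 h6⟩

/-- In the state `σ`, the vertex `u` is equipped with the list `L u`: array 7 holds the heads,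
arrays 8 and 9 the successors and the contents of the cells, register 3 the number of cells. -/
def Lists (σ : State) (L : Fin n → List (Fin n)) : Prop :=
  σ.arr 8 0 = 0 ∧ ∀ u : Fin n, LinkedTo (σ.arr 8) (σ.arr 9) (σ.reg 3) (σ.arr 7 u) (L u)

/-- The heads of the arcs in `es` that leave `u`. -/
def outNeighbors (es : List (Fin n × Fin n)) (u : Fin n) : List (Fin n) :=
  (es.filter fun e => e.1 = u).map Prod.snd

/-- Arrays `a` and `b` of `σ` hold the endpoints of the arcs `es`. -/
def HoldsArcs (σ : State) (a b : ℕ) (es : List (Fin n × Fin n)) : Prop :=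
  ∀ (i : ℕ) (h : i < es.length), σ.arr a i = (es[i]).1 ∧ σ.arr b i = (es[i]).2

/-- Repeat `p` for all values of register 2 below the value of register `r`. -/
def forProg (r : ℕ) (p : Prog) : Prog :=
  .seq (.assign 2 (.const 0))
    (.while (.lt (.reg 2) (.reg r)) (.seq p (.assign 2 (.succ (.reg 2)))))

/-- The rule for `forProg`: the body `p` must preserve registers 2 and `r`. -/
theorem runs_forProg {r : ℕ} {p : Prog} (hp : p.LoopFree) (I : ℕ → State → Prop)
    (hreg : ∀ i j σ, I i σ → I i (σ.setReg 2 j)) {N : ℕ}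
    (hstep : ∀ i σ, i < N → I i σ → σ.reg 2 = i →
      I (i + 1) (p.effect σ) ∧ (p.effect σ).reg 2 = i)
    (hN : ∀ i σ, I i σ → σ.reg r = N) {σ : State} (h : I 0 σ) :
    Runs (forProg r p) σ ((N + 1) * (p.maxCost + 7)) (I N) := by
  have h1 : Runs (.assign 2 (.const 0)) σ 2 fun τ => I 0 τ ∧ τ.reg 2 = 0 :=
    Prog.LoopFree.runs (p := .assign 2 (.const 0)) trivial
      ⟨hreg _ _ _ h, by simp [Prog.effect, setReg_reg, Expr.eval]⟩
  refine (h1.seq fun τ hτ => runs_for (fun i σ => I i σ ∧ σ.reg 2 = i) N (p.maxCost + 3) ?_ ?_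
    hτ).mono ?_ fun τ hτ => hτ.1
  · rintro i σ hi ⟨hI, h2⟩
    refine ⟨by simpa [Test.Holds, Expr.eval, h2, hN i σ hI] using hi, ?_⟩
    have hlf : (Prog.seq p (.assign 2 (.succ (.reg 2)))).LoopFree := ⟨hp, trivial⟩
    refine hlf.runs (Q := fun σ => I (i + 1) σ ∧ σ.reg 2 = i + 1) ?_
    obtain ⟨h3, h4⟩ := hstep i σ hi hI h2
    exact ⟨hreg _ _ _ h3, by simp [Prog.effect, setReg_reg, Expr.eval, h4]⟩
  · rintro σ ⟨hI, h2⟩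
    simp [Test.Holds, Expr.eval, h2, hN N σ hI]
  · simp only [Test.cost, Expr.cost]
    nlinarith

/-- Add the head of arc number `i` (register 2) to the list of its tail, if the test succeeds. -/
def insertBody (a b : ℕ) (test : Test) : Prog :=
  .ite test
    (.seq (.assign 3 (.succ (.reg 3)))
      (.seq (.store 9 (.reg 3) (.read b (.reg 2)))
        (.seq (.store 8 (.reg 3) (.read 7 (.read a (.reg 2))))
          (.store 7 (.read a (.reg 2)) (.reg 3)))))
    .skip

/-- The states `σ` and `τ` agree outside of the adjacency lists and the loop counter. -/
def AgreeOffLists (σ τ : State) : Prop :=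
  (∀ x, x ≠ 2 → x ≠ 3 → τ.reg x = σ.reg x) ∧ ∀ a, a ≠ 7 → a ≠ 8 → a ≠ 9 → τ.arr a = σ.arr a

theorem insertBody_spec {σ : State} {a b : ℕ} {test : Test} {u w : Fin n}
    {L : Fin n → List (Fin n)} (hL : Lists σ L) (ha : a ≠ 7 ∧ a ≠ 8 ∧ a ≠ 9)
    (hu : σ.arr a (σ.reg 2) = u) (hw : σ.arr b (σ.reg 2) = w) :
    AgreeOffLists σ ((insertBody a b test).effect σ) ∧
      ((insertBody a b test).effect σ).reg 2 = σ.reg 2 ∧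
      Lists ((insertBody a b test).effect σ)
        (if test.Holds σ then Function.update L u (w :: L u) else L) := by
  by_cases ht : test.Holds σ
  · simp only [insertBody, Prog.effect, if_pos ht]
    refine ⟨⟨fun x h2 h3 => ?_, fun c h7 h8 h9 => ?_⟩, ?_, ?_, fun v => ?_⟩
    · simp [setArr_reg, setReg_reg, h3]
    · simp [setArr_arr, setReg_arr, h7, h8, h9]
    · simp [setArr_reg, setReg_reg]
    · simp [setArr_arr, setArr_reg, setReg_reg, setReg_arr, Expr.eval, hL.1]
    · have hold : ∀ x : Fin n, LinkedTo
          (Function.update (σ.arr 8) (σ.reg 3 + 1) (σ.arr 7 u))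
          (Function.update (σ.arr 9) (σ.reg 3 + 1) w) (σ.reg 3 + 1) (σ.arr 7 x) (L x) := fun x =>
        LinkedTo.frame (Nat.le_succ _)
          (fun e he => Function.update_of_ne (by omega) _ _)
          (fun e he => Function.update_of_ne (by omega) _ _) (hL.2 x)
      simp only [setArr_arr, setArr_reg, setReg_reg, setReg_arr, Expr.eval, hu, hw, ha, if_true,
        if_false, reduceIte, Nat.reduceEqDiff]
      by_cases hv : v = u
      · subst hv
        simp only [Function.update_self]
        exact ⟨Nat.succ_ne_zero _, le_rfl, Function.update_self .., by simpa using hold v⟩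
      · have hv' : (v : ℕ) ≠ u := fun e => hv (Fin.ext e)
        simpa only [Function.update_of_ne hv, Function.update_of_ne hv'] using hold v
  · simp only [insertBody, Prog.effect, if_neg ht]
    exact ⟨⟨fun _ _ _ => rfl, fun _ _ _ _ => rfl⟩, trivial, hL⟩

theorem outNeighbors_take_succ {es : List (Fin n × Fin n)} {i : ℕ} (hi : i < es.length)
    (u : Fin n) : outNeighbors (es.take (i + 1)) u =
      outNeighbors (es.take i) u ++ if (es[i]).1 = u then [(es[i]).2] else [] := by
  rw [outNeighbors, ← List.take_concat_get' es i hi, List.filter_append, List.map_append,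
    ← outNeighbors]
  congr 1
  by_cases h : (es[i]).1 = u <;> simp [h]

/-- Inserting all arcs whose heads satisfy `P`. -/
theorem runs_insert {σ : State} {a b : ℕ} {test : Test} {es : List (Fin n × Fin n)}
    {L : Fin n → List (Fin n)} (P : Fin n → Prop) (hL : Lists σ L) (hb : b ≠ 7 ∧ b ≠ 8 ∧ b ≠ 9)
    (ha : a ≠ 7 ∧ a ≠ 8 ∧ a ≠ 9) (hes : HoldsArcs σ a b es) (hm : σ.reg 1 = es.length)
    (htest : ∀ τ, AgreeOffLists σ τ → ∀ w : Fin n, τ.arr b (τ.reg 2) = w → (test.Holds τ ↔ P w)) :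
    Runs (forProg 1 (insertBody a b test)) σ
      ((es.length + 1) * ((insertBody a b test).maxCost + 7)) fun τ => AgreeOffLists σ τ ∧
        Lists τ fun u => ((outNeighbors es u).filter fun w => P w).reverse ++ L u := by
  refine (runs_forProg (r := 1) (p := insertBody a b test) (N := es.length)
    (by simp [insertBody, Prog.LoopFree]) (fun i τ => AgreeOffLists σ τ ∧ Lists τ fun u =>
      ((outNeighbors (es.take i) u).filter fun w => P w).reverse ++ L u)
    ?_ ?_ ?_ ?_).mono le_rfl ?_
  · rintro i j τ ⟨h1, h2⟩
    refine ⟨⟨fun x hx hx' => ?_, fun c h7 h8 h9 => h1.2 c h7 h8 h9⟩, ?_⟩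
    · simpa [setReg_reg, hx] using h1.1 x hx hx'
    · exact ⟨h2.1, fun u => by simpa [setReg_arr, setReg_reg] using h2.2 u⟩
  · rintro i τ hi ⟨h1, h2⟩ hreg
    have hau : τ.arr a (τ.reg 2) = (es[i]).1 := by
      rw [hreg, h1.2 a ha.1 ha.2.1 ha.2.2]; exact (hes i hi).1
    have hbw : τ.arr b (τ.reg 2) = (es[i]).2 := by
      rw [hreg, h1.2 b hb.1 hb.2.1 hb.2.2]; exact (hes i hi).2
    obtain ⟨h3, h4, h5⟩ := insertBody_spec (test := test) h2 ha hau hbw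
    refine ⟨⟨⟨fun x hx hx' => (h3.1 x hx hx').trans (h1.1 x hx hx'), fun c h7 h8 h9 =>
      (h3.2 c h7 h8 h9).trans (h1.2 c h7 h8 h9)⟩, ?_⟩, h4.trans hreg⟩
    convert h5 using 1
    funext u
    rw [outNeighbors_take_succ hi, List.filter_append, List.reverse_append, List.append_assoc,
      htest τ h1 _ hbw]
    by_cases hu : (es[i]).1 = u
    · subst hu
      by_cases hP : P (es[i]).2 <;> simp [hP]
    · by_cases hP : P (es[i]).2 <;> simp [hP, hu, Function.update_of_ne (Ne.symm hu)]
  · rintro i τ ⟨h1, -⟩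
    exact (h1.1 1 (by omega) (by omega)).trans hm
  · exact ⟨⟨fun _ _ _ => rfl, fun _ _ _ _ => rfl⟩, by simpa [outNeighbors] using hL⟩
  · rintro τ ⟨h1, h2⟩
    rw [List.take_length] at h2
    exact ⟨h1, h2⟩

end Programs

/-! ### Preparing the traversal -/

section Preparation

open scoped Classical

variable {n : ℕ}

theorem mem_outNeighbors {es : List (Fin n × Fin n)} {u w : Fin n} :
    w ∈ outNeighbors es u ↔ (u, w) ∈ es := by
  simp only [outNeighbors, List.mem_map, List.mem_filter, decide_eq_true_eq]
  constructor
  · rintro ⟨⟨a, b⟩, ⟨h1, h2⟩, h3⟩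
    simp only at h2 h3
    exact h2 ▸ h3 ▸ h1
  · exact fun h => ⟨(u, w), ⟨h, rfl⟩, rfl⟩

theorem mem_outNeighbors_swap {es : List (Fin n × Fin n)} {u w : Fin n} :
    w ∈ outNeighbors (es.map Prod.swap) u ↔ (w, u) ∈ es := by
  rw [mem_outNeighbors, List.mem_map]
  constructor
  · rintro ⟨⟨a, b⟩, h1, h2⟩
    rw [Prod.swap_prod_mk, Prod.mk.injEq] at h2
    exact h2.1 ▸ h2.2 ▸ h1
  · exact fun h => ⟨(w, u), h, rfl⟩

/-- The neighbors of `u` that satisfy `P`, in the order in which two insertion loops over the edge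
list leave them. -/
noncomputable def neighborList (es : List (Fin n × Fin n)) (P : Fin n → Prop) (u : Fin n) :
    List (Fin n) :=
  ((outNeighbors (es.map Prod.swap) u).filter fun w => P w).reverse ++
    ((outNeighbors es u).filter fun w => P w).reverse

theorem IsEdgeList.adj_iff {T : SimpleGraph (Fin n)} {es : List (Fin n × Fin n)}
    (h : IsEdgeList T es) (u w : Fin n) : T.Adj u w ↔ (u, w) ∈ es ∨ (w, u) ∈ es := by
  rw [h.2, List.mem_map]
  constructor
  · rintro ⟨⟨a, b⟩, h1, h2⟩
    rw [Sym2.eq_iff] at h2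
    rcases h2 with ⟨rfl, rfl⟩ | ⟨rfl, rfl⟩
    exacts [Or.inl h1, Or.inr h1]
  · rintro (h1 | h1)
    exacts [⟨_, h1, rfl⟩, ⟨_, h1, Sym2.eq_swap⟩]

theorem IsEdgeList.mem_neighborList {T : SimpleGraph (Fin n)} {es : List (Fin n × Fin n)}
    (h : IsEdgeList T es) {P : Fin n → Prop} {u w : Fin n} :
    w ∈ neighborList es P u ↔ T.Adj u w ∧ P w := by
  rw [h.adj_iff, neighborList, List.mem_append, List.mem_reverse, List.mem_reverse,
    List.mem_filter, List.mem_filter, mem_outNeighbors_swap, mem_outNeighbors, decide_eq_true_eq]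
  tauto

theorem nodup_outNeighbors {es : List (Fin n × Fin n)} (h : es.Nodup) (u : Fin n) :
    (outNeighbors es u).Nodup := by
  refine List.Nodup.map_on ?_ (h.filter _)
  rintro ⟨a, b⟩ ha ⟨c, d⟩ hc hbd
  simp only [List.mem_filter, decide_eq_true_eq] at ha hc hbd
  rw [ha.2, hc.2, hbd]

theorem IsEdgeList.nodup_neighborList {T : SimpleGraph (Fin n)} {es : List (Fin n × Fin n)}
    (h : IsEdgeList T es) (P : Fin n → Prop) (u : Fin n) : (neighborList es P u).Nodup := by
  have hes : es.Nodup := h.1.of_map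
  refine List.nodup_append.2 ⟨List.nodup_reverse.2 ((nodup_outNeighbors
    (hes.map Prod.swap_injective) u).filter _), List.nodup_reverse.2
    ((nodup_outNeighbors hes u).filter _), ?_⟩
  rintro w hw _ hw' rfl
  have h1 : (w, u) ∈ es := mem_outNeighbors_swap.1 (List.mem_filter.1 (List.mem_reverse.1 hw)).1
  have h2 : (u, w) ∈ es := mem_outNeighbors.1 (List.mem_filter.1 (List.mem_reverse.1 hw')).1
  have h3 := List.inj_on_of_nodup_map h.1 h1 h2 Sym2.eq_swap
  have h4 : T.Adj u w := (h.adj_iff u w).2 (Or.inl h2)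
  exact h4.ne (Prod.mk.injEq .. ▸ h3).2

theorem IsEdgeList.length_neighborList {T : SimpleGraph (Fin n)} {es : List (Fin n × Fin n)}
    (h : IsEdgeList T es) (P : Fin n → Prop) (u : Fin n) :
    (neighborList es P u).length = (Finset.univ.filter fun w => T.Adj u w ∧ P w).card := by
  rw [← List.toFinset_card_of_nodup (h.nodup_neighborList P u)]
  congr 1
  ext w
  simp [h.mem_neighborList]

theorem IsEdgeList.length_add_one {T : SimpleGraph (Fin n)} {es : List (Fin n × Fin n)}
    (h : IsEdgeList T es) (hT : T.IsTree) : es.length + 1 = n := by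
  have h1 := hT.card_edgeFinset
  rw [Fintype.card_fin] at h1
  suffices h2 : es.length = T.edgeFinset.card by rw [h2, h1]
  rw [← List.length_map (f := fun e : Fin n × Fin n => s(e.1, e.2)),
    ← List.toFinset_card_of_nodup h.1]
  congr 1
  ext e
  induction e with
  | _ u v => rw [List.mem_toFinset, SimpleGraph.mem_edgeFinset, SimpleGraph.mem_edgeSet, h.2]

/-- Count both endpoints of edge number `i` (register 2). -/
def degreeBody : Prog :=
  .seq (.store 6 (.read 0 (.reg 2)) (.succ (.read 6 (.read 0 (.reg 2)))))
    (.store 6 (.read 1 (.reg 2)) (.succ (.read 6 (.read 1 (.reg 2)))))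

/-- The states agree outside of array 6 and the loop counter. -/
def AgreeOffDegrees (σ τ : State) : Prop :=
  (∀ x, x ≠ 2 → τ.reg x = σ.reg x) ∧ ∀ a, a ≠ 6 → τ.arr a = σ.arr a

theorem runs_degree {σ : State} {es : List (Fin n × Fin n)} (hes : HoldsArcs σ 0 1 es)
    (hm : σ.reg 1 = es.length) (h6 : ∀ u, σ.arr 6 u = 0) :
    Runs (forProg 1 degreeBody) σ ((es.length + 1) * (degreeBody.maxCost + 7)) fun τ =>
      AgreeOffDegrees σ τ ∧
        ∀ u : Fin n, τ.arr 6 u = (neighborList es (fun _ => True) u).length := by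
  have hlen : ∀ u : Fin n, (neighborList es (fun _ => True) u).length =
      (outNeighbors es u).length + (outNeighbors (es.map Prod.swap) u).length := by
    intro u
    simp [neighborList, Nat.add_comm]
  refine (runs_forProg (r := 1) (p := degreeBody) (N := es.length)
    (by simp [degreeBody, Prog.LoopFree]) (fun i τ => AgreeOffDegrees σ τ ∧ ∀ u : Fin n,
      τ.arr 6 u = (outNeighbors (es.take i) u).length +
        (outNeighbors ((es.map Prod.swap).take i) u).length)
    ?_ ?_ ?_ ?_).mono le_rfl ?_
  · rintro i j τ ⟨h1, h2⟩
    exact ⟨⟨fun x hx => by simpa [setReg_reg, hx] using h1.1 x hx, h1.2⟩, h2⟩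
  · rintro i τ hi ⟨h1, h2⟩ hreg
    have hi' : i < (es.map Prod.swap).length := by simpa using hi
    have hu : τ.arr 0 i = (es[i]).1 := by rw [h1.2 0 (by omega)]; exact (hes i hi).1
    have hw : τ.arr 1 i = (es[i]).2 := by rw [h1.2 1 (by omega)]; exact (hes i hi).2
    refine ⟨⟨⟨fun x hx => ?_, fun a ha => ?_⟩, fun u => ?_⟩, ?_⟩
    · rw [← h1.1 x hx]; simp [degreeBody, Prog.effect, setArr_reg]
    · rw [← h1.2 a ha]; simp [degreeBody, Prog.effect, setArr_arr, ha]
    · rw [outNeighbors_take_succ hi, outNeighbors_take_succ hi', List.length_append,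
        List.length_append]
      simp only [degreeBody, Prog.effect, setArr_arr, setArr_reg, Expr.eval, hreg, if_true,
        reduceIte, hu, hw, Function.update_apply, List.getElem_map,
        Prod.fst_swap, Prod.snd_swap, OfNat.one_ne_ofNat]
      have e1 : ((u : ℕ) = ((es[i]).1 : Fin n)) ↔ (es[i]).1 = u := by rw [Fin.val_inj, eq_comm]
      have e2 : ((u : ℕ) = ((es[i]).2 : Fin n)) ↔ (es[i]).2 = u := by rw [Fin.val_inj, eq_comm]
      have e3 : (((es[i]).2 : ℕ) = ((es[i]).1 : Fin n)) ↔ (es[i]).2 = (es[i]).1 := Fin.val_inj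
      simp only [e1, e2, e3, h2]
      by_cases c1 : (es[i]).1 = u <;> by_cases c2 : (es[i]).2 = u
      · subst c1
        simp [c2]
        omega
      · subst c1
        simp [c2]
        omega
      · subst c2
        simp [c1, Ne.symm c1]
        omega
      · simp [c1, c2]
    · simp [degreeBody, Prog.effect, setArr_reg, hreg]
  · rintro i τ ⟨h1, -⟩
    exact (h1.1 1 (by omega)).trans hm
  · exact ⟨⟨fun _ _ => rfl, fun _ _ => rfl⟩, fun u => by simp [h6, outNeighbors]⟩
  · rintro τ ⟨h1, h2⟩
    refine ⟨h1, fun u => ?_⟩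
    rw [h2, hlen, List.take_length, List.take_of_length_le (by simp)]

/-- Remember vertex number `i` (register 2) in register 4 if it has at least two neighbors, but the
list of its inner neighbors has at most one entry. The leaves must not have been inserted yet. -/
def rootBody : Prog :=
  .ite (.lt (.const 1) (.read 6 (.reg 2)))
    (.ite (.eq (.read 8 (.read 7 (.reg 2))) (.const 0)) (.assign 4 (.reg 2)) .skip) .skip

/-- If the lists contain only inner neighbors, `rootBody` finds a good root provided that there is
one. -/
theorem runs_root {σ : State} {N : ℕ} (hn : σ.reg 0 = N) (h4 : σ.reg 4 < N) :
    Runs (forProg 0 rootBody) σ ((N + 1) * (rootBody.maxCost + 7)) fun τ =>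
      ((∀ x, x ≠ 2 → x ≠ 4 → τ.reg x = σ.reg x) ∧ τ.arr = σ.arr) ∧ τ.reg 4 < N ∧
        ((∃ j < N, 1 < σ.arr 6 j ∧ σ.arr 8 (σ.arr 7 j) = 0) →
          1 < σ.arr 6 (τ.reg 4) ∧ σ.arr 8 (σ.arr 7 (τ.reg 4)) = 0) := by
  refine runs_forProg (r := 0) (p := rootBody) (N := N)
    (by simp [rootBody, Prog.LoopFree]) (fun i τ =>
      ((∀ x, x ≠ 2 → x ≠ 4 → τ.reg x = σ.reg x) ∧ τ.arr = σ.arr) ∧ τ.reg 4 < N ∧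
        ((∃ j < i, 1 < σ.arr 6 j ∧ σ.arr 8 (σ.arr 7 j) = 0) →
          1 < σ.arr 6 (τ.reg 4) ∧ σ.arr 8 (σ.arr 7 (τ.reg 4)) = 0))
    ?_ ?_ ?_ ?_
  · rintro i j τ ⟨h1, h2, h3⟩
    refine ⟨⟨fun x hx hx' => ?_, h1.2⟩, by simpa [setReg_reg] using h2,
      by simpa [setReg_reg] using h3⟩
    simpa [setReg_reg, hx] using h1.1 x hx hx'
  · rintro i τ hi ⟨h1, h2, h3⟩ hreg
    simp only [rootBody, Prog.effect, Test.Holds, Expr.eval, hreg, h1.2]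
    by_cases c1 : 1 < σ.arr 6 i
    · by_cases c2 : σ.arr 8 (σ.arr 7 i) = 0
      · rw [if_pos c1, if_pos c2]
        refine ⟨⟨⟨fun x hx hx' => ?_, h1.2⟩, ?_, fun _ => ?_⟩, ?_⟩
        · simpa [setReg_reg, hx'] using h1.1 x hx hx'
        · simpa [setReg_reg] using hi
        · simpa [setReg_reg] using ⟨c1, c2⟩
        · simpa [setReg_reg] using hreg
      · rw [if_pos c1, if_neg c2]
        refine ⟨⟨h1, h2, ?_⟩, hreg⟩
        rintro ⟨j, hj, g1, g2⟩
        rcases Nat.lt_succ_iff_lt_or_eq.1 hj with hj | rfl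
        · exact h3 ⟨j, hj, g1, g2⟩
        · exact absurd g2 c2
    · rw [if_neg c1]
      refine ⟨⟨h1, h2, ?_⟩, hreg⟩
      rintro ⟨j, hj, g1, g2⟩
      rcases Nat.lt_succ_iff_lt_or_eq.1 hj with hj | rfl
      · exact h3 ⟨j, hj, g1, g2⟩
      · exact absurd g1 c1
  · rintro i τ ⟨h1, -⟩
    exact (h1.1 0 (by omega) (by omega)).trans hn
  · exact ⟨⟨fun _ _ _ => rfl, rfl⟩, h4, fun ⟨j, hj, _⟩ => absurd hj (Nat.not_lt_zero _)⟩

theorem LinkedTo.next_eq_zero_iff {nxt tgt : ℕ → ℕ} {b e : ℕ} {l : List (Fin n)}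
    (h : LinkedTo nxt tgt b e l) (h0 : nxt 0 = 0) : nxt e = 0 ↔ l.length ≤ 1 := by
  match l, h with
  | [], h =>
    have : e = 0 := h
    simp [this, h0]
  | [w], h =>
    have : nxt e = 0 := h.2.2.2
    simp [this]
  | w :: w' :: l, h => simpa using h.2.2.2.1

/-- Repeat the insertion for both orientations of the edges. -/
def insertBoth (test : ℕ → Test) : Prog :=
  .seq (forProg 1 (insertBody 0 1 (test 1))) (forProg 1 (insertBody 1 0 (test 0)))

/-- The head of arc number `i` (register 2), stored in array `b`, has at least two neighbors. -/
def innerTest (b : ℕ) : Test := .lt (.const 1) (.read 6 (.read b (.reg 2)))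

/-- The head of arc number `i` (register 2), stored in array `b`, has exactly one neighbor. -/
def leafTest (b : ℕ) : Test := .eq (.read 6 (.read b (.reg 2))) (.const 1)

/-- Compute the degrees, adjacency lists with all leaves in front of all inner vertices, and a good
root. -/
def prepareProg : Prog :=
  .seq (forProg 1 degreeBody) (.seq (insertBoth innerTest)
    (.seq (forProg 0 rootBody) (insertBoth leafTest)))

/-- The state in which the traversal begins. -/
structure Prepared (T : SimpleGraph (Fin n)) (es : List (Fin n × Fin n)) (ρ : Fin n) (σ : State) :
    Prop where
  root : σ.reg 4 = ρ
  good : 3 ≤ n → IsGoodRoot T ρ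
  pos : ∀ u : Fin n, 1 ≤ σ.arr 6 u
  inner : ∀ u : Fin n, 1 < σ.arr 6 u ↔ IsInner T u
  lists : Lists σ fun u =>
    neighborList es (fun w => ¬ IsInner T w) u ++ neighborList es (IsInner T) u
  zero : ∀ a, 2 ≤ a → a ≤ 5 → ∀ i, σ.arr a i = 0

theorem AgreeOffLists.trans {σ τ υ : State} (h : AgreeOffLists σ τ) (h' : AgreeOffLists τ υ) :
    AgreeOffLists σ υ :=
  ⟨fun x h1 h2 => (h'.1 x h1 h2).trans (h.1 x h1 h2),
    fun a h1 h2 h3 => (h'.2 a h1 h2 h3).trans (h.2 a h1 h2 h3)⟩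

theorem HoldsArcs.swap {σ : State} {a b : ℕ} {es : List (Fin n × Fin n)}
    (h : HoldsArcs σ a b es) : HoldsArcs σ b a (es.map Prod.swap) := by
  intro i hi
  rw [List.length_map] at hi
  simpa using (h i hi).symm

theorem HoldsArcs.agree {σ τ : State} {a b : ℕ} {es : List (Fin n × Fin n)}
    (h : HoldsArcs σ a b es) (ha : τ.arr a = σ.arr a) (hb : τ.arr b = σ.arr b) :
    HoldsArcs τ a b es := by
  intro i hi
  rw [ha, hb]
  exact h i hi

/-- Inserting all arcs of both orientations whose heads satisfy `P`. -/
theorem runs_insertBoth {σ : State} {test : ℕ → Test} {es : List (Fin n × Fin n)}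
    {L : Fin n → List (Fin n)} (P : Fin n → Prop) (hL : Lists σ L) (hes : HoldsArcs σ 0 1 es)
    (hm : σ.reg 1 = es.length)
    (htest : ∀ b τ, AgreeOffLists σ τ → ∀ w : Fin n, τ.arr b (τ.reg 2) = w →
      ((test b).Holds τ ↔ P w)) :
    Runs (insertBoth test) σ ((es.length + 1) * ((insertBody 0 1 (test 1)).maxCost + 7 +
      ((insertBody 1 0 (test 0)).maxCost + 7))) fun τ => AgreeOffLists σ τ ∧
        Lists τ fun u => neighborList es P u ++ L u := by
  refine ((runs_insert P hL (by omega) (by omega) hes hm (htest 1)).seq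
    (t := (es.length + 1) * ((insertBody 1 0 (test 0)).maxCost + 7))
    (R := fun τ => AgreeOffLists σ τ ∧ Lists τ fun u => neighborList es P u ++ L u)
    fun τ hτ => ?_).mono (Nat.mul_add ..).ge fun _ => id
  refine (runs_insert (es := es.map Prod.swap) P hτ.2 (by omega) (by omega)
      (hes.swap.agree (hτ.1.2 1 (by omega) (by omega) (by omega))
        (hτ.1.2 0 (by omega) (by omega) (by omega))) ?_
      fun υ hυ => htest 0 υ (hτ.1.trans hυ)).mono (by rw [List.length_map]) fun υ hυ =>
        ⟨hτ.1.trans hυ.1, ?_⟩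
  · rw [hτ.1.1 1 (by omega) (by omega), hm, List.length_map]
  · simpa only [neighborList, List.append_assoc] using hυ.2

/-- A bound for the number of steps of the preparation, per vertex. -/
def prepareCost : ℕ :=
  degreeBody.maxCost + (insertBody 0 1 (innerTest 1)).maxCost +
    (insertBody 1 0 (innerTest 0)).maxCost + (insertBody 0 1 (leafTest 1)).maxCost +
    (insertBody 1 0 (leafTest 0)).maxCost + 2 * rootBody.maxCost + 49

theorem runs_prepare {T : SimpleGraph (Fin n)} (hT : T.IsTree) (h2 : 2 ≤ n)
    {es : List (Fin n × Fin n)} (hes : IsEdgeList T es) :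
    Runs prepareProg (inputState es) (n * prepareCost) fun τ => ∃ ρ, Prepared T es ρ τ := by
  have hlen := hes.length_add_one hT
  have hm : (inputState es).reg 1 = es.length := by simp [inputState]
  have h0 : (inputState es).reg 0 = n := by simp [inputState]
  have harcs : HoldsArcs (inputState es) 0 1 es := by
    intro i hi
    simp [inputState, hi]
  have hdeg : ∀ u, (neighborList es (fun _ => True) u).length =
      (Finset.univ.filter fun w => T.Adj u w).card := by
    intro u
    rw [hes.length_neighborList]
    congr 1
    ext w
    simp
  have hpos : ∀ u, 1 ≤ (neighborList es (fun _ => True) u).length := by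
    intro u
    have : Nontrivial (Fin n) := Fin.nontrivial_iff_two_le.2 h2
    obtain ⟨w, hw⟩ := hT.connected.preconnected.exists_adj_of_nontrivial u
    rw [hdeg]
    exact Finset.card_pos.2 ⟨w, by simp [hw]⟩
  have hinner : ∀ u, 1 < (neighborList es (fun _ => True) u).length ↔ IsInner T u := by
    intro u
    rw [hdeg, Finset.one_lt_card]
    simp only [Finset.mem_filter, Finset.mem_univ, true_and]
    exact ⟨fun ⟨a, ha, b, hb, hab⟩ => ⟨a, b, hab, ha, hb⟩,
      fun ⟨a, b, hab, ha, hb⟩ => ⟨a, ha, b, hb, hab⟩⟩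
  have hd := runs_degree harcs hm (by simp [inputState])
  refine (hd.seq (t := n * (prepareCost - degreeBody.maxCost - 7))
    (R := fun τ => ∃ ρ, Prepared T es ρ τ) fun τ₁ h₁ => ?_).mono ?_ fun _ => id
  swap
  · rw [hlen, ← Nat.mul_add, prepareCost]
    exact Nat.mul_le_mul_left _ (by omega)
  have hb₁ := runs_insertBoth (σ := τ₁) (test := innerTest) (es := es) (L := fun _ => [])
    (IsInner T) ⟨by rw [h₁.1.2 8 (by omega)]; simp [inputState], fun u => by
      rw [h₁.1.2 7 (by omega)]; simp [inputState, LinkedTo]⟩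
    (harcs.agree (h₁.1.2 0 (by omega)) (h₁.1.2 1 (by omega)))
    ((h₁.1.1 1 (by omega)).trans hm) (by
      intro b τ hτ w hw
      rw [innerTest, Test.Holds, Expr.eval, Expr.eval, Expr.eval, Expr.eval, hw,
        hτ.2 6 (by omega) (by omega) (by omega), h₁.2, hinner])
  refine (hb₁.seq (t := n * (prepareCost - degreeBody.maxCost - 7 -
    ((insertBody 0 1 (innerTest 1)).maxCost + 7 + ((insertBody 1 0 (innerTest 0)).maxCost + 7))))
    (R := fun τ => ∃ ρ, Prepared T es ρ τ) fun τ₂ h₂ => ?_).mono ?_ fun _ => id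
  swap
  · rw [hlen, ← Nat.mul_add, prepareCost]
    exact Nat.mul_le_mul_left _ (by omega)
  have h6 : τ₂.arr 6 = τ₁.arr 6 := h₂.1.2 6 (by omega) (by omega) (by omega)
  have hr := runs_root (σ := τ₂) (N := n)
    (by rw [h₂.1.1 0 (by omega) (by omega), h₁.1.1 0 (by omega), h0])
    (by rw [h₂.1.1 4 (by omega) (by omega), h₁.1.1 4 (by omega)]; simp [inputState]; omega)
  refine (hr.seq (t := n * ((insertBody 0 1 (leafTest 1)).maxCost + 7 +
    ((insertBody 1 0 (leafTest 0)).maxCost + 7)))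
    (R := fun τ => ∃ ρ, Prepared T es ρ τ) fun τ₃ h₃ => ?_).mono ?_ fun _ => id
  swap
  · have : (n + 1) * (rootBody.maxCost + 7) ≤ n * (2 * (rootBody.maxCost + 7)) := by
      rw [← Nat.mul_assoc]
      exact Nat.mul_le_mul_right _ (by omega)
    refine (Nat.add_le_add_right this _).trans ?_
    rw [← Nat.mul_add, prepareCost]
    exact Nat.mul_le_mul_left _ (by omega)
  obtain ⟨⟨hreg₃, harr₃⟩, hρn, hgood⟩ := h₃
  have hreg3 : τ₃.reg 3 = τ₂.reg 3 := hreg₃ 3 (by omega) (by omega)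
  have hb₂ := runs_insertBoth (σ := τ₃) (test := leafTest) (es := es)
    (L := fun u => neighborList es (IsInner T) u) (fun w => ¬ IsInner T w)
    (by
      refine ⟨by rw [harr₃]; exact h₂.2.1, fun u => ?_⟩
      rw [harr₃, hreg3]
      simpa using h₂.2.2 u)
    (harcs.agree (by rw [harr₃, h₂.1.2 0 (by omega) (by omega) (by omega), h₁.1.2 0 (by omega)])
      (by rw [harr₃, h₂.1.2 1 (by omega) (by omega) (by omega), h₁.1.2 1 (by omega)]))
    (by rw [hreg₃ 1 (by omega) (by omega), h₂.1.1 1 (by omega) (by omega), h₁.1.1 1 (by omega), hm])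
    (by
      intro b τ hτ w hw
      rw [leafTest, Test.Holds, Expr.eval, Expr.eval, Expr.eval, Expr.eval, hw,
        hτ.2 6 (by omega) (by omega) (by omega), harr₃, h6, h₁.2, ← hinner]
      have := hpos w
      omega)
  refine hb₂.mono (by rw [hlen]) fun τ₄ h₄ => ⟨⟨τ₃.reg 4, hρn⟩, ?_⟩
  have h6' : τ₄.arr 6 = τ₁.arr 6 := by
    rw [h₄.1.2 6 (by omega) (by omega) (by omega), harr₃, h6]
  refine ⟨h₄.1.1 4 (by omega) (by omega), fun h3 => ?_, fun u => ?_, fun u => ?_, h₄.2, ?_⟩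
  · have hiff : ∀ u : Fin n, (1 < τ₂.arr 6 u ∧ τ₂.arr 8 (τ₂.arr 7 u) = 0) ↔ IsGoodRoot T u := by
      intro u
      rw [h6, h₁.2, hinner, (h₂.2.2 u).next_eq_zero_iff h₂.2.1]
      simp only [List.append_nil]
      rw [hes.length_neighborList, Finset.card_le_one]
      simp only [Finset.mem_filter, Finset.mem_univ, true_and]
      exact and_congr_right fun _ => ⟨fun g a b ha hb ha' hb' => g a ⟨ha, ha'⟩ b ⟨hb, hb'⟩,
        fun g a ha b hb => g a b ha.1 hb.1 ha.2 hb.2⟩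
    obtain ⟨u, hu⟩ := exists_isGoodRoot hT (by simpa using h3)
    exact (hiff ⟨τ₃.reg 4, hρn⟩).1 (hgood ⟨u, u.2, (hiff u).2 hu⟩)
  · rw [h6', h₁.2]; exact hpos u
  · rw [h6', h₁.2]; exact hinner u
  · intro a ha ha' i
    rw [h₄.1.2 a (by omega) (by omega) (by omega), harr₃,
      h₂.1.2 a (by omega) (by omega) (by omega), h₁.1.2 a (by omega)]
    have e0 : a ≠ 0 := by omega
    have e1 : a ≠ 1 := by omega
    simp [inputState, e0, e1]

end Preparation

/-! ### The traversal as a program -/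

section TraversalProgram

open scoped Classical

variable {n : ℕ} {T : SimpleGraph (Fin n)}

theorem Runs.while_true {b : Test} {p : Prog} {σ : State} {s t : ℕ} {Q R : State → Prop}
    (hb : b.Holds σ) (h : Runs p σ s Q) (h' : ∀ τ, Q τ → Runs (.while b p) τ t R) :
    Runs (.while b p) σ (b.cost + s + t) R := by
  obtain ⟨s', τ, h1, h2, h3⟩ := h
  obtain ⟨t', υ, h4, h5, h6⟩ := h' τ h3
  exact ⟨_, υ, .while_true hb h1 h4, by omega, h6⟩

theorem Runs.while_false {b : Test} {p : Prog} {σ : State} {R : State → Prop}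
    (hb : ¬ b.Holds σ) (h : R σ) : Runs (.while b p) σ b.cost R :=
  ⟨_, σ, .while_false hb, le_rfl, h⟩

/-- The array `f` holds the stack `stk`, whose top is the head of the list. -/
def StackAt (f : ℕ → ℕ) : List (Fin n) → Prop
  | [] => True
  | v :: stk => f stk.length = v ∧ StackAt f stk

theorem StackAt.update {f : ℕ → ℕ} {i c : ℕ} : ∀ {stk : List (Fin n)}, stk.length ≤ i →
    StackAt f stk → StackAt (Function.update f i c) stk
  | [], _, _ => trivial
  | _ :: stk, hi, h => ⟨by
      rw [List.length_cons] at hi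
      rw [Function.update_of_ne (by omega)]
      exact h.1, StackAt.update (by rw [List.length_cons] at hi; omega) h.2⟩

/-- Push the vertex in the current list cell (register 8), unless it has been visited. -/
def scanBody : Prog :=
  .seq (.assign 9 (.read 9 (.reg 8)))
    (.seq (.ite (.eq (.read 4 (.succ (.reg 9))) (.const 0))
        (.seq (.store 3 (.succ (.reg 9)) (.reg 6))
          (.seq (.store 10 (.reg 5) (.reg 9)) (.assign 5 (.succ (.reg 5))))) .skip)
      (.assign 8 (.read 8 (.reg 8))))

/-- Push all unvisited vertices of a linked list. -/
def scanProg : Prog := .while (.lt (.const 0) (.reg 8)) scanBody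

/-- What `scanProg` achieves: the vertices `ch` have been pushed onto the stack `stk`. -/
structure Scanned (σ τ : State) (ch stk : List (Fin n)) : Prop where
  sp : τ.reg 5 = (ch ++ stk).length
  stack : StackAt (τ.arr 10) (ch ++ stk)
  lo : ∀ v : Fin n, τ.arr 3 (v + 1) = if v ∈ ch then σ.reg 6 else σ.arr 3 (v + 1)
  reg : ∀ x, x ≠ 5 → x ≠ 8 → x ≠ 9 → τ.reg x = σ.reg x
  arr : ∀ a, a ≠ 3 → a ≠ 10 → τ.arr a = σ.arr a

/-- The scan leaves the unvisited entries of the list on the stack, in reverse order. -/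
theorem runs_scan {b : ℕ} (l : List (Fin n)) : ∀ (σ : State) (stk : List (Fin n)),
    LinkedTo (σ.arr 8) (σ.arr 9) b (σ.reg 8) l → σ.reg 5 = stk.length → StackAt (σ.arr 10) stk →
    Runs scanProg σ (l.length * (scanBody.maxCost + 3) + 3) fun τ =>
      Scanned σ τ (l.filter fun w : Fin n => σ.arr 4 ((w : ℕ) + 1) = 0).reverse stk := by
  induction l with
  | nil =>
    intro σ stk hl hsp hstk
    have hl : σ.reg 8 = 0 := hl
    refine (Runs.while_false (by simp [Test.Holds, Expr.eval, hl]) ?_).mono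
      (by simp [Test.cost, Expr.cost]) fun _ => id
    exact ⟨by simpa using hsp, by simpa using hstk, by simp, fun _ _ _ _ => rfl, fun _ _ _ => rfl⟩
  | cons w l ih =>
    intro σ stk hl hsp hstk
    obtain ⟨h1, h2, h3, h4⟩ := hl
    have hlf : scanBody.LoopFree := by simp [scanBody, Prog.LoopFree]
    -- the effect of one round
    have hbody : LinkedTo ((scanBody.effect σ).arr 8) ((scanBody.effect σ).arr 9) b
        ((scanBody.effect σ).reg 8) l ∧
        Scanned σ (scanBody.effect σ) (if σ.arr 4 ((w : ℕ) + 1) = 0 then [w] else []) stk := by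
      by_cases hw : σ.arr 4 (w + 1) = 0
      · rw [if_pos hw]
        simp only [scanBody, Prog.effect, Test.Holds, Expr.eval, setReg_reg, setReg_arr, setArr_reg,
          setArr_arr, h3, hw, reduceIte, Nat.reduceEqDiff]
        refine ⟨h4, ?_, ?_, ?_, ?_, ?_⟩
        · simp [setReg_reg, hsp]
        · simp only [setReg_arr, setArr_arr, reduceIte, Nat.reduceEqDiff, hsp,
            List.cons_append, List.nil_append]
          exact ⟨Function.update_self .., hstk.update le_rfl⟩
        · intro v
          simp only [setReg_arr, setArr_arr, reduceIte, Nat.reduceEqDiff,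
            Function.update_apply, Nat.add_right_cancel_iff, Fin.val_inj, List.mem_singleton]
        · intro x h5 h8 h9
          simp [setReg_reg, setArr_reg, h5, h8, h9]
        · intro a ha3 ha10
          simp [setReg_arr, setArr_arr, ha3, ha10]
      · rw [if_neg hw]
        simp only [scanBody, Prog.effect, Test.Holds, Expr.eval, setReg_reg, setReg_arr,
          h3, hw, reduceIte, Nat.reduceEqDiff]
        refine ⟨h4, ?_, ?_, ?_, ?_, ?_⟩
        · simp [setReg_reg, hsp]
        · simpa [setReg_arr] using hstk
        · simp [setReg_arr]
        · intro x h5 h8 h9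
          simp [setReg_reg, h8, h9]
        · intro a _ _
          rfl
    obtain ⟨hlist, hone⟩ := hbody
    refine (Runs.while_true (by simpa [Test.Holds, Expr.eval] using Nat.pos_of_ne_zero h1)
      (hlf.runs (Q := fun τ => τ = scanBody.effect σ) rfl)
      (t := l.length * (scanBody.maxCost + 3) + 3) ?_).mono ?_ fun _ => id
    · rintro _ rfl
      refine (ih _ _ hlist hone.sp hone.stack).mono le_rfl fun τ hτ => ?_
      rw [hone.arr 4 (by omega) (by omega)] at hτ
      have hch : ((w :: l).filter fun x : Fin n => σ.arr 4 ((x : ℕ) + 1) = 0).reverse =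
          (l.filter fun x : Fin n => σ.arr 4 ((x : ℕ) + 1) = 0).reverse ++
            if σ.arr 4 ((w : ℕ) + 1) = 0 then [w] else [] := by
        by_cases hw : σ.arr 4 (w + 1) = 0 <;> simp [hw]
      rw [hch]
      refine ⟨by rw [List.append_assoc]; exact hτ.sp, by rw [List.append_assoc]; exact hτ.stack,
        fun v => ?_, fun x h5 h8 h9 => (hτ.reg x h5 h8 h9).trans (hone.reg x h5 h8 h9),
        fun a ha hb => (hτ.arr a ha hb).trans (hone.arr a ha hb)⟩
      rw [hτ.lo, hone.lo, hone.reg 6 (by omega) (by omega) (by omega)]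
      simp only [List.mem_append]
      split_ifs <;> tauto
    · simp only [Test.cost, Expr.cost, List.length_cons, Nat.add_mul, Nat.one_mul]
      omega

/-- Pop a vertex, move it to register 7 and set its output pointer. -/
def popProg : Prog :=
  .seq (.assign 5 (.pred (.reg 5)))
    (.seq (.assign 7 (.read 10 (.reg 5))) (.store 2 (.reg 7) (.succ (.reg 7))))

/-- Close the interval of a leaf. -/
def leafProg : Prog := .store 4 (.succ (.reg 7)) (.reg 6)

/-- Close the interval of an inner vertex and go to its adjacency list. -/
def openProg : Prog :=
  .seq (.store 4 (.succ (.reg 7)) (.succ (.reg 6))) (.assign 8 (.read 7 (.reg 7)))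

/-- Use one point, and another one if the top of the stack is a leaf. -/
def countProg : Prog :=
  .seq (.assign 6 (.succ (.reg 6)))
    (.ite (.eq (.read 6 (.read 10 (.pred (.reg 5)))) (.const 1)) (.assign 6 (.succ (.reg 6))) .skip)

/-- Visit the vertex on top of the stack. -/
def visitProg : Prog :=
  .seq popProg (.ite (.eq (.read 6 (.reg 7)) (.const 1)) leafProg
    (.seq openProg (.seq scanProg countProg)))

/-- The memory state `σ` represents a state of the traversal. -/
structure Represents (ρ : Fin n) (par : Fin n → Fin n) (L : Fin n → List (Fin n)) (σ : State)
    (D : Finset (Fin n)) (stk : List (Fin n)) (lo hi : Fin n → ℕ) (cnt : ℕ) : Prop where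
  sp : σ.reg 5 = stk.length
  count : σ.reg 6 = cnt
  stack : StackAt (σ.arr 10) stk
  left : ∀ v : Fin n, σ.arr 3 (v + 1) = lo v
  right : ∀ v : Fin n, σ.arr 4 (v + 1) = hi v
  visited : ∀ v, hi v = 0 ↔ v ∉ D
  pointer : ∀ v ∈ D, σ.arr 2 v = v + 1
  last : ∀ i, σ.arr 5 i = 0
  leaf : ∀ v : Fin n, σ.arr 6 v = 1 ↔ IsLeafOf ρ par v
  lists : Lists σ L

/-- The lists `L` contain the neighbors of each vertex, leaves first. When such a list is pushed
onto the stack, an inner vertex ends up on top unless all entries are leaves. -/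
structure LeavesFirst (T : SimpleGraph (Fin n)) (L : Fin n → List (Fin n)) : Prop where
  nodup : ∀ v, (L v).Nodup
  mem : ∀ v w, w ∈ L v ↔ T.Adj v w
  split : ∀ v, ∃ A B, L v = A ++ B ∧ (∀ w ∈ A, ¬ IsInner T w) ∧ ∀ w ∈ B, IsInner T w

theorem not_isLeafOf_of_isInner {ρ : Fin n} {par : Fin n → Fin n} {dep : Fin n → ℕ}
    (hr : IsRooted T ρ par dep) {v : Fin n} (hv : IsInner T v) : ¬ IsLeafOf ρ par v := by
  intro hl
  have key : ∀ x, T.Adj v x → par v = x := fun x hx =>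
    ((hr.adj_iff _ _).1 hx).elim And.right fun h => absurd h.2 (hl.2 x h.1)
  obtain ⟨a, b, hab, ha, hb⟩ := hv
  exact hab ((key a ha).symm.trans (key b hb))

/-- A visit carries out one step of the traversal. The children of the visited vertex are its
neighbors whose right end is still `0`. -/
theorem runs_visit {ρ : Fin n} {par : Fin n → Fin n} {dep : Fin n → ℕ}
    (hr : IsRooted T ρ par dep) (hρ : ∃ c, c ≠ ρ ∧ par c = ρ) {L : Fin n → List (Fin n)}
    (hL : LeavesFirst T L) {σ : State} {D : Finset (Fin n)} {v : Fin n} {stk : List (Fin n)}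
    {lo hi : Fin n → ℕ} {cnt : ℕ} (ht : Traversal T ρ par D (v :: stk) lo hi cnt)
    (hσ : Represents ρ par L σ D (v :: stk) lo hi cnt) :
    Runs visitProg σ (popProg.maxCost + 4 + leafProg.maxCost + openProg.maxCost +
      countProg.maxCost + 3 + (L v).length * (scanBody.maxCost + 3)) fun τ =>
      ∃ stk' lo' hi' cnt', Traversal T ρ par (insert v D) stk' lo' hi' cnt' ∧
        Represents ρ par L τ (insert v D) stk' lo' hi' cnt' := by
  have hvD : v ∉ D := ht.disj v (by simp)
  have hcnt : 0 < cnt := (Nat.zero_le _).trans_lt (ht.lo_lt v (by simp))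
  have hchild : ¬ IsLeafOf ρ par v → ∃ c, c ≠ ρ ∧ par c = v := by
    intro hv
    by_cases hvρ : v = ρ
    · rw [hvρ]; exact hρ
    · by_contra hcon
      push Not at hcon
      exact hv ⟨hvρ, hcon⟩
  have hvis : ∀ c (hi' : Fin n → ℕ), hi' v = c → 0 < c → (∀ w, w ≠ v → hi' w = hi w) →
      ∀ w, hi' w = 0 ↔ w ∉ insert v D := by
    intro c hi' h1 h2 h3 w
    by_cases hw : w = v
    · subst hw
      simp only [Finset.mem_insert_self, not_true_eq_false, iff_false]
      omega
    · rw [h3 w hw, hσ.visited, Finset.mem_insert, not_or]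
      exact ⟨fun g => ⟨hw, g⟩, And.right⟩
  -- after popping
  have hpop : ∀ τ, τ = popProg.effect σ → τ.reg 5 = stk.length ∧ τ.reg 7 = v ∧
      (∀ x, x ≠ 5 → x ≠ 7 → τ.reg x = σ.reg x) ∧ (∀ a, a ≠ 2 → τ.arr a = σ.arr a) ∧
      ∀ w ∈ insert v D, τ.arr 2 w = w + 1 := by
    rintro _ rfl
    have h10 : σ.arr 10 stk.length = v := hσ.stack.1
    simp only [popProg, Prog.effect, Expr.eval, setReg_reg, setReg_arr, setArr_reg,
      setArr_arr, reduceIte, Nat.reduceEqDiff, hσ.sp, List.length_cons, Nat.add_sub_cancel, h10]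
    refine ⟨trivial, trivial, fun x h5 h7 => by simp [h5, h7], fun a ha => by simp [ha], ?_⟩
    intro w hw
    by_cases hwv : w = v
    · subst hwv; simp
    · have hwD : w ∈ D := (Finset.mem_insert.1 hw).resolve_left hwv
      rw [Function.update_of_ne (fun e => hwv (Fin.ext e))]
      exact hσ.pointer w hwD
  refine ((Prog.LoopFree.runs (p := popProg) (σ := σ) (by simp [popProg, Prog.LoopFree])
    (Q := fun τ => τ = popProg.effect σ) rfl).seq (t := 4 + (leafProg.maxCost +
      (openProg.maxCost + ((L v).length * (scanBody.maxCost + 3) + 3 + countProg.maxCost))))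
    fun τ hτ => Runs.ite (fun hb => ?_) fun hb => ?_).mono (by omega) fun _ => id
  all_goals
    obtain ⟨p5, p7, preg, parr, p2⟩ := hpop τ hτ
    clear hτ
    simp only [Test.Holds, Expr.eval, p7, parr 6 (by omega), hσ.leaf] at hb
  · refine (Prog.LoopFree.runs (p := leafProg) (by simp [leafProg, Prog.LoopFree]) ?_).mono
      (Nat.le_add_right _ _) fun _ => id
    have hnew : Traversal T ρ par (insert v D) stk lo (Function.update hi v cnt) cnt := by
      convert ht.leaf_step hr hb (Function.update_self ..) fun w hw => Function.update_of_ne hw ..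
    refine ⟨stk, lo, Function.update hi v cnt, cnt, hnew, ?_⟩
    simp only [leafProg, Prog.effect, Expr.eval]
    refine ⟨p5, ?_, ?_, fun w => ?_, fun w => ?_, ?_, fun w hw => ?_, fun i => ?_, fun w => ?_, ?_⟩
    · rw [setArr_reg, preg 6 (by omega) (by omega)]; exact hσ.count
    · simp only [setArr_arr, reduceIte, Nat.reduceEqDiff, parr 10 (by omega)]; exact hσ.stack.2
    · simp only [setArr_arr, reduceIte, Nat.reduceEqDiff, parr 3 (by omega)]; exact hσ.left w
    · simp only [setArr_arr, reduceIte, p7, preg 6 (by omega) (by omega), parr 4 (by omega),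
        Function.update_apply, Nat.add_right_cancel_iff, Fin.val_inj, hσ.count, hσ.right]
    · exact hvis cnt _ (by simp) hcnt fun w hw => by simp [hw]
    · simp only [setArr_arr, reduceIte, Nat.reduceEqDiff]; exact p2 w hw
    · simp only [setArr_arr, reduceIte, Nat.reduceEqDiff, parr 5 (by omega)]; exact hσ.last i
    · simp only [setArr_arr, reduceIte, Nat.reduceEqDiff, parr 6 (by omega)]; exact hσ.leaf w
    · simp only [Lists, setArr_arr, setArr_reg, reduceIte, Nat.reduceEqDiff, parr 7 (by omega),
        parr 8 (by omega), parr 9 (by omega), preg 3 (by omega) (by omega)]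
      exact hσ.lists
  · -- `τ₁` is the state in which the scan begins
    refine ((Prog.LoopFree.runs (p := openProg) (by simp [openProg, Prog.LoopFree])
      (Q := fun τ₁ => τ₁ = openProg.effect τ) rfl).seq fun τ₁ hτ₁ => ?_).mono
      (Nat.le_add_left _ _) fun _ => id
    obtain ⟨o8, oreg, o4, oarr⟩ : τ₁.reg 8 = τ.arr 7 v ∧ (∀ x, x ≠ 8 → τ₁.reg x = τ.reg x) ∧
        (∀ w : Fin n, τ₁.arr 4 (w + 1) = if w = v then cnt + 1 else hi w) ∧
        ∀ a, a ≠ 4 → τ₁.arr a = τ.arr a := by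
      rw [hτ₁]
      simp only [openProg, Prog.effect, Expr.eval, setReg_reg, setReg_arr, setArr_reg,
        setArr_arr, reduceIte, Nat.reduceEqDiff, p7]
      refine ⟨trivial, fun x hx => by simp [hx], fun w => ?_, fun a ha => by simp [ha]⟩
      simp only [preg 6 (by omega) (by omega), parr 4 (by omega),
        Function.update_apply, Nat.add_right_cancel_iff, Fin.val_inj, hσ.count, hσ.right]
    clear hτ₁
    have hlink : LinkedTo (τ₁.arr 8) (τ₁.arr 9) (σ.reg 3) (τ₁.reg 8) (L v) := by
      rw [o8, oarr 8 (by omega), oarr 9 (by omega), parr 7 (by omega), parr 8 (by omega),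
        parr 9 (by omega)]
      exact hσ.lists.2 v
    refine ((runs_scan (L v) τ₁ stk hlink (by rw [oreg 5 (by omega), p5])
      (by rw [oarr 10 (by omega), parr 10 (by omega)]; exact hσ.stack.2)).seq
      fun τ₂ hτ₂ => Prog.LoopFree.runs (p := countProg) (by simp [countProg, Prog.LoopFree]) ?_)
    set ch := ((L v).filter fun w : Fin n => τ₁.arr 4 ((w : ℕ) + 1) = 0).reverse with hch
    have hmem : ∀ c, c ∈ ch ↔ c ≠ ρ ∧ par c = v := by
      intro c
      rw [hch, List.mem_reverse, List.mem_filter, hL.mem, decide_eq_true_eq, o4]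
      constructor
      · rintro ⟨hvc, h0⟩
        have hcv : c ≠ v := hvc.ne'
        rw [if_neg hcv, hσ.visited] at h0
        rcases (hr.adj_iff _ _).1 hvc with ⟨h1, h2⟩ | h1
        · exact absurd (h2 ▸ ht.par_pending v (by simp) h1) h0
        · exact h1
      · rintro ⟨hc, hcv⟩
        have hvc : T.Adj v c := (hr.adj_iff _ _).2 (Or.inr ⟨hc, hcv⟩)
        refine ⟨hvc, ?_⟩
        rw [if_neg hvc.ne', hσ.visited]
        exact fun hcD => hvD (hcv ▸ ht.par_visited c hcD hc)
    have hhead : ¬ IsLastInner ρ par v → ∃ t rest, ch = t :: rest ∧ ¬ IsLeafOf ρ par t := by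
      intro hl
      have : ∃ c, c ≠ ρ ∧ par c = v ∧ ¬ IsLeafOf ρ par c := by
        by_contra hcon
        push Not at hcon
        exact hl ⟨hb, hcon⟩
      obtain ⟨c, hcρ, hcv, hcl⟩ := this
      obtain ⟨A, B, hAB, hA, hB⟩ := hL.split v
      have hcc : c ∈ ch := (hmem c).2 ⟨hcρ, hcv⟩
      have hci : IsInner T c := isInner_of_not_isLeafOf hr hcρ hcl
      rw [hch, hAB, List.filter_append, List.reverse_append] at hcc ⊢
      have hcB : c ∈ (B.filter fun w : Fin n => τ₁.arr 4 ((w : ℕ) + 1) = 0).reverse := by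
        refine (List.mem_append.1 hcc).resolve_right fun h => ?_
        exact hA c (List.mem_filter.1 (List.mem_reverse.1 h)).1 hci
      cases hB' : (B.filter fun w : Fin n => τ₁.arr 4 ((w : ℕ) + 1) = 0).reverse with
      | nil => rw [hB'] at hcB; simp at hcB
      | cons t rest =>
        refine ⟨t, _, List.cons_append .., not_isLeafOf_of_isInner hr (hB t ?_)⟩
        have : t ∈ (B.filter fun w : Fin n => τ₁.arr 4 ((w : ℕ) + 1) = 0).reverse := by
          rw [hB']; simp
        exact (List.mem_filter.1 (List.mem_reverse.1 this)).1
    have h6 : τ₂.arr 6 = σ.arr 6 := by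
      rw [hτ₂.arr 6 (by omega) (by omega), oarr 6 (by omega), parr 6 (by omega)]
    have hcnt₂ : τ₂.reg 6 = cnt := by
      rw [hτ₂.reg 6 (by omega) (by omega) (by omega), oreg 6 (by omega),
        preg 6 (by omega) (by omega), hσ.count]
    -- the top of the stack is a leaf exactly if all children of `v` are leaves
    have htop : τ₂.arr 6 (τ₂.arr 10 (τ₂.reg 5 - 1)) = 1 ↔ IsLastInner ρ par v := by
      obtain ⟨c, hc⟩ := hchild hb
      have hcc : c ∈ ch := (hmem c).2 hc
      cases hch' : ch with
      | nil => rw [hch'] at hcc; simp at hcc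
      | cons t rest =>
        have hs := hτ₂.stack
        rw [hτ₂.sp, hch', List.cons_append, List.length_cons, Nat.add_sub_cancel, h6]
        rw [hch'] at hs
        rw [show τ₂.arr 10 (rest ++ stk).length = t from hs.1, hσ.leaf]
        constructor
        · intro htl
          by_contra hl
          obtain ⟨t', rest', h1, h2⟩ := hhead hl
          rw [hch'] at h1
          exact h2 ((List.cons.inj h1).1 ▸ htl)
        · intro hl
          have := (hmem t).1 (by rw [hch']; simp)
          exact hl.2 t this.1 this.2
    have hcount : ∀ υ, υ = countProg.effect τ₂ →
        υ.reg 6 = (if IsLastInner ρ par v then cnt + 2 else cnt + 1) ∧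
        (∀ x, x ≠ 6 → υ.reg x = τ₂.reg x) ∧ υ.arr = τ₂.arr := by
      rintro _ rfl
      simp only [countProg, Prog.effect, Test.Holds, Expr.eval, setReg_reg, setReg_arr, reduceIte,
        Nat.reduceEqDiff, htop, hcnt₂]
      by_cases hl : IsLastInner ρ par v
      · simp only [if_pos hl]
        exact ⟨by simp [setReg_reg], fun x hx => by simp [setReg_reg, hx], rfl⟩
      · simp only [if_neg hl]
        exact ⟨by simp [setReg_reg], fun x hx => by simp [setReg_reg, hx], rfl⟩
    obtain ⟨c6, creg, carr⟩ := hcount _ rfl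
    have hnew : Traversal T ρ par (insert v D) (ch ++ stk) (fun w => if w ∈ ch then cnt else lo w)
        (Function.update hi v (cnt + 1)) (if IsLastInner ρ par v then cnt + 2 else cnt + 1) := by
      convert ht.inner_step hr hb (List.nodup_reverse.2 ((hL.nodup v).filter _)) hmem hhead
        (fun c hc => if_pos hc) (fun c hc => if_neg hc) (Function.update_self ..)
        (fun w hw => Function.update_of_ne hw ..) rfl
    refine ⟨ch ++ stk, fun w => if w ∈ ch then cnt else lo w, Function.update hi v (cnt + 1), _,
      hnew, ?_⟩
    have a4 : τ₂.arr 4 = τ₁.arr 4 := hτ₂.arr 4 (by omega) (by omega)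
    have aold : ∀ a, a ≠ 2 → a ≠ 3 → a ≠ 4 → a ≠ 10 → (countProg.effect τ₂).arr a = σ.arr a := by
      intro a h2 h3 h4 h10
      rw [carr, hτ₂.arr a h3 h10, oarr a h4, parr a h2]
    refine ⟨?_, c6, ?_, fun w => ?_, fun w => ?_, ?_, fun w hw => ?_, fun i => ?_, fun w => ?_, ?_⟩
    · rw [creg 5 (by omega)]; exact hτ₂.sp
    · rw [carr]; exact hτ₂.stack
    · rw [carr, hτ₂.lo, oreg 6 (by omega), preg 6 (by omega) (by omega), hσ.count,
        oarr 3 (by omega), parr 3 (by omega), hσ.left]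
    · rw [carr, a4, o4, Function.update_apply]
    · exact hvis (cnt + 1) _ (by simp) (Nat.succ_pos _) fun w hw => by simp [hw]
    · rw [carr, hτ₂.arr 2 (by omega) (by omega), oarr 2 (by omega)]; exact p2 w hw
    · rw [aold 5 (by omega) (by omega) (by omega) (by omega)]; exact hσ.last i
    · rw [aold 6 (by omega) (by omega) (by omega) (by omega)]; exact hσ.leaf w
    · rw [Lists, aold 7 (by omega) (by omega) (by omega) (by omega),
        aold 8 (by omega) (by omega) (by omega) (by omega),
        aold 9 (by omega) (by omega) (by omega) (by omega), creg 3 (by omega),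
        hτ₂.reg 3 (by omega) (by omega) (by omega), oreg 3 (by omega), preg 3 (by omega) (by omega)]
      exact hσ.lists

end TraversalProgram

/-! ### The linear-time algorithm -/

section Algorithm

open scoped Classical

variable {n : ℕ} {T : SimpleGraph (Fin n)}

/-- Push the root, whose degree is increased so that it never counts as a leaf. -/
def startProg : Prog :=
  .seq (.store 6 (.reg 4) (.succ (.read 6 (.reg 4))))
    (.seq (.store 10 (.const 0) (.reg 4)) (.seq (.assign 5 (.const 1)) (.assign 6 (.const 1))))

/-- Visit vertices until the stack is empty. -/
def traverseProg : Prog := .while (.lt (.const 0) (.reg 5)) visitProg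

/-- The algorithm. Arrays 0 and 1 hold the input and arrays 2 to 5 the output, where the interval of
vertex `v` is cell `v + 1`; array 6 holds the degrees, arrays 7 to 9 the adjacency lists, array 10
the stack. Register 2 is a loop counter, register 3 counts the list cells, register 4 holds the
root, register 5 the height of the stack, register 6 the next unused point, register 7 the current
vertex, and registers 8 and 9 a list cell and its entry. The only vertex of a one-vertex tree gets
the empty set, which is the initial value of its pointer. -/
def overlapProg : Prog :=
  .ite (.lt (.const 1) (.reg 0)) (.seq prepareProg (.seq startProg traverseProg)) .skip

theorem leavesFirst_neighborList {es : List (Fin n × Fin n)} (hes : IsEdgeList T es) :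
    LeavesFirst T fun u =>
      neighborList es (fun w => ¬ IsInner T w) u ++ neighborList es (IsInner T) u where
  nodup u := List.nodup_append.2 ⟨hes.nodup_neighborList _ u, hes.nodup_neighborList _ u, by
    rintro a ha _ hb rfl
    exact (hes.mem_neighborList.1 ha).2 (hes.mem_neighborList.1 hb).2⟩
  mem u w := by
    rw [List.mem_append, hes.mem_neighborList, hes.mem_neighborList]
    tauto
  split u := ⟨_, _, rfl, fun _ hw => (hes.mem_neighborList.1 hw).2,
    fun _ hw => (hes.mem_neighborList.1 hw).2⟩

/-- The handshake lemma. -/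
theorem LeavesFirst.sum_length {L : Fin n → List (Fin n)} (hL : LeavesFirst T L) (hT : T.IsTree) :
    ∑ v, (L v).length + 2 = 2 * n := by
  have h1 : ∀ v, (L v).length = T.degree v := by
    intro v
    rw [← List.toFinset_card_of_nodup (hL.nodup v), ← T.card_neighborFinset_eq_degree]
    congr 1
    ext w
    rw [List.mem_toFinset, hL.mem, T.mem_neighborFinset]
  have h2 := hT.card_edgeFinset
  rw [Fintype.card_fin] at h2
  rw [Finset.sum_congr rfl fun v _ => h1 v, T.sum_degrees_eq_twice_card_edges]
  omega

/-- The state before the first visit. The increased degree of the root does not matter elsewhere,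
because degrees only serve to recognize leaves. -/
theorem runs_start {es : List (Fin n × Fin n)} {ρ : Fin n} {par : Fin n → Fin n} {dep : Fin n → ℕ}
    (hr : IsRooted T ρ par dep) {σ : State} (hσ : Prepared T es ρ σ) :
    Runs startProg σ startProg.maxCost fun τ => Represents ρ par (fun u =>
      neighborList es (fun w => ¬ IsInner T w) u ++ neighborList es (IsInner T) u) τ ∅ [ρ]
        (fun _ => 0) (fun _ => 0) 1 := by
  refine Prog.LoopFree.runs (by simp [startProg, Prog.LoopFree]) ?_
  have hz : ∀ a, 2 ≤ a → a ≤ 5 → ∀ i, (startProg.effect σ).arr a i = 0 := by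
    intro a h2 h5 i
    have h6 : a ≠ 6 := by omega
    have h10 : a ≠ 10 := by omega
    simpa [startProg, Prog.effect, setReg_arr, setArr_arr, h6, h10] using hσ.zero a h2 h5 i
  refine ⟨?_, ?_, ⟨?_, trivial⟩, fun v => hz 3 (by omega) (by omega) _,
    fun v => hz 4 (by omega) (by omega) _, by simp, by simp, hz 5 (by omega) le_rfl,
    fun v => ?_, ?_⟩
  · simp [startProg, Prog.effect, setReg_reg, Expr.eval]
  · simp [startProg, Prog.effect, setReg_reg, Expr.eval]
  · simp [startProg, Prog.effect, setReg_arr, setArr_arr, setArr_reg, Expr.eval, hσ.root]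
  · simp only [startProg, Prog.effect, setReg_arr, setArr_arr, Expr.eval, hσ.root,
      reduceIte, Nat.reduceEqDiff, Function.update_apply, Fin.val_inj]
    have h1 := hσ.pos v
    have h2 := hσ.inner v
    by_cases hv : v = ρ
    · subst hv
      rw [if_pos rfl]
      exact ⟨fun h => by omega, fun h => absurd rfl h.1⟩
    · rw [if_neg hv]
      constructor
      · intro h
        by_contra hl
        have := h2.2 (isInner_of_not_isLeafOf hr hv hl)
        omega
      · intro hl
        by_contra h
        exact not_isLeafOf_of_isInner hr (h2.1 (by omega)) hl
  · have hl := hσ.lists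
    simpa [Lists, startProg, Prog.effect, setReg_arr, setReg_reg, setArr_arr, setArr_reg,
      Expr.eval] using hl

/-- A bound for the number of steps that a visit takes, apart from the scan. -/
def visitCost : ℕ :=
  popProg.maxCost + 4 + leafProg.maxCost + openProg.maxCost + countProg.maxCost + 3

/-- The number of remaining steps is bounded by a sum over the unvisited vertices. -/
theorem runs_traverse {ρ : Fin n} {par : Fin n → Fin n} {dep : Fin n → ℕ}
    (hr : IsRooted T ρ par dep) (hρ : ∃ c, c ≠ ρ ∧ par c = ρ) {L : Fin n → List (Fin n)}
    (hL : LeavesFirst T L) {σ : State}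
    (hσ : Represents ρ par L σ ∅ [ρ] (fun _ => 0) (fun _ => 0) 1) :
    Runs traverseProg σ (∑ v, (3 + visitCost + (L v).length * (scanBody.maxCost + 3)) + 3)
      fun τ => ∃ D lo hi cnt, Traversal T ρ par D [] lo hi cnt ∧
        Represents ρ par L τ D [] lo hi cnt := by
  refine (runs_while (b := .lt (.const 0) (.reg 5)) (p := visitProg)
    (fun (D : Finset (Fin n)) σ => ∃ stk lo hi cnt, Traversal T ρ par D stk lo hi cnt ∧
      Represents ρ par L σ D stk lo hi cnt)
    (fun D => ∑ v ∈ Dᶜ, (3 + visitCost + (L v).length * (scanBody.maxCost + 3)) + 3)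
    ?_ ?_ (i := ∅) ⟨_, _, _, _, Traversal.start rfl, hσ⟩).mono
    (by rw [Finset.compl_empty]) fun _ => id
  · rintro D σ ⟨stk, lo, hi, cnt, ht, hs⟩ hb
    match stk, ht, hs with
    | [], _, hs => simp [Test.Holds, Expr.eval, hs.sp] at hb
    | v :: stk, ht, hs =>
      refine ⟨_, (runs_visit hr hρ hL ht hs).mono le_rfl fun τ hτ => ⟨insert v D, hτ, ?_⟩⟩
      have hv : v ∈ Dᶜ := Finset.mem_compl.2 (ht.disj v (by simp))
      rw [Finset.compl_insert, ← Finset.add_sum_erase _ _ hv]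
      simp only [Test.cost, Expr.cost, visitCost]
      omega
  · rintro D σ ⟨stk, lo, hi, cnt, ht, hs⟩ hb
    refine ⟨?_, by simp [Test.cost, Expr.cost]⟩
    match stk, ht, hs with
    | [], ht, hs => exact ⟨D, lo, hi, cnt, ht, hs⟩
    | v :: stk, _, hs => simp [Test.Holds, Expr.eval, hs.sp] at hb

theorem Represents.outputs {ρ : Fin n} {par : Fin n → Fin n} {dep : Fin n → ℕ}
    (hr : IsRooted T ρ par dep) {L : Fin n → List (Fin n)} {σ : State} {D : Finset (Fin n)}
    {lo hi : Fin n → ℕ} {cnt : ℕ} (ht : Traversal T ρ par D [] lo hi cnt)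
    (hσ : Represents ρ par L σ D [] lo hi cnt) : Outputs σ fun v => Finset.Ico (lo v) (hi v) := by
  intro v
  have hv : v ∈ D := by rw [ht.visited_eq_univ hr]; exact Finset.mem_univ v
  have h : EncodesSet σ (v + 1) (Finset.Ico (σ.arr 3 (v + 1)) (σ.arr 4 (v + 1)) ∪ ∅) :=
    .cons (Nat.succ_ne_zero _) (by rw [hσ.left, hσ.right]; exact ht.lo_lt_hi v hv)
      (by rw [hσ.last]; exact .nil) (Finset.disjoint_empty_right _)
  rw [Finset.union_empty, hσ.left, hσ.right] at h
  rwa [hσ.pointer v hv]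

/-- The number of steps of the algorithm per vertex. -/
def overlapCost : ℕ :=
  7 + prepareCost + startProg.maxCost + visitCost + 2 * (scanBody.maxCost + 3) + 6

theorem overlapProg_producesOptimalRep (hT : T.IsTree) :
    ProducesOptimalRep overlapProg T (overlapCost * n) := by
  intro es hes
  have hn : 1 ≤ n := by
    obtain ⟨v⟩ := hT.connected.nonempty
    exact v.pos
  suffices h : Runs overlapProg (inputState es) (overlapCost * n) fun σ =>
      ∃ f : Fin n → Finset ℕ, Outputs σ f ∧ IsOverlapRep T f ∧ size f = overlapNumber T by
    obtain ⟨s, σ, h1, h2, f, h3⟩ := h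
    exact ⟨s, σ, f, h1, h2, h3⟩
  have h0 : (inputState es).reg 0 = n := by simp [inputState]
  refine (Runs.ite (b := .lt (.const 1) (.reg 0)) (t := n * (overlapCost - 3)) (fun hb => ?_)
    fun hb => ?_).mono ?_ fun _ => id
  · have h2 : 1 < n := by simpa [Test.Holds, Expr.eval, h0] using hb
    refine ((runs_prepare hT h2 hes).seq (t := n * (overlapCost - 3 - prepareCost))
      fun σ hσ => ?_).mono ?_ fun _ => id
    swap
    · rw [← Nat.mul_add]
      exact Nat.mul_le_mul_left _ (by rw [overlapCost]; omega)
    obtain ⟨ρ, hσ⟩ := hσ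
    obtain ⟨par, dep, hr⟩ := exists_isRooted hT ρ
    have hρ : ∃ c, c ≠ ρ ∧ par c = ρ := by
      have : Nontrivial (Fin n) := Fin.nontrivial_iff_two_le.2 h2
      obtain ⟨c, hc⟩ := hT.connected.preconnected.exists_adj_of_nontrivial ρ
      exact ⟨c, ((hr.adj_iff _ _).1 hc).resolve_left fun g => g.1 rfl⟩
    have hL := leavesFirst_neighborList hes
    refine ((runs_start hr hσ).seq fun τ hτ => runs_traverse hr hρ hL hτ).mono ?_ ?_
    · have hsum := hL.sum_length hT
      rw [Finset.sum_add_distrib, ← Finset.sum_mul, Finset.sum_const, Finset.card_univ,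
        Fintype.card_fin, smul_eq_mul]
      have h3 : overlapCost - 3 - prepareCost = startProg.maxCost + (3 + visitCost) +
        2 * (scanBody.maxCost + 3) + 7 := by rw [overlapCost]; omega
      rw [h3]
      generalize startProg.maxCost = a
      generalize 3 + visitCost = b
      generalize scanBody.maxCost + 3 = c at *
      have h4 := Nat.mul_le_mul_right c (Nat.le_of_add_right_le hsum.le)
      have h5 : a ≤ n * a := Nat.le_mul_of_pos_left _ hn
      nlinarith
    · rintro τ ⟨D, lo, hi, cnt, ht, hs⟩
      refine ⟨_, hs.outputs hr ht, ht.isOverlapRep hr, ?_⟩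
      exact size_eq_overlapNumber (fun g hg => weight_le_size hT (by rwa [Fintype.card_fin]) hr
        (by simpa using hσ.good) hg) (ht.isOverlapRep hr) (ht.size_le_weight hr)
  · have h1 : n = 1 := by
      simp only [Test.Holds, Expr.eval, h0] at hb
      omega
    have hrep : IsOverlapRep T fun _ => ∅ := by
      intro u v
      have : Subsingleton (Fin n) := Fin.subsingleton_iff_le_one.2 h1.le
      exact ⟨fun h => absurd (Subsingleton.elim u v) h.ne, fun h => absurd h.1 (by simp)⟩
    refine ⟨1, _, .skip _, ?_, fun _ => ∅, fun v => ?_, hrep, ?_⟩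
    · rw [h1, Nat.one_mul, overlapCost]
      omega
    · have : (inputState es).arr 2 v = 0 := by simp [inputState]
      rw [this]
      exact .nil
    · exact size_eq_overlapNumber (k := 0) (fun _ _ => Nat.zero_le _) hrep (by
        rw [size, Finset.card_eq_zero.2]
        · ext x; simp)
  · simp only [Test.cost, Expr.cost]
    have : overlapCost * n = n * (overlapCost - 3) + n * 3 := by
      rw [← Nat.mul_add, Nat.mul_comm, overlapCost]
      congr 1
    omega

end Algorithm
end OverlapTree

theorem theorem2 :
    (∀ (V : Type*) [Fintype V] (T : SimpleGraph V), T.IsTree → 3 ≤ Fintype.card V →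
      (∃ S : T.Subgraph, OverlapTree.IsLargestSkeleton T S) ∧
        ∀ S : T.Subgraph, OverlapTree.IsLargestSkeleton T S →
          OverlapTree.overlapNumber T = S.verts.ncard) ∧
    ∃ (p : OverlapTree.Prog) (C : ℕ), ∀ (n : ℕ) (T : SimpleGraph (Fin n)), T.IsTree →
      OverlapTree.ProducesOptimalRep p T (C * n) :=
  ⟨fun _ _ _ hT h3 => ⟨OverlapTree.exists_isLargestSkeleton hT,
    fun _ hS => OverlapTree.overlapNumber_eq_ncard hT h3 hS⟩,
    OverlapTree.overlapProg, OverlapTree.overlapCost,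
    fun _ _ hT => OverlapTree.overlapProg_producesOptimalRep hT⟩
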